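/- Let $C_0>c>0$ and let $q(x)\in C^{11}(\mathbb R)$ be real-valued with $q(x)\to 0$ as $x\to+\infty$, $q(x)\to -c^2$ as $x\to-\infty$, $$\int_0^{+\infty} e^{C_0x}\bigl(|q(x)|+|q(-x)+c^2|\bigr)dx<\infty ,\qquad \int_{\mathbb R}(x^6+1)|q^{(i)}(x)|\,dx<\infty\quad (1\le i\le 11).$$ Let $q(x,t)$, $(x,t)\in\mathbb R\times\mathbb R$, be the solution of $q_t=6qq_x-q_{xxx}$, $q(x,0)=q(x)$; that is, a classical solution with $q(\cdot,t)\in C^3(\mathbb R)$, with $\partial_x^iq$ ($0\le i\le 3$) continuous in $(x,t)$, and with $\int_0^{+\infty}|x|(|q(x,t)|+|q(-x,t)+c^2|)dx$ finite for all $t$ and bounded for $t$ in compact sets. Put $H(t)=-\frac{d^2}{dx^2}+q(\cdot,t)$ on $H^2(\mathbb R)\subset L^2(\mathbb R)$. For $\operatorname{Im}k_1\ge 0$ let $k=\sqrt{k_1^2-c^2}$ be the branch that is continuous on $\operatorname{Im}k_1\ge0$ and maps $\operatorname{Im}k_1>0$ into $\operatorname{Im}k>0$ (so $k_1=\sqrt{k^2+c^2}$).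 Let $\phi(k_1,x,t)$ and $\phi_1(k_1,x,t)$ be the Jost solutions, i.e. the solutions of $H(t)\psi=k^2\psi$ with $\lim_{x\to+\infty}e^{-ikx}\phi=1$ and $\lim_{x\to-\infty}e^{ik_1x}\phi_1=1$, let $W=\phi_1\phi'-\phi_1'\phi$ (with $'=\partial_x$) be their Wronskian, $T_1(k_1,t)=2ik_1/W(k_1,t)$ the left transmission coefficient, and let the left reflection coefficient $R_1(k_1,t)$, $k_1\in\mathbb R$, be defined by $T_1\phi=\overline{\phi_1}+R_1\phi_1$; write $R_1(k_1)=R_1(k_1,0)$. Assume that $H(0)$ is nonresonant: $W\ne0$ at $k_1=0$ (that is, $k=ic$), $t=0$. Then $H(0)$ has only finitely many eigenvalues below $-c^2$. Write them as $-(\kappa_{1,j}^2+c^2)$, $1\le j\le N$, with $0<\kappa_{1,1}<\dots<\kappa_{1,N}$, and let $\gamma_{1,j}=\|\phi_1(i\kappa_{1,j},\cdot,0)\|_{L^2}^{-1}$. Let $0<\varepsilon<\frac14\min_{1\le j\le N}|\kappa_{1,j}-\kappa_{1,j-1}|$, $\kappa_{1,0}=0$ (any $\varepsilon>0$ if $N=0$),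 and let $\mathbb T_j^U$, $\mathbb T_j^L$ be the circles of radius $\varepsilon$ around $i\kappa_{1,j}$ and $-i\kappa_{1,j}$. Fix $x\in\mathbb R$ and $t\in\mathbb R\setminus\{0\}$ and put $$\Phi_1(k_1)=-8ik_1^3+12ic^2k_1-24i\xi k_1,\qquad \xi=\frac{x}{12t}.$$ Define the row vector $$m(k_1)=\begin{cases}\bigl(T_1(k_1,t)\phi(k_1,x,t)e^{-ik_1x},\ \ \phi_1(k_1,x,t)e^{ik_1x}\bigr),&\operatorname{Im}k_1>0,\\ \bigl(\phi_1(-k_1,x,t)e^{-ik_1x},\ \ T_1(-k_1,t)\phi(-k_1,x,t)e^{ik_1x}\bigr),&\operatorname{Im}k_1<0,\end{cases}$$ and redefine it inside the small discs by replacing $m(k_1)$ with $$m(k_1)\begin{pmatrix}1&0\\-\frac{i\gamma_{1,j}^2e^{t\Phi_1(i\kappa_{1,j})}}{k_1-i\kappa_{1,j}}&1\end{pmatrix}\ \text{if } |k_1-i\kappa_{1,j}|<\varepsilon,\qquad m(k_1)\begin{pmatrix}1&\frac{i\gamma_{1,j}^2e^{t\Phi_1(i\kappa_{1,j})}}{k_1+i\kappa_{1,j}}\\0&1\end{pmatrix}\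 \text{if } |k_1+i\kappa_{1,j}|<\varepsilon,$$ with the limiting values at the centres $\pm i\kappa_{1,j}$. Then $m$ solves the following vector Riemann–Hilbert problem: $m$ is holomorphic in $\mathbb C\setminus\bigl(\mathbb R\cup\bigcup_{j=1}^N(\mathbb T_j^U\cup\mathbb T_j^L)\bigr)$ and satisfies 1. the jump condition: the limits $m_\pm$ of $m$ from the left ($+$) and right ($-$) side of the contour exist at each of its points, and $m_+(k_1)=m_-(k_1)v(k_1)$ with $$v(k_1)=\begin{cases}\begin{pmatrix}1-|R_1(k_1)|^2&-\overline{R_1(k_1)}e^{-t\Phi_1(k_1)}\\R_1(k_1)e^{t\Phi_1(k_1)}&1\end{pmatrix},&k_1\in\mathbb R\setminus[-c,c],\\[3mm]\begin{pmatrix}0&-\overline{R_1(k_1)}e^{-t\Phi_1(k_1)}\\R_1(k_1)e^{t\Phi_1(k_1)}&1\end{pmatrix},&k_1\in[-c,c],\\[3mm]\begin{pmatrix}1&0\\-\frac{i\gamma_{1,j}^2e^{t\Phi_1(i\kappa_{1,j})}}{k_1-i\kappa_{1,j}}&1\end{pmatrix},&k_1\in\mathbb T_j^U,\\[3mm]\begin{pmatrix}1&-\frac{i\gamma_{1,j}^2e^{-t\Phi_1(-i\kappa_{1,j})}}{k_1+i\kappa_{1,j}}\\0&1\end{pmatrix},&k_1\in\mathbb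 T_j^L,\end{cases}$$ where $\mathbb R$ is oriented from left to right, $\mathbb T_j^U$ counterclockwise and $\mathbb T_j^L$ clockwise; 2. the symmetry condition $m(-k_1)=m(k_1)\begin{pmatrix}0&1\\1&0\end{pmatrix}$ off the contour; 3. the normalization condition $\lim_{\kappa\to+\infty}m(i\kappa)=(1\quad1)$. -/

import Mathlib

open Filter Topology MeasureTheory

noncomputable section

namespace StepKdV

/-! ### The Cauchy problem -/

/-- Admissible steplike initial data: `q₀ ∈ C¹¹(ℝ)`, `q₀ → 0` at `+∞`, `q₀ → -c²` at `-∞`,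
exponential decay of the perturbation with rate `C₀`, and integrability of
`(x⁶ + 1) |q₀⁽ⁱ⁾(x)|` for `i = 1, …, 11`. -/
structure SteplikeData (c C₀ : ℝ) (q₀ : ℝ → ℝ) : Prop where
  smooth : ContDiff ℝ 11 q₀
  right_limit : Tendsto q₀ atTop (𝓝 0)
  left_limit : Tendsto q₀ atBot (𝓝 (-c ^ 2))
  exp_decay : IntegrableOn
    (fun x : ℝ => Real.exp (C₀ * x) * (|q₀ x| + |q₀ (-x) + c ^ 2|)) (Set.Ioi 0)
  deriv_decay : ∀ i : ℕ, 1 ≤ i → i ≤ 11 →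
    Integrable (fun x : ℝ => (x ^ 6 + 1) * |iteratedDeriv i q₀ x|)

/-- The (classical) steplike solutions `q(x,t)`, `(x,t) ∈ ℝ × ℝ`, of the Korteweg-de Vries
equation `q_t = 6 q q_x - q_xxx`: `q(·,t) ∈ C³` with `x`-derivatives up to order three
continuous in `(x,t)`, and the first moment of the perturbation is finite for every `t`,
locally bounded in `t`. -/
structure IsKdVSolution (c : ℝ) (q : ℝ → ℝ → ℝ) : Prop where
  smooth : ∀ t, ContDiff ℝ 3 (fun x => q x t)
  continuous_deriv : ∀ i : ℕ, i ≤ 3 →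
    Continuous (fun p : ℝ × ℝ => iteratedDeriv i (fun x => q x p.2) p.1)
  kdv : ∀ x t, HasDerivAt (fun s => q x s)
    (6 * q x t * deriv (fun y => q y t) x - iteratedDeriv 3 (fun y => q y t) x) t
  moment_integrable : ∀ t, IntegrableOn
    (fun x : ℝ => |x| * (|q x t| + |q (-x) t + c ^ 2|)) (Set.Ioi 0)
  moment_bounded : ∀ τ : ℝ, ∃ M : ℝ, ∀ t, |t| ≤ τ →
    ∫ x in Set.Ioi (0 : ℝ), |x| * (|q x t| + |q (-x) t + c ^ 2|) ≤ M

/-! ### Scattering theory of `-d²/dx² + q` for a fixed steplike potential `q` -/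

/-- `ψ` is a classical solution of `-ψ'' + q ψ = E ψ`. -/
def IsSchrodingerSolution (q : ℝ → ℝ) (E : ℂ) (ψ : ℝ → ℂ) : Prop :=
  ContDiff ℝ 2 ψ ∧ ∀ x, -deriv (deriv ψ) x + (q x : ℂ) * ψ x = E * ψ x

/-- `E` is an eigenvalue of `-d²/dx² + q` on `H²(ℝ) ⊆ L²(ℝ)`. (For continuous `q` the
eigenfunctions are `C²`.) -/
def IsEigenvalue (q : ℝ → ℝ) (E : ℝ) : Prop :=
  ∃ ψ : ℝ → ℂ, ψ ≠ 0 ∧ IsSchrodingerSolution q E ψ ∧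
    MemLp ψ 2 volume ∧ MemLp (deriv ψ) 2 volume ∧ MemLp (deriv (deriv ψ)) 2 volume

/-- `k = √(k₁² - c²)`, the inverse of `k₁ = √(k² + c²)`. With principal square roots this is
the branch that is analytic in `Im k₁ > 0` with values in `Im k > 0`, continuous on
`Im k₁ ≥ 0`. -/
def kOf (c : ℝ) (k₁ : ℂ) : ℂ :=
  (k₁ - c) ^ (1 / 2 : ℂ) * (k₁ + c) ^ (1 / 2 : ℂ)

/-- The right Jost solution: `-ψ'' + q ψ = k² ψ`, `e^{-ikx} ψ(x) → 1` as `x → +∞`. -/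
def IsRightJost (q : ℝ → ℝ) (k : ℂ) (ψ : ℝ → ℂ) : Prop :=
  IsSchrodingerSolution q (k ^ 2) ψ ∧
    Tendsto (fun x : ℝ => Complex.exp (-Complex.I * k * x) * ψ x) atTop (𝓝 1)

/-- The left Jost solution: `-ψ'' + q ψ = (k₁² - c²) ψ`, `e^{i k₁ x} ψ(x) → 1` as `x → -∞`. -/
def IsLeftJost (q : ℝ → ℝ) (c : ℝ) (k₁ : ℂ) (ψ : ℝ → ℂ) : Prop :=
  IsSchrodingerSolution q (k₁ ^ 2 - c ^ 2) ψ ∧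
    Tendsto (fun x : ℝ => Complex.exp (Complex.I * k₁ * x) * ψ x) atBot (𝓝 1)

/-- The right Jost solution `φ`, as a function of `k₁`. -/
def jostRight (q : ℝ → ℝ) (c : ℝ) (k₁ : ℂ) : ℝ → ℂ :=
  Classical.epsilon (IsRightJost q (kOf c k₁))

/-- The left Jost solution `φ₁`, as a function of `k₁`. -/
def jostLeft (q : ℝ → ℝ) (c : ℝ) (k₁ : ℂ) : ℝ → ℂ :=
  Classical.epsilon (IsLeftJost q c k₁)

/-- The Wronskian `W = φ₁ φ' - φ₁' φ` of the Jost solutions; it does not depend on `x` and is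
evaluated at `x = 0`. -/
def jostWronskian (q : ℝ → ℝ) (c : ℝ) (k₁ : ℂ) : ℂ :=
  jostLeft q c k₁ 0 * deriv (jostRight q c k₁) 0 - deriv (jostLeft q c k₁) 0 * jostRight q c k₁ 0

/-- The left transmission coefficient `T₁ = 2 i k₁ / W`. -/
def leftTransmission (q : ℝ → ℝ) (c : ℝ) (k₁ : ℂ) : ℂ :=
  2 * Complex.I * k₁ / jostWronskian q c k₁

/-- The left reflection coefficient `R₁(k₁)`, `k₁ ∈ ℝ`: the number for which the scattering
relation `T₁ φ = conj φ₁ + R₁ φ₁` holds. -/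
def leftReflection (q : ℝ → ℝ) (c : ℝ) (k₁ : ℝ) : ℂ :=
  Classical.epsilon fun r : ℂ => ∀ x : ℝ,
    leftTransmission q c k₁ * jostRight q c k₁ x =
      (starRingEnd ℂ) (jostLeft q c k₁ x) + r * jostLeft q c k₁ x

/-- The numbers `κ₁ > 0` for which `-(κ₁² + c²)` is an eigenvalue. -/
def leftDiscreteSpectrum (q : ℝ → ℝ) (c : ℝ) : Set ℝ :=
  {κ₁ | 0 < κ₁ ∧ IsEigenvalue q (-(κ₁ ^ 2 + c ^ 2))}

/-- The left normalizing constant `γ₁ = ‖φ₁(iκ₁, ·)‖₂⁻¹`. -/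
def leftNorming (q : ℝ → ℝ) (c : ℝ) (κ₁ : ℝ) : ℝ :=
  (Real.sqrt (∫ x : ℝ, ‖jostLeft q c (Complex.I * κ₁) x‖ ^ 2))⁻¹

/-- `Φ₁(k₁) = -8 i k₁³ + 12 i c² k₁ - 24 i ξ k₁` with `ξ = x / (12 t)`. -/
def phase (c x t : ℝ) (k₁ : ℂ) : ℂ :=
  -8 * Complex.I * k₁ ^ 3 + 12 * Complex.I * c ^ 2 * k₁
    - 24 * Complex.I * ((x / (12 * t) : ℝ) : ℂ) * k₁

/-! ### The vector function -/

/-- The row vector built from the left Jost data of the potential `q` (at the given time); its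
value for real `k₁` is irrelevant. -/
def leftVector (q : ℝ → ℝ) (c x : ℝ) (k₁ : ℂ) : Fin 2 → ℂ :=
  if 0 < k₁.im then
    ![leftTransmission q c k₁ * jostRight q c k₁ x * Complex.exp (-Complex.I * k₁ * x),
      jostLeft q c k₁ x * Complex.exp (Complex.I * k₁ * x)]
  else if k₁.im < 0 then
    ![jostLeft q c (-k₁) x * Complex.exp (-Complex.I * k₁ * x),
      leftTransmission q c (-k₁) * jostRight q c (-k₁) x * Complex.exp (Complex.I * k₁ * x)]
  else 0

/-- The vector function for `q(·,t)`, redefined in the (disjoint) discs of radius `ε` around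
`± i κ_j`: it is multiplied there by
`!![1, 0; - i γ_j² e^{tΦ₁(iκ_j)} / (k₁ - iκ_j), 1]` (upper discs) and by
`!![1, i γ_j² e^{tΦ₁(iκ_j)} / (k₁ + iκ_j); 0, 1]` (lower discs). -/
def redefinedVector {N : ℕ} (q : ℝ → ℝ → ℝ) (c x t ε : ℝ) (κ γ : Fin N → ℝ) (k₁ : ℂ) :
    Fin 2 → ℂ :=
  if 0 < k₁.im then
    Matrix.vecMul (leftVector (fun y => q y t) c x k₁)
      !![1, 0;
        -∑ j, if ‖k₁ - Complex.I * κ j‖ < ε then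
          Complex.I * γ j ^ 2 * Complex.exp (t * phase c x t (Complex.I * κ j))
            / (k₁ - Complex.I * κ j) else 0, 1]
  else
    Matrix.vecMul (leftVector (fun y => q y t) c x k₁)
      !![1, ∑ j, if ‖k₁ + Complex.I * κ j‖ < ε then
          Complex.I * γ j ^ 2 * Complex.exp (t * phase c x t (Complex.I * κ j))
            / (k₁ + Complex.I * κ j) else 0;
        0, 1]

open Classical in
/-- The vector function `m(k₁) = m(k₁,x,t)`: at the centres `± i κ_j` of the discs, where the
formula is not defined, it takes its limit. -/
def rhVector {N : ℕ} (q : ℝ → ℝ → ℝ) (c x t ε : ℝ) (κ γ : Fin N → ℝ) (k₁ : ℂ) : Fin 2 → ℂ :=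
  if ∃ j, k₁ = Complex.I * κ j ∨ k₁ = -(Complex.I * κ j) then
    limUnder (𝓝[≠] k₁) (redefinedVector q c x t ε κ γ)
  else redefinedVector q c x t ε κ γ k₁

/-! ### The Riemann-Hilbert problem -/

/-- `m₊(k) = m₋(k) v`, where `m₊(k)` and `m₋(k)` are the limits of `m` at `k` from the region
`P` on the positive and the region `M` on the negative side of the contour. -/
def HasJump (m : ℂ → Fin 2 → ℂ) (P M : Set ℂ) (k : ℂ) (v : Matrix (Fin 2) (Fin 2) ℂ) : Prop :=
  ∃ mp mm : Fin 2 → ℂ, Tendsto m (𝓝[P] k) (𝓝 mp) ∧ Tendsto m (𝓝[M] k) (𝓝 mm) ∧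
    mp = Matrix.vecMul mm v

/-- The union of `ℝ` and of the circles of radius `ε` around `± i κ_j`. -/
def contour {N : ℕ} (ε : ℝ) (κ : Fin N → ℝ) : Set ℂ :=
  {k | k.im = 0} ∪
    ⋃ j, (Metric.sphere (Complex.I * κ j) ε ∪ Metric.sphere (-(Complex.I * κ j)) ε)

/-- `m` solves the vector Riemann-Hilbert problem with data `R₁`, `(κ_j, γ_j)`. The real line is
oriented from left to right, the circles around `iκ_j` counterclockwise (positive side: the
interior), those around `-iκ_j` clockwise (positive side: the exterior). -/
structure SolvesRHP {N : ℕ} (c x t ε : ℝ) (R₁ : ℝ → ℂ) (κ γ : Fin N → ℝ)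
    (m : ℂ → Fin 2 → ℂ) : Prop where
  holomorphic : DifferentiableOn ℂ m (contour ε κ)ᶜ
  jump_outer : ∀ s : ℝ, s ∉ Set.Icc (-c) c →
    HasJump m {z | 0 < z.im} {z | z.im < 0} (s : ℂ)
      !![1 - (‖R₁ s‖ : ℂ) ^ 2, -(starRingEnd ℂ) (R₁ s) * Complex.exp (-t * phase c x t s);
        R₁ s * Complex.exp (t * phase c x t s), 1]
  jump_inner : ∀ s : ℝ, s ∈ Set.Icc (-c) c →
    HasJump m {z | 0 < z.im} {z | z.im < 0} (s : ℂ)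
      !![0, -(starRingEnd ℂ) (R₁ s) * Complex.exp (-t * phase c x t s);
        R₁ s * Complex.exp (t * phase c x t s), 1]
  jump_upper : ∀ j, ∀ k ∈ Metric.sphere (Complex.I * κ j) ε,
    HasJump m (Metric.ball (Complex.I * κ j) ε) (Metric.closedBall (Complex.I * κ j) ε)ᶜ k
      !![1, 0;
        -(Complex.I * γ j ^ 2 * Complex.exp (t * phase c x t (Complex.I * κ j))
          / (k - Complex.I * κ j)), 1]
  jump_lower : ∀ j, ∀ k ∈ Metric.sphere (-(Complex.I * κ j)) ε,
    HasJump m (Metric.closedBall (-(Complex.I * κ j)) ε)ᶜ (Metric.ball (-(Complex.I * κ j)) ε) k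
      !![1, -(Complex.I * γ j ^ 2 * Complex.exp (-t * phase c x t (-(Complex.I * κ j)))
          / (k + Complex.I * κ j));
        0, 1]
  symmetry : ∀ k ∈ (contour ε κ)ᶜ, m (-k) = Matrix.vecMul (m k) !![0, 1; 1, 0]
  normalization : Tendsto (fun s : ℝ => m (Complex.I * s)) atTop (𝓝 ![1, 1])

end StepKdV

end

noncomputable section
namespace StepKdV

/-! ### Integrals over half-lines -/

section Tails

variable {E : Type*} [NormedAddCommGroup E]

/-! Everything is read off from explicitly constructed Jost solutions. With `φ = e^{ikx} m` the
Schrödinger equation reads `m'' + 2ik m' = V m`. The Volterra equation for `m` is solved by a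
Neumann series that converges uniformly for `Im k ≥ 0`, including `k = 0`, under a finite first
moment alone. Hence `m` and `m'` are continuous in `k` on the closed half-plane and holomorphic
inside (`continuousOn_jostM`, `differentiableOn_jostM`). The normalization at infinity determines
the solution (`eq_jost`), so the choices made by `Classical.epsilon` are these functions. The left
solution is the right one of the reflected potential `q(-x) + c²`.

At a fixed time the problem is governed by the Wronskian `W`. It has no real zeros: for `k₁ ≠ 0` by
a sign argument (`wronskian_ne_zero_of_real`), at `k₁ = 0` by nonresonance. Its zeros in the upper
half-plane are the points `iκ` belonging to eigenvalues, and they are simple because `W'(iκ) = 2iκ μ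
‖φ₁‖²` when `φ = μ φ₁` (`hasDerivAt_wronskian`). So `T₁` has simple poles there, and the triangular
factors in the discs remove them. The relation `T₁ φ = conj φ₁ + R₁ φ₁` and its conjugate are the
jump on the real line (`jump_real`); on `[-c, c]` the solution `φ` is real, which forces `|R₁| = 1`.
The symmetry is built into the vector, and the normalization is a high-energy estimate.

The time dependence comes from the Lax pair: `φ_t = P φ - 4ik³ φ` for the right solution. Since no
decay of the `x`-derivatives of `q(·,t)` is assumed, this cannot be obtained by simply letting `x →
∞`. Instead, `φ(0,t)` and `φ'(0,t)` are Wronskians of `φ` with solutions having fixed Cauchy data at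
`x = 0`. These Wronskians are limits of averages against a bump on `[n, n+1]`, and integration by
parts removes every derivative of the potential from the error (`integral_testFun_laxP`, `pairing`).
The Jost data at `x = 0` therefore obey a linear system in `t` (`LaxFlow`) whose Wronskians evolve
by pure exponentials. This gives the evolution of `W`, `T₁`, `R₁` and of the constants `μ`, and with
the factors `e^{± ik₁x}` the exponentials combine to `e^{tΦ₁}` (`mul_phase`). -/

theorem integrableOn_Ioi_of_continuous {g : ℝ → E} (hg : Continuous g) {a : ℝ}
    (h : IntegrableOn g (Set.Ioi a)) (b : ℝ) : IntegrableOn g (Set.Ioi b) := by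
  refine (((hg.integrableOn_Icc (a := b) (b := a)).union h)).mono_set ?_
  intro y hy
  by_cases hya : y ≤ a
  · exact Or.inl ⟨le_of_lt hy, hya⟩
  · exact Or.inr (not_le.mp hya)

variable [NormedSpace ℝ E]

theorem integral_Ioi_eq_sub {g : ℝ → E} (hg : Continuous g) {a : ℝ}
    (h : IntegrableOn g (Set.Ioi a)) (x : ℝ) :
    ∫ y in Set.Ioi x, g y = (∫ y in Set.Ioi a, g y) - ∫ y in a..x, g y := by
  rw [← intervalIntegral.integral_Ioi_sub_Ioi' h (integrableOn_Ioi_of_continuous hg h x)]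
  abel

theorem hasDerivAt_integral_Ioi [CompleteSpace E] {g : ℝ → E} (hg : Continuous g) {a : ℝ}
    (h : IntegrableOn g (Set.Ioi a)) (x : ℝ) :
    HasDerivAt (fun x => ∫ y in Set.Ioi x, g y) (-g x) x := by
  have h1 : (fun x => ∫ y in Set.Ioi x, g y) =
      fun x => (∫ y in Set.Ioi a, g y) - ∫ y in a..x, g y := by
    funext x; exact integral_Ioi_eq_sub hg h x
  rw [h1]
  have h2 := intervalIntegral.integral_hasDerivAt_right (hg.intervalIntegrable a x)
    (hg.stronglyMeasurableAtFilter _ _) hg.continuousAt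
  simpa using h2.const_sub (∫ y in Set.Ioi a, g y)

end Tails

/-! ### Potentials with a finite first moment -/

/-- Continuous potentials with a finite first moment at `+∞`. -/
structure ShortRange (V : ℝ → ℝ) : Prop where
  cont : Continuous V
  moment : IntegrableOn (fun y => y * |V y|) (Set.Ioi 0)

/-- `∫_x^∞ |V|`. -/
def tail (V : ℝ → ℝ) (x : ℝ) : ℝ := ∫ y in Set.Ioi x, |V y|

/-- `∫_x^∞ ∫_y^∞ |V|`. -/
def tailTwo (V : ℝ → ℝ) (x : ℝ) : ℝ := ∫ y in Set.Ioi x, tail V y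

/-- The weight controlling the Jost solution on `[x, ∞)`. -/
def weight (V : ℝ → ℝ) (x : ℝ) : ℝ := Real.exp (2 * tailTwo V x)

variable {V : ℝ → ℝ}

theorem tail_nonneg (V : ℝ → ℝ) (x : ℝ) : 0 ≤ tail V x :=
  integral_nonneg fun _ => abs_nonneg _

theorem tailTwo_nonneg (V : ℝ → ℝ) (x : ℝ) : 0 ≤ tailTwo V x :=
  integral_nonneg fun _ => tail_nonneg V _

theorem one_le_weight (V : ℝ → ℝ) (x : ℝ) : 1 ≤ weight V x :=
  Real.one_le_exp (by have := tailTwo_nonneg V x; positivity)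

theorem weight_pos (V : ℝ → ℝ) (x : ℝ) : 0 < weight V x := Real.exp_pos _

namespace ShortRange

theorem integrableOn_abs (hV : ShortRange V) (x : ℝ) : IntegrableOn (fun y => |V y|) (Set.Ioi x) := by
  refine integrableOn_Ioi_of_continuous hV.cont.abs (a := 1) ?_ x
  refine Integrable.mono' (hV.moment.mono_set (Set.Ioi_subset_Ioi zero_le_one))
    hV.cont.abs.aestronglyMeasurable.restrict ?_
  refine (ae_restrict_iff' measurableSet_Ioi).2 (Eventually.of_forall fun y hy => ?_)
  have hy : (1 : ℝ) < y := hy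
  rw [Real.norm_eq_abs, abs_abs]
  nlinarith [abs_nonneg (V y)]

theorem hasDerivAt_tail (hV : ShortRange V) (x : ℝ) : HasDerivAt (tail V) (-|V x|) x :=
  hasDerivAt_integral_Ioi hV.cont.abs (hV.integrableOn_abs 0) x

theorem continuous_tail (hV : ShortRange V) : Continuous (tail V) :=
  continuous_iff_continuousAt.2 fun x => (hV.hasDerivAt_tail x).continuousAt

theorem tail_antitone (hV : ShortRange V) : Antitone (tail V) :=
  antitone_of_hasDerivAt_nonpos (f' := fun x => -|V x|) (hV.hasDerivAt_tail)
    fun x => by simp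

theorem tendsto_tail (V : ℝ → ℝ) : Tendsto (tail V) atTop (𝓝 0) :=
  tendsto_integral_Ioi_zero tendsto_id

theorem mul_tail_le (hV : ShortRange V) {R : ℝ} (hR : 0 ≤ R) :
    R * tail V R ≤ ∫ y in Set.Ioi R, y * |V y| := by
  unfold tail
  rw [← integral_const_mul]
  refine setIntegral_mono_on ((hV.integrableOn_abs R).const_mul R)
    (hV.moment.mono_set (Set.Ioi_subset_Ioi hR)) measurableSet_Ioi fun y hy => ?_
  exact mul_le_mul_of_nonneg_right (le_of_lt hy) (abs_nonneg _)

theorem moment_tail_le (hV : ShortRange V) {R : ℝ} (hR : 0 ≤ R) :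
    ∫ y in Set.Ioi R, y * |V y| ≤ ∫ y in Set.Ioi 0, y * |V y| := by
  refine setIntegral_mono_set hV.moment ?_ (Set.Ioi_subset_Ioi hR).eventuallyLE
  refine (ae_restrict_iff' measurableSet_Ioi).2 (Eventually.of_forall fun y hy => ?_)
  exact mul_nonneg (le_of_lt hy) (abs_nonneg _)

/-- Integration by parts: `(y · tail)' = tail - y|V|`, and the boundary term `R · tail R` is
absorbed by the moment over `(R, ∞)`. This is where the first moment makes the double tail finite.
-/
theorem intervalIntegral_tail_le (hV : ShortRange V) {R : ℝ} (hR : 0 ≤ R) :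
    ∫ y in (0 : ℝ)..R, tail V y ≤ ∫ y in Set.Ioi 0, y * |V y| := by
  have h1 : ∀ y ∈ Set.uIcc 0 R, HasDerivAt (fun y => y * tail V y)
      (tail V y - y * |V y|) y := fun y _ => by
    exact ((hasDerivAt_id' y).mul (hV.hasDerivAt_tail y)).congr_deriv (by ring)
  have hc : Continuous fun y => y * |V y| := continuous_id.mul hV.cont.abs
  have h2 := intervalIntegral.integral_eq_sub_of_hasDerivAt h1
    ((hV.continuous_tail.sub hc).intervalIntegrable _ _)
  rw [intervalIntegral.integral_sub (hV.continuous_tail.intervalIntegrable _ _)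
    (hc.intervalIntegrable _ _)] at h2
  have h3 := intervalIntegral.integral_interval_add_Ioi (b := R) hV.moment
    (hV.moment.mono_set (Set.Ioi_subset_Ioi hR))
  have h4 := hV.mul_tail_le hR
  linarith

theorem integrableOn_tail (hV : ShortRange V) (x : ℝ) : IntegrableOn (tail V) (Set.Ioi x) := by
  refine integrableOn_Ioi_of_continuous hV.continuous_tail (a := 0) ?_ x
  refine integrableOn_Ioi_of_intervalIntegral_norm_bounded (∫ y in Set.Ioi 0, y * |V y|) 0
    (b := fun n : ℕ => (n : ℝ)) (l := atTop)
    (fun n => (hV.continuous_tail.integrableOn_Icc).mono_set Set.Ioc_subset_Icc_self)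
    tendsto_natCast_atTop_atTop (Eventually.of_forall fun n => ?_)
  simp only [Real.norm_eq_abs, abs_of_nonneg (tail_nonneg V _)]
  exact hV.intervalIntegral_tail_le (Nat.cast_nonneg n)

theorem tailTwo_zero_le (hV : ShortRange V) : tailTwo V 0 ≤ ∫ y in Set.Ioi 0, y * |V y| :=
  le_of_tendsto (intervalIntegral_tendsto_integral_Ioi 0 (hV.integrableOn_tail 0) tendsto_id)
    ((eventually_ge_atTop 0).mono fun _ hR => hV.intervalIntegral_tail_le hR)

theorem hasDerivAt_tailTwo (hV : ShortRange V) (x : ℝ) :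
    HasDerivAt (tailTwo V) (-tail V x) x :=
  hasDerivAt_integral_Ioi hV.continuous_tail (hV.integrableOn_tail 0) x

theorem hasDerivAt_weight (hV : ShortRange V) (x : ℝ) :
    HasDerivAt (weight V) (-(2 * (weight V x * tail V x))) x := by
  exact ((hV.hasDerivAt_tailTwo x).const_mul 2).exp.congr_deriv (by simp only [weight]; ring)

theorem continuous_weight (hV : ShortRange V) : Continuous (weight V) :=
  continuous_iff_continuousAt.2 fun x => (hV.hasDerivAt_weight x).continuousAt

theorem weight_antitone (hV : ShortRange V) : Antitone (weight V) :=
  antitone_of_hasDerivAt_nonpos hV.hasDerivAt_weight fun x => by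
    have := mul_nonneg (weight_pos V x).le (tail_nonneg V x)
    simp only [Pi.zero_apply]
    linarith

theorem tendsto_weight (V : ℝ → ℝ) : Tendsto (weight V) atTop (𝓝 1) := by
  have h : Tendsto (tailTwo V) atTop (𝓝 0) := tendsto_integral_Ioi_zero tendsto_id
  have := (Real.continuous_exp.tendsto _).comp (h.const_mul 2)
  rw [mul_zero, Real.exp_zero] at this
  exact this

theorem integrableOn_weight_mul_tail (hV : ShortRange V) (x : ℝ) :
    IntegrableOn (fun y => weight V y * tail V y) (Set.Ioi x) := by
  refine Integrable.mono' ((hV.integrableOn_tail x).const_mul (weight V x))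
    (hV.continuous_weight.mul hV.continuous_tail).aestronglyMeasurable.restrict ?_
  refine (ae_restrict_iff' measurableSet_Ioi).2 (Eventually.of_forall fun y hy => ?_)
  rw [Real.norm_eq_abs, abs_of_nonneg (mul_nonneg (weight_pos V y).le (tail_nonneg V y))]
  exact mul_le_mul_of_nonneg_right (hV.weight_antitone (le_of_lt hy)) (tail_nonneg V y)

/-- The factor two in the exponent of `weight` is chosen for this: `weight' = -2 · weight · tail`,
so one Volterra step applied to a function bounded by `weight` gains a factor one half. The Neumann
series then converges geometrically, uniformly in `k`. -/
theorem integral_weight_mul_tail (hV : ShortRange V) (x : ℝ) :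
    ∫ y in Set.Ioi x, weight V y * tail V y = (weight V x - 1) / 2 := by
  have h := integral_Ioi_of_hasDerivAt_of_tendsto' (a := x) (m := -1 / 2)
    (f := fun y => -weight V y / 2) (f' := fun y => weight V y * tail V y)
    (fun y _ => by
      exact ((hV.hasDerivAt_weight y).neg.div_const 2).congr_deriv (by ring))
    (hV.integrableOn_weight_mul_tail x)
    (((tendsto_weight V).neg).div_const 2)
  rw [h]; ring

end ShortRange

/-! ### The iteration for the Jost solution -/

theorem norm_exp_two_I_mul_le_one {k : ℂ} (hk : 0 ≤ k.im) {x y : ℝ} (h : x ≤ y) :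
    ‖Complex.exp (2 * Complex.I * k * ((y : ℂ) - x))‖ ≤ 1 := by
  rw [Complex.norm_exp, Real.exp_le_one_iff]
  have : (2 * Complex.I * k * ((y : ℂ) - x)).re = -(2 * k.im * (y - x)) := by
    simp [Complex.mul_re, Complex.mul_im]
  rw [this]
  have := mul_nonneg hk (sub_nonneg.2 h)
  linarith

/-- One step of the iteration for the derivative of `e^{-ikx} φ`. -/
def jostStep (V : ℝ → ℝ) (k : ℂ) (u : ℝ → ℂ) (x : ℝ) : ℂ :=
  -∫ y in Set.Ioi x, Complex.exp (2 * Complex.I * k * ((y : ℂ) - x)) * ((V y : ℂ) * u y)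

/-- The terms of the Neumann series for `e^{-ikx} φ`. -/
def jostTerm (V : ℝ → ℝ) (k : ℂ) : ℕ → ℝ → ℂ
  | 0 => fun _ => 1
  | n + 1 => fun x => -∫ y in Set.Ioi x, jostStep V k (jostTerm V k n) y

namespace ShortRange

section Step

variable {k : ℂ} {u : ℝ → ℂ} {C : ℝ}

theorem norm_step_integrand_le (hV : ShortRange V) (hk : 0 ≤ k.im)
    (hb : ∀ x, ‖u x‖ ≤ C * weight V x) {x y : ℝ} (h : x ≤ y) :
    ‖Complex.exp (2 * Complex.I * k * ((y : ℂ) - x)) * ((V y : ℂ) * u y)‖ ≤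
      C * weight V x * |V y| := by
  have hC : 0 ≤ C := by
    have := (norm_nonneg _).trans (hb 0)
    exact nonneg_of_mul_nonneg_left this (weight_pos V 0)
  rw [norm_mul, norm_mul, Complex.norm_real, Real.norm_eq_abs]
  have h1 := norm_exp_two_I_mul_le_one hk h
  have h2 : ‖u y‖ ≤ C * weight V x :=
    (hb y).trans (mul_le_mul_of_nonneg_left (hV.weight_antitone h) hC)
  calc _ ≤ 1 * (|V y| * (C * weight V x)) := by gcongr
    _ = _ := by ring

theorem continuous_step_integrand (hV : ShortRange V) (hu : Continuous u) (x : ℝ) :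
    Continuous fun y : ℝ =>
      Complex.exp (2 * Complex.I * k * ((y : ℂ) - x)) * ((V y : ℂ) * u y) := by
  have := hV.cont
  fun_prop

theorem integrableOn_step (hV : ShortRange V) (hk : 0 ≤ k.im) (hu : Continuous u)
    (hb : ∀ x, ‖u x‖ ≤ C * weight V x) (x : ℝ) :
    IntegrableOn (fun y : ℝ =>
      Complex.exp (2 * Complex.I * k * ((y : ℂ) - x)) * ((V y : ℂ) * u y)) (Set.Ioi x) := by
  refine Integrable.mono' ((hV.integrableOn_abs x).const_mul (C * weight V x))
    (hV.continuous_step_integrand hu x).aestronglyMeasurable.restrict ?_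
  exact (ae_restrict_iff' measurableSet_Ioi).2 (Eventually.of_forall fun y hy =>
    hV.norm_step_integrand_le hk hb (le_of_lt hy))

theorem norm_jostStep_le (hV : ShortRange V) (hk : 0 ≤ k.im)
    (hb : ∀ x, ‖u x‖ ≤ C * weight V x) (x : ℝ) :
    ‖jostStep V k u x‖ ≤ C * (weight V x * tail V x) := by
  rw [jostStep, norm_neg, ← mul_assoc, tail, ← integral_const_mul]
  exact norm_integral_le_of_norm_le ((hV.integrableOn_abs x).const_mul _)
    ((ae_restrict_iff' measurableSet_Ioi).2 (Eventually.of_forall fun y hy =>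
    hV.norm_step_integrand_le hk hb (le_of_lt hy)))

/-- Pulling `e^{-2ikx}` out of the integral leaves a product of an exponential and a tail integral.
Summed over the Neumann series this becomes `m'' = V m - 2ik m'`. -/
theorem hasDerivAt_jostStep (hV : ShortRange V) (hk : 0 ≤ k.im) (hu : Continuous u)
    (hb : ∀ x, ‖u x‖ ≤ C * weight V x) (x : ℝ) :
    HasDerivAt (jostStep V k u) (V x * u x - 2 * Complex.I * k * jostStep V k u x) x := by
  have hsplit : ∀ x, jostStep V k u x = Complex.exp (-(2 * Complex.I * k * x)) *
      -∫ y in Set.Ioi x, Complex.exp (2 * Complex.I * k * (y : ℂ)) * ((V y : ℂ) * u y) := by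
    intro x
    rw [jostStep, mul_neg, ← integral_const_mul]
    congr 1
    refine integral_congr_ae (Eventually.of_forall fun y => ?_)
    simp only
    rw [← mul_assoc (Complex.exp (-(2 * Complex.I * k * x))), ← Complex.exp_add]
    congr 2; ring
  have hcont : Continuous fun y : ℝ =>
      Complex.exp (2 * Complex.I * k * (y : ℂ)) * ((V y : ℂ) * u y) := by
    have := hV.cont
    fun_prop
  have hint : IntegrableOn (fun y : ℝ =>
      Complex.exp (2 * Complex.I * k * (y : ℂ)) * ((V y : ℂ) * u y)) (Set.Ioi 0) := by
    simpa using hV.integrableOn_step hk hu hb 0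
  have h1 := (hasDerivAt_integral_Ioi hcont hint x).neg
  have h2 : HasDerivAt (fun x : ℝ => Complex.exp (-(2 * Complex.I * k * x)))
      (Complex.exp (-(2 * Complex.I * k * x)) * (-(2 * Complex.I * k))) x := by
    have := ((hasDerivAt_id' x).ofReal_comp.const_mul (2 * Complex.I * k)).neg.cexp
    simpa using this
  have h3 := h2.mul h1
  have hfun : jostStep V k u = _ := funext hsplit
  rw [hfun]
  refine h3.congr_deriv ?_
  have : Complex.exp (-(2 * Complex.I * k * x)) * Complex.exp (2 * Complex.I * k * x) = 1 := by
    rw [← Complex.exp_add]; simp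
  simp only [Pi.neg_apply]
  linear_combination ((V x : ℂ) * u x) * this

theorem continuous_jostStep (hV : ShortRange V) (hk : 0 ≤ k.im) (hu : Continuous u)
    (hb : ∀ x, ‖u x‖ ≤ C * weight V x) : Continuous (jostStep V k u) :=
  continuous_iff_continuousAt.2 fun x => (hV.hasDerivAt_jostStep hk hu hb x).continuousAt

theorem integrableOn_jostStep (hV : ShortRange V) (hk : 0 ≤ k.im) (hu : Continuous u)
    (hb : ∀ x, ‖u x‖ ≤ C * weight V x) (x : ℝ) :
    IntegrableOn (jostStep V k u) (Set.Ioi x) :=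
  Integrable.mono' ((hV.integrableOn_weight_mul_tail x).const_mul C)
    (hV.continuous_jostStep hk hu hb).aestronglyMeasurable.restrict
    (Eventually.of_forall fun y => hV.norm_jostStep_le hk hb y)

theorem norm_integral_jostStep_le (hV : ShortRange V) (hk : 0 ≤ k.im)
    (hb : ∀ x, ‖u x‖ ≤ C * weight V x) (x : ℝ) :
    ‖-∫ y in Set.Ioi x, jostStep V k u y‖ ≤ C * ((weight V x - 1) / 2) := by
  rw [norm_neg, ← hV.integral_weight_mul_tail, ← integral_const_mul]
  exact norm_integral_le_of_norm_le ((hV.integrableOn_weight_mul_tail x).const_mul C)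
    (Eventually.of_forall fun y => hV.norm_jostStep_le hk hb y)

theorem hasDerivAt_integral_jostStep (hV : ShortRange V) (hk : 0 ≤ k.im) (hu : Continuous u)
    (hb : ∀ x, ‖u x‖ ≤ C * weight V x) (x : ℝ) :
    HasDerivAt (fun x => -∫ y in Set.Ioi x, jostStep V k u y) (jostStep V k u x) x := by
  exact (hasDerivAt_integral_Ioi (hV.continuous_jostStep hk hu hb)
    (hV.integrableOn_jostStep hk hu hb 0) x).neg.congr_deriv (neg_neg _)

end Step

section Terms

variable {k : ℂ}

/-- Continuity and the bound go through the induction together, since each Volterra step uses both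
for the preceding term. -/
theorem jostTerm_aux (hV : ShortRange V) (hk : 0 ≤ k.im) (n : ℕ) :
    Continuous (jostTerm V k n) ∧ ∀ x, ‖jostTerm V k n x‖ ≤ (1 / 2) ^ n * weight V x := by
  induction n with
  | zero => exact ⟨continuous_const, fun x => by simpa [jostTerm] using one_le_weight V x⟩
  | succ n ih =>
    refine ⟨continuous_iff_continuousAt.2 fun x =>
      (hV.hasDerivAt_integral_jostStep hk ih.1 ih.2 x).continuousAt, fun x => ?_⟩
    refine (hV.norm_integral_jostStep_le hk ih.2 x).trans ?_
    have : (0 : ℝ) ≤ (1 / 2) ^ n := by positivity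
    rw [pow_succ]
    nlinarith

theorem continuous_jostTerm (hV : ShortRange V) (hk : 0 ≤ k.im) (n : ℕ) :
    Continuous (jostTerm V k n) := (hV.jostTerm_aux hk n).1

theorem norm_jostTerm_le (hV : ShortRange V) (hk : 0 ≤ k.im) (n : ℕ) (x : ℝ) :
    ‖jostTerm V k n x‖ ≤ (1 / 2) ^ n * weight V x := (hV.jostTerm_aux hk n).2 x

theorem norm_jostTerm_succ_le (hV : ShortRange V) (hk : 0 ≤ k.im) (n : ℕ) (x : ℝ) :
    ‖jostTerm V k (n + 1) x‖ ≤ (1 / 2) ^ n * ((weight V x - 1) / 2) :=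
  hV.norm_integral_jostStep_le hk (hV.norm_jostTerm_le hk n) x

end Terms

end ShortRange
end StepKdV
end

noncomputable section
namespace StepKdV
variable {V : ℝ → ℝ}

/-! ### Dependence on the spectral parameter -/

/-- Only the integrand itself has to be dominated: Cauchy's estimate on small circles supplies the
bound for its derivative. -/
theorem differentiableOn_integral_of_dominated {α : Type*} [MeasurableSpace α] {μ : Measure α}
    {U : Set ℂ} (hU : IsOpen U) {F : ℂ → α → ℂ} {b : α → ℝ} (hb : Integrable b μ)
    (hm : ∀ k ∈ U, AEStronglyMeasurable (F k) μ)
    (hd : ∀ᵐ y ∂μ, DifferentiableOn ℂ (fun k => F k y) U)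
    (hle : ∀ᵐ y ∂μ, ∀ k ∈ U, ‖F k y‖ ≤ b y) :
    DifferentiableOn ℂ (fun k => ∫ y, F k y ∂μ) U := by
  intro k₀ hk₀
  obtain ⟨r, hr, hrU⟩ := Metric.isOpen_iff.1 hU k₀ hk₀
  have hsub : ∀ k ∈ Metric.ball k₀ (r / 2), Metric.closedBall k (r / 4) ⊆ U := by
    intro k hk z hz
    apply hrU
    rw [Metric.mem_ball] at hk ⊢
    have := Metric.mem_closedBall.1 hz
    linarith [dist_triangle z k k₀]
  have hmem : ∀ k ∈ Metric.ball k₀ (r / 2), k ∈ U := fun k hk =>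
    hsub k hk (Metric.mem_closedBall_self (by positivity))
  -- The `k`-derivative is measurable in `y` as an almost everywhere limit of difference quotients
  -- along a sequence `w n → 0` that stays in `U - k₀`.
  have hmeas : AEStronglyMeasurable (fun y => deriv (fun k => F k y) k₀) μ := by
    let w : ℕ → ℂ := fun n => ((r / 2 * (1 / ((n : ℝ) + 2)) : ℝ) : ℂ)
    have hw0 : ∀ n, w n ≠ 0 := fun n => by
      simp only [w, ne_eq, Complex.ofReal_eq_zero]; positivity
    have hwU : ∀ n, k₀ + w n ∈ U := fun n => by
      apply hmem
      rw [Metric.mem_ball, dist_eq_norm, add_sub_cancel_left]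
      simp only [w, Complex.norm_real, Real.norm_eq_abs]
      rw [abs_of_pos (by positivity)]
      have : 1 / ((n : ℝ) + 2) < 1 := by
        rw [div_lt_one (by positivity)]
        have : (0 : ℝ) ≤ n := Nat.cast_nonneg n
        linarith
      nlinarith
    have hwlim : Tendsto w atTop (𝓝[≠] 0) := by
      rw [tendsto_nhdsWithin_iff]
      refine ⟨?_, Eventually.of_forall hw0⟩
      have h1 : Tendsto (fun n : ℕ => 1 / ((n : ℝ) + 2)) atTop (𝓝 0) := by
        have := (tendsto_one_div_add_atTop_nhds_zero_nat (𝕜 := ℝ)).comp (tendsto_add_atTop_nat 1)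
        refine this.congr fun n => ?_
        simp only [Function.comp]
        push_cast
        ring_nf
      have h2 := h1.const_mul (r / 2)
      rw [mul_zero] at h2
      have h3 := (Complex.continuous_ofReal.tendsto 0).comp h2
      simpa [Function.comp_def, w] using h3
    refine aestronglyMeasurable_of_tendsto_ae atTop
      (f := fun n y => (w n)⁻¹ • (F (k₀ + w n) y - F k₀ y)) (fun n => ?_) ?_
    · exact ((hm _ (hwU n)).sub (hm _ hk₀)).const_smul (w n)⁻¹
    · filter_upwards [hd] with y hy
      have h1 := ((hy k₀ hk₀).differentiableAt (hU.mem_nhds hk₀)).hasDerivAt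
      exact (hasDerivAt_iff_tendsto_slope_zero.1 h1).comp hwlim
  have key := hasDerivAt_integral_of_dominated_loc_of_deriv_le (μ := μ) (F := F) (x₀ := k₀)
    (F' := fun k y => deriv (fun k => F k y) k) (bound := fun y => b y / (r / 4))
    (Metric.ball_mem_nhds k₀ (half_pos hr))
    (Filter.eventually_of_mem (hU.mem_nhds hk₀) hm)
    (hb.mono' (hm _ hk₀) (hle.mono fun y hy => hy k₀ hk₀)) hmeas ?_ (hb.div_const _) ?_
  · exact key.2.differentiableAt.differentiableWithinAt
  · filter_upwards [hd, hle] with y hy hy2 k hk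
    refine Complex.norm_deriv_le_of_forall_mem_sphere_norm_le (by positivity) ?_ fun z hz =>
      hy2 z (hsub k hk (Metric.sphere_subset_closedBall hz))
    refine DifferentiableOn.diffContOnCl ?_
    exact hy.mono ((Metric.closure_ball_subset_closedBall).trans (hsub k hk))
  · filter_upwards [hd] with y hy k hk
    exact ((hy k (hmem k hk)).differentiableAt (hU.mem_nhds (hmem k hk))).hasDerivAt

/-- The closed upper half-plane. -/
def upperClosed : Set ℂ := {k | 0 ≤ k.im}

/-- The open upper half-plane. -/
def upperOpen : Set ℂ := {k | 0 < k.im}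

theorem isOpen_upperOpen : IsOpen upperOpen := isOpen_lt continuous_const Complex.continuous_im

theorem upperOpen_subset : upperOpen ⊆ upperClosed := fun _ h => le_of_lt (α := ℝ) h

namespace ShortRange

theorem continuousOn_jostStep (hV : ShortRange V) {u : ℂ → ℝ → ℂ} {C : ℝ}
    (hu : ∀ k ∈ upperClosed, Continuous (u k))
    (hb : ∀ k ∈ upperClosed, ∀ x, ‖u k x‖ ≤ C * weight V x)
    (hc : ∀ x, ContinuousOn (fun k => u k x) upperClosed) (x : ℝ) :
    ContinuousOn (fun k => jostStep V k (u k) x) upperClosed := by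
  refine (continuousOn_of_dominated (bound := fun y => C * weight V x * |V y|)
    (fun k hk => ?_) (fun k hk => ?_) ((hV.integrableOn_abs x).const_mul _) ?_).neg
  · exact (hV.integrableOn_step hk (hu k hk) (hb k hk) x).aestronglyMeasurable
  · exact (ae_restrict_iff' measurableSet_Ioi).2 (Eventually.of_forall fun y hy =>
      hV.norm_step_integrand_le hk (hb k hk) (le_of_lt hy))
  · refine Eventually.of_forall fun y => ?_
    have := hc y
    fun_prop

theorem differentiableOn_jostStep (hV : ShortRange V) {u : ℂ → ℝ → ℂ} {C : ℝ}
    (hu : ∀ k ∈ upperClosed, Continuous (u k))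
    (hb : ∀ k ∈ upperClosed, ∀ x, ‖u k x‖ ≤ C * weight V x)
    (hc : ∀ x, DifferentiableOn ℂ (fun k => u k x) upperOpen) (x : ℝ) :
    DifferentiableOn ℂ (fun k => jostStep V k (u k) x) upperOpen := by
  refine (differentiableOn_integral_of_dominated isOpen_upperOpen
    (b := fun y => C * weight V x * |V y|) ((hV.integrableOn_abs x).const_mul _)
    (fun k hk => ?_) ?_ ?_).neg
  · have hk := upperOpen_subset hk
    exact (hV.integrableOn_step hk (hu k hk) (hb k hk) x).aestronglyMeasurable
  · refine Eventually.of_forall fun y => ?_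
    have := hc y
    fun_prop
  · exact (ae_restrict_iff' measurableSet_Ioi).2 (Eventually.of_forall fun y hy k hk =>
      hV.norm_step_integrand_le (upperOpen_subset hk) (hb k (upperOpen_subset hk)) (le_of_lt hy))

theorem continuousOn_jostTerm (hV : ShortRange V) (n : ℕ) (x : ℝ) :
    ContinuousOn (fun k => jostTerm V k n x) upperClosed := by
  induction n generalizing x with
  | zero => exact continuousOn_const
  | succ n ih =>
    refine (continuousOn_of_dominated
      (bound := fun y => (1 / 2) ^ n * (weight V y * tail V y)) (fun k hk => ?_) (fun k hk => ?_)
      ((hV.integrableOn_weight_mul_tail x).const_mul _) ?_).neg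
    · exact (hV.integrableOn_jostStep hk (hV.continuous_jostTerm hk n)
        (hV.norm_jostTerm_le hk n) x).aestronglyMeasurable
    · exact Eventually.of_forall fun y => hV.norm_jostStep_le hk (hV.norm_jostTerm_le hk n) y
    · exact Eventually.of_forall fun y => hV.continuousOn_jostStep
        (fun k hk => hV.continuous_jostTerm hk n) (fun k hk => hV.norm_jostTerm_le hk n) ih y

theorem differentiableOn_jostTerm (hV : ShortRange V) (n : ℕ) (x : ℝ) :
    DifferentiableOn ℂ (fun k => jostTerm V k n x) upperOpen := by
  induction n generalizing x with
  | zero => exact differentiableOn_const _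
  | succ n ih =>
    refine (differentiableOn_integral_of_dominated isOpen_upperOpen
      (b := fun y => (1 / 2) ^ n * (weight V y * tail V y))
      ((hV.integrableOn_weight_mul_tail x).const_mul _) (fun k hk => ?_) ?_ ?_).neg
    · have hk := upperOpen_subset hk
      exact (hV.integrableOn_jostStep hk (hV.continuous_jostTerm hk n)
        (hV.norm_jostTerm_le hk n) x).aestronglyMeasurable
    · exact Eventually.of_forall fun y => hV.differentiableOn_jostStep
        (fun k hk => hV.continuous_jostTerm hk n) (fun k hk => hV.norm_jostTerm_le hk n) ih y
    · exact Eventually.of_forall fun y k hk => hV.norm_jostStep_le (upperOpen_subset hk)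
        (hV.norm_jostTerm_le (upperOpen_subset hk) n) y

end ShortRange

/-! ### The Jost solution -/

/-- `e^{-ikx} φ(k, x)` for the Jost solution `φ`. -/
def jostM (V : ℝ → ℝ) (k : ℂ) (x : ℝ) : ℂ := ∑' n, jostTerm V k n x

/-- The `x`-derivative of `e^{-ikx} φ(k, x)`. -/
def jostMDeriv (V : ℝ → ℝ) (k : ℂ) (x : ℝ) : ℂ := ∑' n, jostStep V k (jostTerm V k n) x

theorem summable_half_pow_mul (a : ℝ) : Summable fun n : ℕ => (1 / 2 : ℝ) ^ n * a :=
  summable_geometric_two.mul_right a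

namespace ShortRange

variable {k : ℂ}

theorem norm_jostStep_term_le (hV : ShortRange V) (hk : 0 ≤ k.im) (n : ℕ) (x : ℝ) :
    ‖jostStep V k (jostTerm V k n) x‖ ≤ (1 / 2) ^ n * (weight V x * tail V x) :=
  hV.norm_jostStep_le hk (hV.norm_jostTerm_le hk n) x

theorem summable_jostTerm (hV : ShortRange V) (hk : 0 ≤ k.im) (x : ℝ) :
    Summable fun n => jostTerm V k n x :=
  Summable.of_norm_bounded (summable_half_pow_mul _) fun n => hV.norm_jostTerm_le hk n x

theorem summable_jostStep (hV : ShortRange V) (hk : 0 ≤ k.im) (x : ℝ) :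
    Summable fun n => jostStep V k (jostTerm V k n) x :=
  Summable.of_norm_bounded (summable_half_pow_mul _) fun n => hV.norm_jostStep_term_le hk n x

theorem tsum_half_pow_mul (a : ℝ) : ∑' n : ℕ, (1 / 2 : ℝ) ^ n * a = 2 * a := by
  rw [tsum_mul_right, tsum_geometric_two]

theorem norm_jostM_le (hV : ShortRange V) (hk : 0 ≤ k.im) (x : ℝ) :
    ‖jostM V k x‖ ≤ 2 * weight V x := by
  rw [← tsum_half_pow_mul]
  exact tsum_of_norm_bounded (summable_half_pow_mul _).hasSum fun n => hV.norm_jostTerm_le hk n x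

theorem norm_jostMDeriv_le (hV : ShortRange V) (hk : 0 ≤ k.im) (x : ℝ) :
    ‖jostMDeriv V k x‖ ≤ 2 * (weight V x * tail V x) := by
  rw [← tsum_half_pow_mul]
  exact tsum_of_norm_bounded (summable_half_pow_mul _).hasSum
    fun n => hV.norm_jostStep_term_le hk n x

theorem jostM_eq (hV : ShortRange V) (hk : 0 ≤ k.im) (x : ℝ) :
    jostM V k x = 1 + ∑' n, jostTerm V k (n + 1) x := by
  rw [jostM, (hV.summable_jostTerm hk x).tsum_eq_zero_add]; rfl

theorem norm_jostM_sub_one_le (hV : ShortRange V) (hk : 0 ≤ k.im) (x : ℝ) :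
    ‖jostM V k x - 1‖ ≤ weight V x - 1 := by
  rw [hV.jostM_eq hk, add_sub_cancel_left]
  have h := tsum_of_norm_bounded (summable_half_pow_mul ((weight V x - 1) / 2)).hasSum
    fun n => hV.norm_jostTerm_succ_le hk n x
  rw [tsum_half_pow_mul] at h
  linarith

theorem hasDerivAt_jostM (hV : ShortRange V) (hk : 0 ≤ k.im) (x : ℝ) :
    HasDerivAt (jostM V k) (jostMDeriv V k x) x := by
  have h1 : jostM V k = fun x => 1 + ∑' n, jostTerm V k (n + 1) x :=
    funext (hV.jostM_eq hk)
  rw [h1]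
  refine HasDerivAt.const_add 1 ?_
  -- `weight` and `tail` are antitone, so their values at `x - 1` majorize the differentiated terms
  -- on this whole half-line.
  have hmem : x ∈ Set.Ioi (x - 1) := by simp
  refine hasDerivAt_tsum_of_isPreconnected
    (summable_half_pow_mul (weight V (x - 1) * tail V (x - 1))) isOpen_Ioi isPreconnected_Ioi
    (fun n y _ => hV.hasDerivAt_integral_jostStep hk (hV.continuous_jostTerm hk n)
      (hV.norm_jostTerm_le hk n) y) (fun n y hy => ?_) hmem
    ((summable_nat_add_iff 1).2 (hV.summable_jostTerm hk x)) hmem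
  refine (hV.norm_jostStep_term_le hk n y).trans ?_
  have hy : x - 1 ≤ y := le_of_lt hy
  exact mul_le_mul_of_nonneg_left (mul_le_mul (hV.weight_antitone hy) (hV.tail_antitone hy)
    (tail_nonneg V y) (weight_pos V _).le) (by positivity)

theorem hasDerivAt_jostMDeriv (hV : ShortRange V) (hk : 0 ≤ k.im) (x : ℝ) :
    HasDerivAt (jostMDeriv V k)
      (V x * jostM V k x - 2 * Complex.I * k * jostMDeriv V k x) x := by
  -- The potential is bounded only locally, hence a bounded interval instead of a half-line.
  obtain ⟨B, hB⟩ := (isCompact_Icc (a := x - 1) (b := x + 1)).exists_bound_of_continuousOn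
    hV.cont.continuousOn
  have hmem : x ∈ Set.Ioo (x - 1) (x + 1) := by constructor <;> linarith
  have hs : V x * jostM V k x - 2 * Complex.I * k * jostMDeriv V k x =
      ∑' n, (V x * jostTerm V k n x - 2 * Complex.I * k * jostStep V k (jostTerm V k n) x) := by
    rw [jostM, jostMDeriv, ((hV.summable_jostTerm hk x).mul_left _).tsum_sub
      ((hV.summable_jostStep hk x).mul_left _), tsum_mul_left, tsum_mul_left]
  rw [hs]
  refine hasDerivAt_tsum_of_isPreconnected
    (summable_half_pow_mul (B * weight V (x - 1) +
      ‖2 * Complex.I * k‖ * (weight V (x - 1) * tail V (x - 1)))) isOpen_Ioo isPreconnected_Ioo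
    (fun n y _ => hV.hasDerivAt_jostStep hk (hV.continuous_jostTerm hk n)
      (hV.norm_jostTerm_le hk n) y) (fun n y hy => ?_) hmem
    (hV.summable_jostStep hk x) hmem
  have hy1 : x - 1 ≤ y := le_of_lt hy.1
  have hVy := hB y (Set.Ioo_subset_Icc_self hy)
  have h0 : 0 ≤ B := (norm_nonneg _).trans hVy
  refine (norm_sub_le _ _).trans ?_
  rw [norm_mul, norm_mul (2 * Complex.I * k), Complex.norm_real, mul_add]
  have h1 := hV.norm_jostTerm_le hk n y
  have h2 := hV.norm_jostStep_term_le hk n y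
  have h3 := hV.weight_antitone hy1
  have h4 := hV.tail_antitone hy1
  have h5 := tail_nonneg V y
  have h6 := (weight_pos V y).le
  have h7 := (weight_pos V (x - 1)).le
  have e1 : ‖V y‖ * ‖jostTerm V k n y‖ ≤ (1 / 2) ^ n * (B * weight V (x - 1)) := by
    calc _ ≤ B * ((1 / 2) ^ n * weight V (x - 1)) := by
          refine mul_le_mul hVy (h1.trans ?_) (norm_nonneg _) h0
          gcongr
      _ = _ := by ring
  have e2 : ‖2 * Complex.I * k‖ * ‖jostStep V k (jostTerm V k n) y‖ ≤
      (1 / 2) ^ n * (‖2 * Complex.I * k‖ * (weight V (x - 1) * tail V (x - 1))) := by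
    calc _ ≤ ‖2 * Complex.I * k‖ * ((1 / 2) ^ n * (weight V (x - 1) * tail V (x - 1))) := by
          refine mul_le_mul_of_nonneg_left (h2.trans ?_) (norm_nonneg _)
          gcongr
      _ = _ := by ring
  exact add_le_add e1 e2

theorem continuousOn_jostM (hV : ShortRange V) (x : ℝ) :
    ContinuousOn (fun k => jostM V k x) upperClosed :=
  continuousOn_tsum (fun n => hV.continuousOn_jostTerm n x) (summable_half_pow_mul (weight V x))
    fun n _ hk => hV.norm_jostTerm_le hk n x

theorem differentiableOn_jostM (hV : ShortRange V) (x : ℝ) :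
    DifferentiableOn ℂ (fun k => jostM V k x) upperOpen :=
  Complex.differentiableOn_tsum_of_summable_norm (summable_half_pow_mul (weight V x))
    (fun n => hV.differentiableOn_jostTerm n x) isOpen_upperOpen
    fun n _ hk => hV.norm_jostTerm_le (upperOpen_subset hk) n x

theorem continuousOn_jostMDeriv (hV : ShortRange V) (x : ℝ) :
    ContinuousOn (fun k => jostMDeriv V k x) upperClosed :=
  continuousOn_tsum (fun n => hV.continuousOn_jostStep
      (fun _ hk => hV.continuous_jostTerm hk n) (fun _ hk => hV.norm_jostTerm_le hk n)
      (hV.continuousOn_jostTerm n) x)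
    (summable_half_pow_mul (weight V x * tail V x))
    fun n _ hk => hV.norm_jostStep_term_le hk n x

theorem differentiableOn_jostMDeriv (hV : ShortRange V) (x : ℝ) :
    DifferentiableOn ℂ (fun k => jostMDeriv V k x) upperOpen :=
  Complex.differentiableOn_tsum_of_summable_norm
    (summable_half_pow_mul (weight V x * tail V x))
    (fun n => hV.differentiableOn_jostStep
      (fun _ hk => hV.continuous_jostTerm hk n) (fun _ hk => hV.norm_jostTerm_le hk n)
      (hV.differentiableOn_jostTerm n) x) isOpen_upperOpen
    fun n _ hk => hV.norm_jostStep_term_le (upperOpen_subset hk) n x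

end ShortRange
end StepKdV
end

noncomputable section
namespace StepKdV

/-! ### Linear differential equations with a parameter -/

section Picard

variable {E : Type*} [NormedAddCommGroup E] [NormedSpace ℝ E]

/-- The Picard iterates for `Y' = A Y`, `Y(0) = y₀`, as terms of a series. -/
def picardTerm (A : ℝ → ℝ → E →L[ℝ] E) (y₀ : E) : ℕ → ℝ → ℝ → E
  | 0 => fun _ _ => y₀
  | n + 1 => fun x t => ∫ y in (0 : ℝ)..x, A y t (picardTerm A y₀ n y t)

variable {A : ℝ → ℝ → E →L[ℝ] E} (y₀ : E)

theorem continuous_picardTerm (hA : Continuous fun p : ℝ × ℝ => A p.1 p.2) (n : ℕ) :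
    Continuous fun p : ℝ × ℝ => picardTerm A y₀ n p.1 p.2 := by
  induction n with
  | zero => exact continuous_const
  | succ n ih =>
    refine intervalIntegral.continuous_parametric_intervalIntegral_of_continuous
      (f := fun (p : ℝ × ℝ) (y : ℝ) => A y p.2 (picardTerm A y₀ n y p.2)) ?_ continuous_fst
    have h1 : Continuous fun r : (ℝ × ℝ) × ℝ => A r.2 r.1.2 :=
      hA.comp (continuous_snd.prodMk (continuous_snd.comp continuous_fst))
    have h2 : Continuous fun r : (ℝ × ℝ) × ℝ => picardTerm A y₀ n r.2 r.1.2 :=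
      ih.comp (continuous_snd.prodMk (continuous_snd.comp continuous_fst))
    exact h1.clm_apply h2

theorem continuous_picardTerm_left (hA : Continuous fun p : ℝ × ℝ => A p.1 p.2) (n : ℕ) (t : ℝ) :
    Continuous fun x : ℝ => A x t (picardTerm A y₀ n x t) :=
  (hA.comp (continuous_id.prodMk continuous_const)).clm_apply
    ((continuous_picardTerm y₀ hA n).comp (continuous_id.prodMk continuous_const))

theorem norm_picardTerm_le {R C : ℝ} (hC : ∀ x t, |x| ≤ R → |t| ≤ R → ‖A x t‖ ≤ C) (n : ℕ) :
    ∀ x t, |x| ≤ R → |t| ≤ R → ‖picardTerm A y₀ n x t‖ ≤ ‖y₀‖ * ((C * |x|) ^ n / n.factorial) := by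
  induction n with
  | zero => intro x t _ _; simp [picardTerm]
  | succ n ih =>
    intro x t hx ht
    have hC0 : 0 ≤ C := (norm_nonneg _).trans (hC x t hx ht)
    -- Rescaling the integral to `[0, 1]` treats positive and negative `x` at once and produces the
    -- factor `1/(n+1)` from `∫ θ^n`.
    have h1 : picardTerm A y₀ (n + 1) x t =
        x • ∫ θ in (0 : ℝ)..1, A (θ * x) t (picardTerm A y₀ n (θ * x) t) := by
      have := intervalIntegral.smul_integral_comp_mul_right (a := 0) (b := 1)
        (fun y => A y t (picardTerm A y₀ n y t)) x
      rw [zero_mul, one_mul] at this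
      rw [this]; rfl
    rw [h1, norm_smul, Real.norm_eq_abs]
    have h2 : ‖∫ θ in (0 : ℝ)..1, A (θ * x) t (picardTerm A y₀ n (θ * x) t)‖ ≤
        ∫ θ in (0 : ℝ)..1, (C * (‖y₀‖ * ((C * |x|) ^ n / n.factorial))) * θ ^ n := by
      refine intervalIntegral.norm_integral_le_of_norm_le zero_le_one
        (Eventually.of_forall fun θ hθ => ?_)
        ((continuous_const.mul (continuous_pow n)).intervalIntegrable _ _)
      have hθ0 : 0 ≤ θ := hθ.1.le
      have hθx : |θ * x| ≤ R := by
        rw [abs_mul, abs_of_nonneg hθ0]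
        exact (mul_le_of_le_one_left (abs_nonneg x) hθ.2).trans hx
      calc _ ≤ ‖A (θ * x) t‖ * ‖picardTerm A y₀ n (θ * x) t‖ := ContinuousLinearMap.le_opNorm _ _
        _ ≤ C * (‖y₀‖ * ((C * |θ * x|) ^ n / n.factorial)) :=
          mul_le_mul (hC _ _ hθx ht) (ih _ _ hθx ht) (norm_nonneg _) hC0
        _ = _ := by rw [abs_mul, abs_of_nonneg hθ0]; ring
    rw [intervalIntegral.integral_const_mul, integral_pow] at h2
    refine (mul_le_mul_of_nonneg_left h2 (abs_nonneg x)).trans (le_of_eq ?_)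
    rw [Nat.factorial_succ]
    push_cast
    field_simp
    ring

/-- The Picard series converges locally uniformly in `(x, t)` jointly. Joint continuity is what
later permits differentiation in `t` under integrals over `x`. -/
theorem exists_linear_solution [CompleteSpace E] (hA : Continuous fun p : ℝ × ℝ => A p.1 p.2) :
    ∃ Y : ℝ → ℝ → E, Continuous (fun p : ℝ × ℝ => Y p.1 p.2) ∧ (∀ t, Y 0 t = y₀) ∧
      ∀ x t, HasDerivAt (fun x => Y x t) (A x t (Y x t)) x := by
  have hbd : ∀ R : ℝ, ∃ C, ∀ x t, |x| ≤ R → |t| ≤ R → ‖A x t‖ ≤ C := by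
    intro R
    obtain ⟨C, hC⟩ := ((isCompact_Icc (a := -R) (b := R)).prod
      (isCompact_Icc (a := -R) (b := R))).exists_bound_of_continuousOn hA.continuousOn
    exact ⟨C, fun x t hx ht => hC (x, t) ⟨abs_le.1 hx, abs_le.1 ht⟩⟩
  have hle : ∀ R C : ℝ, (∀ x t, |x| ≤ R → |t| ≤ R → ‖A x t‖ ≤ C) → ∀ n x t, |x| ≤ R → |t| ≤ R →
      ‖picardTerm A y₀ n x t‖ ≤ ‖y₀‖ * ((C * R) ^ n / n.factorial) := by
    intro R C hC n x t hx ht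
    refine (norm_picardTerm_le y₀ hC n x t hx ht).trans ?_
    have hC0 : 0 ≤ C := (norm_nonneg _).trans (hC x t hx ht)
    gcongr
  have hsum : ∀ a : ℝ, Summable fun n : ℕ => ‖y₀‖ * (a ^ n / n.factorial) := fun a =>
    (Real.summable_pow_div_factorial a).mul_left _
  have hsumm : ∀ x t, Summable fun n => picardTerm A y₀ n x t := by
    intro x t
    obtain ⟨C, hC⟩ := hbd (max |x| |t|)
    exact Summable.of_norm_bounded (hsum _) fun n =>
      hle _ C hC n x t (le_max_left _ _) (le_max_right _ _)
  refine ⟨fun x t => ∑' n, picardTerm A y₀ n x t, ?_, fun t => ?_, fun x t => ?_⟩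
  · refine continuous_iff_continuousAt.2 fun p => ?_
    obtain ⟨C, hC⟩ := hbd (‖p‖ + 1)
    have hco : ContinuousOn (fun p : ℝ × ℝ => ∑' n, picardTerm A y₀ n p.1 p.2)
        (Metric.ball 0 (‖p‖ + 1)) := by
      refine continuousOn_tsum (fun n => (continuous_picardTerm y₀ hA n).continuousOn)
        (hsum _) fun n r hr => hle _ C hC n r.1 r.2 ?_ ?_
      · exact (norm_fst_le r).trans (le_of_lt (by simpa using hr))
      · exact (norm_snd_le r).trans (le_of_lt (by simpa using hr))
    exact hco.continuousAt (Metric.isOpen_ball.mem_nhds (by simp))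
  · simp only
    rw [(hsumm 0 t).tsum_eq_zero_add]
    simp [picardTerm]
  · obtain ⟨C, hC⟩ := hbd (max (|x| + 1) |t|)
    have heq : (fun x => ∑' n, picardTerm A y₀ n x t) =
        fun x => y₀ + ∑' n, picardTerm A y₀ (n + 1) x t := by
      funext x; rw [(hsumm x t).tsum_eq_zero_add]; rfl
    rw [heq, ContinuousLinearMap.map_tsum _ (hsumm x t)]
    refine HasDerivAt.const_add _ ?_
    have hmem : x ∈ Metric.ball (0 : ℝ) (|x| + 1) := by simp
    have hu : Summable fun n : ℕ => C * (‖y₀‖ * ((C * max (|x| + 1) |t|) ^ n / n.factorial)) :=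
      (hsum _).mul_left C
    refine hasDerivAt_tsum_of_isPreconnected (g := fun n x => picardTerm A y₀ (n + 1) x t)
      (g' := fun n x => A x t (picardTerm A y₀ n x t)) hu Metric.isOpen_ball
      (convex_ball (0 : ℝ) (|x| + 1)).isPreconnected (fun n y _ => ?_) (fun n y hy => ?_) hmem
      ((summable_nat_add_iff 1).2 (hsumm x t)) hmem
    · have hc := continuous_picardTerm_left y₀ hA n t
      exact intervalIntegral.integral_hasDerivAt_right (hc.intervalIntegrable _ _)
        (hc.stronglyMeasurableAtFilter _ _) hc.continuousAt
    · have hy' : |y| ≤ max (|x| + 1) |t| :=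
        (le_of_lt (by simpa using hy)).trans (le_max_left _ _)
      have h1 := hC y t hy' (le_max_right _ _)
      exact (ContinuousLinearMap.le_opNorm _ _).trans
        (mul_le_mul h1 (hle _ C hC n y t hy' (le_max_right _ _)) (norm_nonneg _)
          ((norm_nonneg _).trans h1))

end Picard

/-! ### Solutions of the Schrödinger equation -/

/-- `f'' = (V - E) f` with `f' = g`. -/
structure SolPair (V : ℝ → ℝ) (E : ℂ) (f g : ℝ → ℂ) : Prop where
  fst : ∀ x, HasDerivAt f (g x) x
  snd : ∀ x, HasDerivAt g ((V x - E) * f x) x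

namespace SolPair

variable {V : ℝ → ℝ} {E : ℂ} {f g f₁ g₁ f₂ g₂ : ℝ → ℂ}

theorem continuous_fst (h : SolPair V E f g) : Continuous f :=
  continuous_iff_continuousAt.2 fun x => (h.fst x).continuousAt

theorem continuous_snd (h : SolPair V E f g) : Continuous g :=
  continuous_iff_continuousAt.2 fun x => (h.snd x).continuousAt

theorem deriv_eq (h : SolPair V E f g) : deriv f = g := funext fun x => (h.fst x).deriv

theorem wronskian_const (h₁ : SolPair V E f₁ g₁) (h₂ : SolPair V E f₂ g₂) (x y : ℝ) :
    f₁ x * g₂ x - g₁ x * f₂ x = f₁ y * g₂ y - g₁ y * f₂ y := by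
  refine is_const_of_deriv_eq_zero (f := fun x => f₁ x * g₂ x - g₁ x * f₂ x) ?_ ?_ x y
  · intro x
    exact (((h₁.fst x).mul (h₂.snd x)).sub ((h₁.snd x).mul (h₂.fst x))).differentiableAt
  · intro x
    refine HasDerivAt.deriv ((((h₁.fst x).mul (h₂.snd x)).sub
      ((h₁.snd x).mul (h₂.fst x))).congr_deriv ?_)
    ring

theorem lincomb (h₁ : SolPair V E f₁ g₁) (h₂ : SolPair V E f₂ g₂) (a b : ℂ) :
    SolPair V E (fun x => a * f₁ x + b * f₂ x) (fun x => a * g₁ x + b * g₂ x) where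
  fst x := ((h₁.fst x).const_mul a).add ((h₂.fst x).const_mul b)
  snd x := (((h₁.snd x).const_mul a).add ((h₂.snd x).const_mul b)).congr_deriv (by ring)

theorem conj (h : SolPair V E f g) : SolPair V ((starRingEnd ℂ) E)
    (fun x => (starRingEnd ℂ) (f x)) (fun x => (starRingEnd ℂ) (g x)) where
  fst x := (h.fst x).star
  snd x := (h.snd x).star.congr_deriv (by simp [mul_comm])

theorem isSchrodingerSolution (h : SolPair V E f g) (hV : Continuous V) :
    IsSchrodingerSolution V E f := by
  have h2 : deriv g = fun x => (V x - E) * f x := funext fun x => (h.snd x).deriv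
  refine ⟨?_, fun x => ?_⟩
  · have hc : Continuous fun x => ((V x : ℂ) - E) * f x := by
      have := h.continuous_fst
      fun_prop
    have hg : ContDiff ℝ 1 g := by
      rw [contDiff_one_iff_deriv, h2]
      exact ⟨fun x => (h.snd x).differentiableAt, hc⟩
    rw [show (2 : WithTop ℕ∞) = 1 + 1 from by norm_num, contDiff_succ_iff_deriv]
    refine ⟨fun x => (h.fst x).differentiableAt, by simp, ?_⟩
    rw [h.deriv_eq]; exact hg
  · rw [h.deriv_eq, h2]; ring

end SolPair

theorem IsSchrodingerSolution.solPair {V : ℝ → ℝ} {E : ℂ} {f : ℝ → ℂ}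
    (h : IsSchrodingerSolution V E f) : SolPair V E f (deriv f) where
  fst x := (h.1.differentiable (by norm_num) x).hasDerivAt
  snd x := by
    have h1 : ContDiff ℝ 1 (deriv f) := by
      have := h.1
      rw [show (2 : WithTop ℕ∞) = 1 + 1 from by norm_num, contDiff_succ_iff_deriv] at this
      exact this.2.2
    refine ((h1.differentiable (by norm_num) x).hasDerivAt).congr_deriv ?_
    linear_combination -h.2 x

theorem exists_solPair {V : ℝ → ℝ → ℝ} (hV : Continuous fun p : ℝ × ℝ => V p.1 p.2) (E z w : ℂ) :
    ∃ f g : ℝ → ℝ → ℂ, (∀ t, SolPair (fun x => V x t) E (fun x => f x t) (fun x => g x t)) ∧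
      Continuous (fun p : ℝ × ℝ => f p.1 p.2) ∧ Continuous (fun p : ℝ × ℝ => g p.1 p.2) ∧
      (∀ t, f 0 t = z) ∧ ∀ t, g 0 t = w := by
  -- The first-order system for `(f, g)`: `J₁` maps it to `(g, 0)` and `J₂` to `(0, f)`.
  let J₁ : ℂ × ℂ →L[ℝ] ℂ × ℂ :=
    (ContinuousLinearMap.inl ℝ ℂ ℂ).comp (ContinuousLinearMap.snd ℝ ℂ ℂ)
  let J₂ : ℂ × ℂ →L[ℝ] ℂ × ℂ :=
    (ContinuousLinearMap.inr ℝ ℂ ℂ).comp (ContinuousLinearMap.fst ℝ ℂ ℂ)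
  have hA : Continuous fun p : ℝ × ℝ => J₁ + ((V p.1 p.2 : ℂ) - E) • J₂ := by fun_prop
  obtain ⟨Y, hY1, hY2, hY3⟩ := exists_linear_solution
    (A := fun x t => J₁ + ((V x t : ℂ) - E) • J₂) (z, w) hA
  refine ⟨fun x t => (Y x t).1, fun x t => (Y x t).2, fun t => ⟨fun x => ?_, fun x => ?_⟩,
    hY1.fst, hY1.snd, fun t => by simp [hY2], fun t => by simp [hY2]⟩
  · have h1 := (ContinuousLinearMap.fst ℝ ℂ ℂ).hasFDerivAt.comp_hasDerivAt x (hY3 x t)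
    exact h1.congr_deriv (by simp [J₁, J₂])
  · have h1 := (ContinuousLinearMap.snd ℝ ℂ ℂ).hasFDerivAt.comp_hasDerivAt x (hY3 x t)
    exact h1.congr_deriv (by simp [J₁, J₂])

namespace SolPair

variable {V : ℝ → ℝ} {E : ℂ} {f g f₁ g₁ f₂ g₂ : ℝ → ℂ}

/-- Constant Wronskians replace Gronwall: those with the solutions of data `(1, 0)` and `(0, 1)`
vanish at `0`, hence everywhere, and Cramer's rule recovers `f` and `g`. -/
theorem eq_zero (hV : Continuous V) (h : SolPair V E f g) (h0 : f 0 = 0) (h1 : g 0 = 0) (x : ℝ) :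
    f x = 0 ∧ g x = 0 := by
  have hV2 : Continuous fun p : ℝ × ℝ => V p.1 := hV.comp _root_.continuous_fst
  obtain ⟨c, c', hc, -, -, hc0, hc0'⟩ := exists_solPair (V := fun x _ => V x) hV2 E 1 0
  obtain ⟨s, s', hs, -, -, hs0, hs0'⟩ := exists_solPair (V := fun x _ => V x) hV2 E 0 1
  have e1 := (hc 0).wronskian_const h x 0
  have e2 := (hs 0).wronskian_const h x 0
  have e3 := (hc 0).wronskian_const (hs 0) x 0
  simp only [hc0, hc0', hs0, hs0', h0, h1] at e1 e2 e3
  constructor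
  · linear_combination (s x 0) * e1 - (c x 0) * e2 - (f x) * e3
  · linear_combination (s' x 0) * e1 - (c' x 0) * e2 - (g x) * e3

/-- If the Wronskian of two solutions vanishes, then a nonzero solution spans the other one. -/
theorem exists_eq_mul (hV : Continuous V) (h₁ : SolPair V E f₁ g₁) (h₂ : SolPair V E f₂ g₂)
    (hne : f₁ ≠ 0) (hW : f₁ 0 * g₂ 0 - g₁ 0 * f₂ 0 = 0) :
    ∃ μ : ℂ, ∀ x, f₂ x = μ * f₁ x ∧ g₂ x = μ * g₁ x := by
  have hn : f₁ 0 ≠ 0 ∨ g₁ 0 ≠ 0 := by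
    by_contra hcon
    push Not at hcon
    exact hne (funext fun x => (h₁.eq_zero hV hcon.1 hcon.2 x).1)
  obtain ⟨μ, e1, e2⟩ : ∃ μ : ℂ, f₂ 0 = μ * f₁ 0 ∧ g₂ 0 = μ * g₁ 0 := by
    rcases hn with h | h
    · refine ⟨f₂ 0 / f₁ 0, by field_simp, ?_⟩
      field_simp
      linear_combination hW
    · refine ⟨g₂ 0 / g₁ 0, ?_, by field_simp⟩
      field_simp
      linear_combination -hW
  refine ⟨μ, fun x => ?_⟩
  have := (h₂.lincomb h₁ 1 (-μ)).eq_zero hV (by simp only [e1]; ring) (by simp only [e2]; ring) x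
  constructor
  · linear_combination this.1
  · linear_combination this.2

end SolPair
end StepKdV
end

noncomputable section
namespace StepKdV

/-! ### The Jost solution: equation, bounds, uniqueness -/

/-- The Jost solution `φ(k, x) ~ e^{ikx}`, `x → +∞`, of `-φ'' + V φ = k² φ`. -/
def jost (V : ℝ → ℝ) (k : ℂ) (x : ℝ) : ℂ := Complex.exp (Complex.I * k * x) * jostM V k x

/-- The `x`-derivative of the Jost solution. -/
def jostDeriv (V : ℝ → ℝ) (k : ℂ) (x : ℝ) : ℂ :=
  Complex.exp (Complex.I * k * x) * (Complex.I * k * jostM V k x + jostMDeriv V k x)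

theorem hasDerivAt_exp_mul (a : ℂ) (x : ℝ) :
    HasDerivAt (fun x : ℝ => Complex.exp (a * x)) (Complex.exp (a * x) * a) x := by
  simpa using ((hasDerivAt_id' x).ofReal_comp.const_mul a).cexp

theorem norm_exp_I_mul (k : ℂ) (x : ℝ) :
    ‖Complex.exp (Complex.I * k * x)‖ = Real.exp (-(k.im * x)) := by
  rw [Complex.norm_exp]
  congr 1
  simp [Complex.mul_re, Complex.mul_im]

theorem exp_neg_I_mul_jost (V : ℝ → ℝ) (k : ℂ) (x : ℝ) :
    Complex.exp (-Complex.I * k * x) * jost V k x = jostM V k x := by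
  rw [jost, ← mul_assoc, ← Complex.exp_add]
  simp

namespace ShortRange

variable {V : ℝ → ℝ} {k : ℂ}

theorem solPair_jost (hV : ShortRange V) (hk : 0 ≤ k.im) :
    SolPair V (k ^ 2) (jost V k) (jostDeriv V k) where
  fst x := ((hasDerivAt_exp_mul (Complex.I * k) x).mul (hV.hasDerivAt_jostM hk x)).congr_deriv
    (by simp only [jostDeriv]; ring)
  snd x := ((hasDerivAt_exp_mul (Complex.I * k) x).mul
    (((hV.hasDerivAt_jostM hk x).const_mul (Complex.I * k)).add
      (hV.hasDerivAt_jostMDeriv hk x))).congr_deriv (by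
      simp only [jost, Pi.add_apply]
      linear_combination Complex.exp (Complex.I * k * x) * k ^ 2 * jostM V k x * Complex.I_sq)

theorem tendsto_jostM (hV : ShortRange V) (hk : 0 ≤ k.im) : Tendsto (jostM V k) atTop (𝓝 1) := by
  rw [tendsto_iff_norm_sub_tendsto_zero]
  refine squeeze_zero (fun _ => norm_nonneg _) (hV.norm_jostM_sub_one_le hk) ?_
  simpa using (tendsto_weight V).sub_const 1

theorem tendsto_jostMDeriv (hV : ShortRange V) (hk : 0 ≤ k.im) :
    Tendsto (jostMDeriv V k) atTop (𝓝 0) := by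
  refine squeeze_zero_norm (hV.norm_jostMDeriv_le hk) ?_
  simpa using ((tendsto_weight V).mul (tendsto_tail V)).const_mul 2

theorem continuous_jostM (hV : ShortRange V) (hk : 0 ≤ k.im) : Continuous (jostM V k) :=
  continuous_iff_continuousAt.2 fun x => (hV.hasDerivAt_jostM hk x).continuousAt

theorem isRightJost_jost (hV : ShortRange V) (hk : 0 ≤ k.im) : IsRightJost V k (jost V k) :=
  ⟨(hV.solPair_jost hk).isSchrodingerSolution hV.cont, by
    simpa only [exp_neg_I_mul_jost] using hV.tendsto_jostM hk⟩

theorem jost_ne_zero (hV : ShortRange V) (hk : 0 ≤ k.im) : jost V k ≠ 0 := by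
  intro h
  have h1 : jostM V k = fun _ => 0 := by
    funext x
    rw [← exp_neg_I_mul_jost, h]; simp
  have h2 := hV.tendsto_jostM hk
  rw [h1] at h2
  exact zero_ne_one (tendsto_nhds_unique tendsto_const_nhds h2)

theorem norm_jost_le (hV : ShortRange V) (hk : 0 ≤ k.im) (x : ℝ) :
    ‖jost V k x‖ ≤ Real.exp (-(k.im * x)) * (2 * weight V x) := by
  rw [jost, norm_mul, norm_exp_I_mul]
  exact mul_le_mul_of_nonneg_left (hV.norm_jostM_le hk x) (Real.exp_pos _).le

theorem norm_jostDeriv_le (hV : ShortRange V) (hk : 0 ≤ k.im) (x : ℝ) :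
    ‖jostDeriv V k x‖ ≤
      Real.exp (-(k.im * x)) * (‖k‖ * (2 * weight V x) + 2 * (weight V x * tail V x)) := by
  rw [jostDeriv, norm_mul, norm_exp_I_mul]
  refine mul_le_mul_of_nonneg_left ((norm_add_le _ _).trans (add_le_add ?_
    (hV.norm_jostMDeriv_le hk x))) (Real.exp_pos _).le
  rw [norm_mul, norm_mul, Complex.norm_I, one_mul]
  exact mul_le_mul_of_nonneg_left (hV.norm_jostM_le hk x) (norm_nonneg _)

/-- Integrate `(m' + 2ik m)' = V m` from `x` to infinity, where `m → 1` and `m' → 0`. This is the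
source of `m = 1 + O(1/k)` at high energy. -/
theorem norm_two_I_mul_jostM_sub_one_le (hV : ShortRange V) (hk : 0 ≤ k.im) (x : ℝ) :
    2 * ‖k‖ * ‖jostM V k x - 1‖ ≤ 4 * (weight V x * tail V x) := by
  have hle : ∀ y ∈ Set.Ioi x, ‖(V y : ℂ) * jostM V k y‖ ≤ 2 * weight V x * |V y| := by
    intro y hy
    rw [norm_mul, Complex.norm_real, Real.norm_eq_abs, mul_comm]
    refine mul_le_mul_of_nonneg_right ((hV.norm_jostM_le hk y).trans ?_) (abs_nonneg _)
    exact mul_le_mul_of_nonneg_left (hV.weight_antitone (le_of_lt hy)) zero_le_two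
  have hbound : Integrable (fun y => 2 * weight V x * |V y|) (volume.restrict (Set.Ioi x)) :=
    (hV.integrableOn_abs x).const_mul _
  have hle' : ∀ᵐ y ∂volume.restrict (Set.Ioi x),
      ‖(V y : ℂ) * jostM V k y‖ ≤ 2 * weight V x * |V y| :=
    (ae_restrict_iff' measurableSet_Ioi).2 (Eventually.of_forall hle)
  have hint : IntegrableOn (fun y => (V y : ℂ) * jostM V k y) (Set.Ioi x) := by
    refine Integrable.mono' hbound ?_ hle'
    have h1 := hV.cont
    have h2 := hV.continuous_jostM hk
    exact (by fun_prop : Continuous fun y => (V y : ℂ) * jostM V k y).aestronglyMeasurable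
  have h := integral_Ioi_of_hasDerivAt_of_tendsto' (a := x) (m := 0 + 2 * Complex.I * k * 1)
    (f := fun y => jostMDeriv V k y + 2 * Complex.I * k * jostM V k y)
    (f' := fun y => (V y : ℂ) * jostM V k y)
    (fun y _ => ((hV.hasDerivAt_jostMDeriv hk y).add
      ((hV.hasDerivAt_jostM hk y).const_mul (2 * Complex.I * k))).congr_deriv (by ring)) hint
    ((hV.tendsto_jostMDeriv hk).add ((hV.tendsto_jostM hk).const_mul _))
  have h2 : 2 * Complex.I * k * (jostM V k x - 1) =
      -(jostMDeriv V k x + ∫ y in Set.Ioi x, (V y : ℂ) * jostM V k y) := by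
    rw [h]; ring
  have h3 : ‖2 * Complex.I * k * (jostM V k x - 1)‖ = 2 * ‖k‖ * ‖jostM V k x - 1‖ := by
    simp
  rw [← h3, h2, norm_neg]
  refine (norm_add_le _ _).trans ?_
  have h4 : ‖∫ y in Set.Ioi x, (V y : ℂ) * jostM V k y‖ ≤ 2 * weight V x * tail V x := by
    rw [tail, ← integral_const_mul]
    exact norm_integral_le_of_norm_le hbound hle'
  linarith [hV.norm_jostMDeriv_le hk x]

/-- The quotient `w = d/φ` satisfies `w' = C/φ² = C e^{-2ikx}/m²` with `C` the Wronskian. Comparing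
increments of `w` over short intervals far out forces `C = 0`, uniformly for all `Im k ≥ 0`, even
where no second solution grows exponentially. Then `d = μ φ`, and the limit gives `μ = 0`. -/
theorem eq_zero_of_tendsto (hV : ShortRange V) (hk : 0 ≤ k.im) {d d' : ℝ → ℂ}
    (hd : SolPair V (k ^ 2) d d')
    (hlim : Tendsto (fun x : ℝ => Complex.exp (-Complex.I * k * x) * d x) atTop (𝓝 0)) :
    d = 0 := by
  have hφ := hV.solPair_jost hk
  set C : ℂ := jost V k 0 * d' 0 - jostDeriv V k 0 * d 0 with hCdef
  have hC : ∀ x, jost V k x * d' x - jostDeriv V k x * d x = C := fun x =>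
    hφ.wronskian_const hd x 0
  have hm := hV.tendsto_jostM hk
  have hcont : ContinuousAt (fun p : ℝ × ℂ => Complex.exp (-(2 * Complex.I * k) * p.1) * (p.2 ^ 2)⁻¹)
      ((0 : ℝ), (1 : ℂ)) := by
    refine ContinuousAt.mul (by fun_prop) (ContinuousAt.inv₀ (by fun_prop) (by simp))
  have hev : ∀ᶠ p : ℝ × ℂ in 𝓝 ((0 : ℝ), (1 : ℂ)),
      ‖Complex.exp (-(2 * Complex.I * k) * p.1) * (p.2 ^ 2)⁻¹ - 1‖ < 1 / 2 := by
    have h1 := (hcont.sub_const 1).norm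
    have h2 : ContinuousAt (fun p : ℝ × ℂ =>
      ‖Complex.exp (-(2 * Complex.I * k) * p.1) * (p.2 ^ 2)⁻¹ - 1‖) ((0 : ℝ), (1 : ℂ)) := h1
    refine h2.eventually_lt continuousAt_const ?_
    norm_num
  rw [nhds_prod_eq, eventually_prod_iff] at hev
  obtain ⟨pa, hpa, pb, hpb, hab⟩ := hev
  -- For `|s| < h` and `x` large, `e^{-2iks}/m²` stays within `1/2` of its limit value `1`.
  obtain ⟨h, hh, hball⟩ := Metric.eventually_nhds_iff.1 hpa
  have hm' : ∀ᶠ x in atTop, pb (jostM V k x) ∧ jostM V k x ≠ 0 :=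
    (hm.eventually hpb).and (hm.eventually (isOpen_ne.mem_nhds one_ne_zero))
  obtain ⟨X, hX⟩ := eventually_atTop.1 hm'
  have hφne : ∀ x, X ≤ x → jost V k x ≠ 0 := fun x hx =>
    mul_ne_zero (Complex.exp_ne_zero _) (hX x hx).2
  set w : ℝ → ℂ := fun x => d x / jost V k x with hw
  have hwlim : Tendsto w atTop (𝓝 0) := by
    have h1 := hlim.div hm one_ne_zero
    rw [zero_div] at h1
    refine h1.congr fun x => ?_
    simp only [hw, Pi.div_apply, jost]
    rw [show -Complex.I * k * x = -(Complex.I * k * x) by ring, Complex.exp_neg,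
      div_mul_eq_div_div]
    field_simp
  have hwd : ∀ x, X ≤ x → HasDerivAt w (C / jost V k x ^ 2) x := fun x hx =>
    ((hd.fst x).div (hφ.fst x) (hφne x hx)).congr_deriv (by rw [← hC x]; ring)
  have hineq : ∀ x, X ≤ x →
      ‖Complex.exp (2 * Complex.I * k * x) * (w (x + h / 2) - w x) - C * (h / 2 : ℝ)‖ ≤
        ‖C‖ * (1 / 2) * (h / 2) := by
    intro x hx
    have key := norm_image_sub_le_of_norm_deriv_le_segment' (a := 0) (b := h / 2)
      (C := ‖C‖ * (1 / 2))
      (f := fun s : ℝ => Complex.exp (2 * Complex.I * k * x) * w (x + s) - C * (s : ℂ))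
      (f' := fun s : ℝ => Complex.exp (2 * Complex.I * k * x) * (C / jost V k (x + s) ^ 2) - C * 1)
      (fun s hs => ?_) (fun s hs => ?_) (h / 2) (Set.right_mem_Icc.2 (by positivity))
    · simp only [add_zero, Complex.ofReal_zero, mul_zero, sub_zero] at key
      refine (le_of_eq ?_).trans key
      congr 1
      ring
    · have h1 := (hwd (x + s) (by linarith [hs.1])).comp_const_add x s
      exact ((h1.const_mul _).sub ((hasDerivAt_id' s).ofReal_comp.const_mul C)).hasDerivWithinAt
    · have h1 := hab (x := s) (hball (by
        rw [Real.dist_eq, sub_zero, abs_of_nonneg hs.1]; linarith [hs.2])) (y := jostM V k (x + s))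
        (hX (x + s) (by linarith [hs.1])).1
      have hne := (hX (x + s) (by linarith [hs.1])).2
      have h2 : Complex.exp (2 * Complex.I * k * x) * (C / jost V k (x + s) ^ 2) - C * 1 =
          C * (Complex.exp (-(2 * Complex.I * k) * s) * (jostM V k (x + s) ^ 2)⁻¹ - 1) := by
        have e1 : Complex.exp (2 * Complex.I * k * x) =
            Complex.exp (-(2 * Complex.I * k) * s) *
              Complex.exp (Complex.I * k * ((x + s : ℝ) : ℂ)) ^ 2 := by
          rw [← Complex.exp_nat_mul, ← Complex.exp_add]
          congr 1; push_cast; ring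
        rw [jost, e1]
        have := Complex.exp_ne_zero (Complex.I * k * ((x + s : ℝ) : ℂ))
        field_simp
      rw [h2, norm_mul]
      exact mul_le_mul_of_nonneg_left h1.le (norm_nonneg _)
  have hlim2 : Tendsto (fun x : ℝ =>
      ‖Complex.exp (2 * Complex.I * k * x) * (w (x + h / 2) - w x) - C * (h / 2 : ℝ)‖) atTop
      (𝓝 ‖(0 : ℂ) - C * (h / 2 : ℝ)‖) := by
    refine (Tendsto.sub_const ?_ _).norm
    have h1 : Tendsto (fun x => w (x + h / 2) - w x) atTop (𝓝 0) := by
      simpa using (hwlim.comp (tendsto_atTop_add_const_right _ (h / 2) tendsto_id)).sub hwlim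
    refine squeeze_zero_norm' ?_ (tendsto_zero_iff_norm_tendsto_zero.1 h1)
    filter_upwards [eventually_ge_atTop 0] with x hx
    rw [norm_mul]
    refine mul_le_of_le_one_left (norm_nonneg _) ?_
    simpa using norm_exp_two_I_mul_le_one hk hx
  -- Since `|e^{2ikx}| ≤ 1` for `x ≥ 0` and `w → 0`, the increments disappear in the limit, leaving
  -- `‖C‖ h/2 ≤ ‖C‖ h/4`.
  have hfin := le_of_tendsto hlim2 ((eventually_ge_atTop X).mono hineq)
  rw [zero_sub, norm_neg, norm_mul, Complex.norm_real, Real.norm_eq_abs,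
    abs_of_pos (half_pos hh)] at hfin
  have hC0 : ‖C‖ = 0 := by
    have h0 := norm_nonneg C
    have : ‖C‖ * (h / 2) ≤ 0 := by linarith
    have h3 : 0 < h / 2 := half_pos hh
    nlinarith
  obtain ⟨μ, hμ⟩ := hφ.exists_eq_mul hV.cont hd (hV.jost_ne_zero hk) (norm_eq_zero.1 hC0)
  have hμ0 : μ = 0 := by
    have h1 : Tendsto (fun x => μ * jostM V k x) atTop (𝓝 0) := by
      refine hlim.congr fun x => ?_
      rw [(hμ x).1, ← exp_neg_I_mul_jost]; ring
    have h2 := tendsto_nhds_unique h1 (hm.const_mul μ)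
    simpa using h2.symm
  funext x
  rw [(hμ x).1, hμ0]; simp

theorem eq_jost (hV : ShortRange V) (hk : 0 ≤ k.im) {ψ : ℝ → ℂ} (h : IsRightJost V k ψ) :
    ψ = jost V k := by
  have h1 := hV.eq_zero_of_tendsto hk (h.1.solPair.lincomb (hV.solPair_jost hk) 1 (-1)) (by
    have := h.2.sub (hV.tendsto_jostM hk)
    rw [sub_self] at this
    refine this.congr fun x => ?_
    rw [← exp_neg_I_mul_jost]; ring)
  funext x
  have := congrFun h1 x
  simp only [Pi.zero_apply] at this
  linear_combination this

/-- Conjugating the equation and the normalization gives a Jost solution at `-conj k`; uniqueness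
identifies it. The second half follows because derivatives are unique. -/
theorem jost_conj (hV : ShortRange V) (hk : 0 ≤ k.im) (x : ℝ) :
    jost V (-(starRingEnd ℂ) k) x = (starRingEnd ℂ) (jost V k x) ∧
    jostDeriv V (-(starRingEnd ℂ) k) x = (starRingEnd ℂ) (jostDeriv V k x) := by
  have hk' : 0 ≤ (-(starRingEnd ℂ) k).im := by simpa using hk
  have hs : SolPair V ((-(starRingEnd ℂ) k) ^ 2) (fun x => (starRingEnd ℂ) (jost V k x))
      (fun x => (starRingEnd ℂ) (jostDeriv V k x)) := by
    have := (hV.solPair_jost hk).conj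
    rwa [map_pow, ← neg_sq] at this
  have h1 : IsRightJost V (-(starRingEnd ℂ) k) (fun x => (starRingEnd ℂ) (jost V k x)) := by
    refine ⟨hs.isSchrodingerSolution hV.cont, ?_⟩
    have := (Complex.continuous_conj.tendsto _).comp (hV.tendsto_jostM hk)
    rw [map_one] at this
    refine this.congr fun x => ?_
    simp only [Function.comp]
    rw [← exp_neg_I_mul_jost, map_mul, ← Complex.exp_conj]
    congr 2
    simp
  have h2 := hV.eq_jost hk' h1
  refine ⟨(congrFun h2 x).symm, ?_⟩
  have h3 := hs.fst x
  rw [h2] at h3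
  exact ((hV.solPair_jost hk').fst x).unique h3

/-- For real `s` the exponentials cancel in this constant Wronskian. What is left involves only `m`
and `m'` and is evaluated at infinity, where they tend to `1` and `0`. -/
theorem wronskian_jost_conj (hV : ShortRange V) (s : ℝ) (x : ℝ) :
    jost V s x * (starRingEnd ℂ) (jostDeriv V s x) -
      jostDeriv V s x * (starRingEnd ℂ) (jost V s x) = -(2 * Complex.I * s) := by
  have hk : 0 ≤ (s : ℂ).im := by simp
  have hs := hV.solPair_jost hk
  have hc := hs.conj
  rw [map_pow, Complex.conj_ofReal] at hc
  set K := jost V s x * (starRingEnd ℂ) (jostDeriv V s x) -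
      jostDeriv V s x * (starRingEnd ℂ) (jost V s x)
  have h1 : ∀ y : ℝ, jostM V s y * (starRingEnd ℂ) (Complex.I * s * jostM V s y + jostMDeriv V s y) -
      (Complex.I * s * jostM V s y + jostMDeriv V s y) * (starRingEnd ℂ) (jostM V s y) = K := by
    intro y
    have e : Complex.exp (Complex.I * s * y) * (starRingEnd ℂ) (Complex.exp (Complex.I * s * y)) = 1 := by
      rw [← Complex.exp_conj, ← Complex.exp_add]
      simp
    have e2 : _ = K := hs.wronskian_const hc y x
    rw [← e2]
    simp only [jost, jostDeriv, map_mul, map_add]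
    linear_combination (-(jostM V s y * ((starRingEnd ℂ) Complex.I * (starRingEnd ℂ) (s : ℂ) *
      (starRingEnd ℂ) (jostM V s y) + (starRingEnd ℂ) (jostMDeriv V s y)) -
      (Complex.I * s * jostM V s y + jostMDeriv V s y) * (starRingEnd ℂ) (jostM V s y))) * e
  have hm := hV.tendsto_jostM hk
  have hm' := hV.tendsto_jostMDeriv hk
  have hsum := (hm.const_mul (Complex.I * s)).add hm'
  have hl := (hm.mul ((Complex.continuous_conj.tendsto _).comp hsum)).sub
    (hsum.mul ((Complex.continuous_conj.tendsto _).comp hm))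
  have h3 : Tendsto (fun _ : ℝ => K) atTop (𝓝 K) := tendsto_const_nhds
  have h4 := tendsto_nhds_unique h3 (hl.congr h1)
  rw [h4]
  simp
  ring

end ShortRange
end StepKdV
end

noncomputable section
namespace StepKdV

/-! ### The branch `k = √(k₁² - c²)` -/

theorem half_cpow_sq (z : ℂ) : (z ^ (1 / 2 : ℂ)) ^ 2 = z := by
  simp

theorem kOf_sq (c : ℝ) (k₁ : ℂ) : kOf c k₁ ^ 2 = k₁ ^ 2 - c ^ 2 := by
  rw [kOf, mul_pow, half_cpow_sq, half_cpow_sq]; ring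

/-- The argument of the product of the two half powers is half the sum of the arguments of `k₁ ∓ c`.
For `Im k₁ ≥ 0` both lie in `[0, π]`, which decides the sign of the sine. -/
theorem kOf_im (c : ℝ) (k₁ : ℂ) (h1 : k₁ - c ≠ 0) (h2 : k₁ + c ≠ 0) :
    ∃ r : ℝ, 0 < r ∧
      (kOf c k₁).im = r * Real.sin ((Complex.arg (k₁ - c) + Complex.arg (k₁ + c)) / 2) := by
  refine ⟨Real.exp (Complex.log (k₁ - c) * (1 / 2) + Complex.log (k₁ + c) * (1 / 2)).re,
    Real.exp_pos _, ?_⟩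
  rw [kOf, Complex.cpow_def_of_ne_zero h1, Complex.cpow_def_of_ne_zero h2, ← Complex.exp_add,
    Complex.exp_im]
  congr 2
  rw [Complex.add_im, Complex.mul_im, Complex.mul_im, Complex.log_im, Complex.log_im]
  simp
  ring

theorem kOf_im_pos (c : ℝ) {k₁ : ℂ} (h : 0 < k₁.im) : 0 < (kOf c k₁).im := by
  have e1 : 0 < (k₁ - c).im := by simpa using h
  have e2 : 0 < (k₁ + c).im := by simpa using h
  have harg : ∀ z : ℂ, 0 < z.im → 0 < z.arg ∧ z.arg < Real.pi := fun z hz => by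
    refine ⟨lt_of_le_of_ne (Complex.arg_nonneg_iff.2 hz.le) fun h0 => ?_,
      lt_of_le_of_ne (Complex.arg_le_pi z) fun h0 => ?_⟩
    · exact hz.ne' (Complex.arg_eq_zero_iff.1 h0.symm).2
    · exact hz.ne' (Complex.arg_eq_pi_iff.1 h0).2
  obtain ⟨r, hr, h3⟩ := kOf_im c k₁ (fun h0 => by simp [h0] at e1) (fun h0 => by simp [h0] at e2)
  rw [h3]
  obtain ⟨a1, a2⟩ := harg _ e1
  obtain ⟨b1, b2⟩ := harg _ e2
  exact mul_pos hr (Real.sin_pos_of_pos_of_lt_pi (by linarith) (by linarith))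

theorem kOf_im_nonneg (c : ℝ) {k₁ : ℂ} (h : 0 ≤ k₁.im) : 0 ≤ (kOf c k₁).im := by
  by_cases h1 : k₁ - c = 0
  · simp [kOf, h1]
  by_cases h2 : k₁ + c = 0
  · simp [kOf, h2]
  obtain ⟨r, hr, h3⟩ := kOf_im c k₁ h1 h2
  rw [h3]
  have a1 := Complex.arg_nonneg_iff.2 (show 0 ≤ (k₁ - c).im by simpa using h)
  have b1 := Complex.arg_nonneg_iff.2 (show 0 ≤ (k₁ + c).im by simpa using h)
  have a2 := Complex.arg_le_pi (k₁ - c)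
  have b2 := Complex.arg_le_pi (k₁ + c)
  exact mul_nonneg hr.le (Real.sin_nonneg_of_nonneg_of_le_pi (by linarith) (by linarith))

/-- The principal logarithm jumps across the negative axis, but it is continuous up to the axis from
above, the only side needed. -/
theorem continuousOn_half_cpow : ContinuousOn (fun z : ℂ => z ^ (1 / 2 : ℂ)) upperClosed := by
  intro z hz
  by_cases h : 0 ≤ z.re ∨ z.im ≠ 0
  · exact (Complex.continuousAt_cpow_const_of_re_pos h (by norm_num)).continuousWithinAt
  · push Not at h
    have h0 : z ≠ 0 := fun h0 => by simp [h0] at h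
    have h1 : ContinuousWithinAt (fun z => Complex.exp (Complex.log z * (1 / 2 : ℂ))) upperClosed z :=
      ((Complex.continuousWithinAt_log_of_re_neg_of_im_zero h.1 h.2).mul
        continuousWithinAt_const).cexp
    refine h1.congr_of_eventuallyEq ?_ (Complex.cpow_def_of_ne_zero h0 _)
    filter_upwards [mem_nhdsWithin_of_mem_nhds (isOpen_ne.mem_nhds h0)] with w hw
    exact Complex.cpow_def_of_ne_zero hw _

theorem continuousOn_kOf (c : ℝ) : ContinuousOn (kOf c) upperClosed := by
  refine ContinuousOn.mul ?_ ?_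
  · exact continuousOn_half_cpow.comp (by fun_prop) fun k hk => by
      simpa [upperClosed] using hk
  · exact continuousOn_half_cpow.comp (by fun_prop) fun k hk => by
      simpa [upperClosed] using hk

theorem differentiableOn_kOf (c : ℝ) : DifferentiableOn ℂ (kOf c) upperOpen := by
  intro k hk
  have hk : 0 < k.im := hk
  have h1 : DifferentiableAt ℂ (fun k : ℂ => (k - c) ^ (1 / 2 : ℂ)) k :=
    DifferentiableAt.cpow_const (by fun_prop) (Or.inr (by simpa using hk.ne'))
  have h2 : DifferentiableAt ℂ (fun k : ℂ => (k + c) ^ (1 / 2 : ℂ)) k :=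
    DifferentiableAt.cpow_const (by fun_prop) (Or.inr (by simpa using hk.ne'))
  exact (h1.mul h2).differentiableWithinAt

theorem half_cpow_of_nonneg {x : ℝ} (hx : 0 ≤ x) : ((x : ℂ)) ^ (1 / 2 : ℂ) = (Real.sqrt x : ℝ) := by
  rw [Real.sqrt_eq_rpow, Complex.ofReal_cpow hx]; norm_num

theorem half_cpow_of_nonpos {x : ℝ} (hx : x ≤ 0) :
    ((x : ℂ)) ^ (1 / 2 : ℂ) = Complex.I * (Real.sqrt (-x) : ℝ) := by
  rw [Complex.ofReal_cpow_of_nonpos hx]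
  have h1 : Complex.exp (Real.pi * Complex.I * (1 / 2)) = Complex.I := by
    rw [show (Real.pi * Complex.I * (1 / 2) : ℂ) = (Real.pi / 2 : ℂ) * Complex.I by ring]
    exact Complex.exp_pi_div_two_mul_I
  rw [h1, show (-(x : ℂ)) = ((-x : ℝ) : ℂ) by simp, half_cpow_of_nonneg (by linarith), mul_comm]

theorem kOf_of_gt {c s : ℝ} (hc : 0 ≤ c) (hs : c < s) :
    kOf c s = ((Real.sqrt (s - c) * Real.sqrt (s + c) : ℝ) : ℂ) := by
  rw [kOf, ← Complex.ofReal_sub, ← Complex.ofReal_add, half_cpow_of_nonneg (by linarith),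
    half_cpow_of_nonneg (by linarith)]
  push_cast; rfl

theorem kOf_of_lt {c s : ℝ} (hc : 0 ≤ c) (hs : s < -c) :
    kOf c s = ((-(Real.sqrt (-s + c) * Real.sqrt (-s - c)) : ℝ) : ℂ) := by
  rw [kOf, ← Complex.ofReal_sub, ← Complex.ofReal_add, half_cpow_of_nonpos (by linarith),
    half_cpow_of_nonpos (by linarith)]
  rw [show -(s - c) = -s + c by ring, show -(s + c) = -s - c by ring]
  push_cast
  linear_combination (Real.sqrt (-s + c) : ℂ) * Real.sqrt (-s - c) * Complex.I_sq

theorem kOf_of_mem {c s : ℝ} (hs : s ∈ Set.Icc (-c) c) :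
    kOf c s = Complex.I * ((Real.sqrt (c - s) * Real.sqrt (c + s) : ℝ) : ℂ) := by
  rw [kOf, ← Complex.ofReal_sub, ← Complex.ofReal_add, half_cpow_of_nonpos (by linarith [hs.2]),
    half_cpow_of_nonneg (by linarith [hs.1])]
  rw [show -(s - c) = c - s by ring, show s + c = c + s by ring]
  push_cast; ring

/-- On the real line `-s` corresponds to the reflection `k ↦ -conj k` of `jost_conj`; all scattering
data at `-s` are thereby conjugates of those at `s`. -/
theorem kOf_neg {c : ℝ} (hc : 0 ≤ c) (s : ℝ) : kOf c (-s : ℝ) = -(starRingEnd ℂ) (kOf c s) := by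
  by_cases h : s ∈ Set.Icc (-c) c
  · rw [kOf_of_mem h, kOf_of_mem (s := -s) ⟨by linarith [h.2], by linarith [h.1]⟩, map_mul,
      Complex.conj_I, Complex.conj_ofReal, sub_neg_eq_add, ← sub_eq_add_neg]
    push_cast; ring
  · rw [Set.mem_Icc, not_and_or, not_le, not_le] at h
    rcases h with h | h
    · rw [kOf_of_lt hc h, kOf_of_gt hc (s := -s) (by linarith), Complex.conj_ofReal]
      push_cast; ring
    · rw [kOf_of_gt hc h, kOf_of_lt hc (s := -s) (by linarith), Complex.conj_ofReal]
      simp only [neg_neg]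
      push_cast; ring

/-- The square determines the value up to sign, and the positive imaginary part selects the sign. -/
theorem kOf_I_mul (c : ℝ) {s : ℝ} (hs : 0 < s) :
    kOf c (Complex.I * s) = Complex.I * (Real.sqrt (s ^ 2 + c ^ 2) : ℝ) := by
  have h1 := kOf_sq c (Complex.I * s)
  have h2 : 0 < (kOf c (Complex.I * s)).im := kOf_im_pos c (by simpa using hs)
  set A := Real.sqrt (s ^ 2 + c ^ 2)
  have hA : (A : ℂ) ^ 2 = s ^ 2 + c ^ 2 := by
    have := Real.sq_sqrt (show 0 ≤ s ^ 2 + c ^ 2 by positivity)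
    exact_mod_cast this
  have h3 : (kOf c (Complex.I * s) - Complex.I * A) * (kOf c (Complex.I * s) + Complex.I * A) = 0 := by
    linear_combination h1 + (s ^ 2 - A ^ 2 : ℂ) * Complex.I_sq + hA
  rcases mul_eq_zero.1 h3 with h | h
  · linear_combination h
  · exfalso
    have h4 := congrArg Complex.im h
    simp at h4
    have : 0 ≤ A := Real.sqrt_nonneg _
    linarith

/-! ### Steplike potentials -/

/-- The reflected potential `q(-x) + c²`. -/
def reflected (c : ℝ) (q : ℝ → ℝ) (x : ℝ) : ℝ := q (-x) + c ^ 2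

/-- Continuous steplike potentials with finite first moments. -/
structure StepPotential (c : ℝ) (q : ℝ → ℝ) : Prop where
  right : ShortRange q
  left : ShortRange (reflected c q)

/-- The left Jost solution. -/
def leftJost (q : ℝ → ℝ) (c : ℝ) (k₁ : ℂ) (x : ℝ) : ℂ := jost (reflected c q) k₁ (-x)

/-- The derivative of the left Jost solution. -/
def leftJostDeriv (q : ℝ → ℝ) (c : ℝ) (k₁ : ℂ) (x : ℝ) : ℂ := -jostDeriv (reflected c q) k₁ (-x)

theorem SolPair.reflect {V : ℝ → ℝ} {E : ℂ} {f g : ℝ → ℂ} (h : SolPair V E f g) (a : ℝ) :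
    SolPair (fun x => V (-x) + a) (E + a) (fun x => f (-x)) (fun x => -g (-x)) where
  fst x := ((h.fst (-x)).scomp x (hasDerivAt_neg x)).congr_deriv (by simp)
  snd x := (((h.snd (-x)).scomp x (hasDerivAt_neg x)).neg).congr_deriv (by simp)

namespace StepPotential

variable {c : ℝ} {q : ℝ → ℝ} {k₁ : ℂ}

theorem solPair_right (hq : StepPotential c q) (hk : 0 ≤ k₁.im) :
    SolPair q (k₁ ^ 2 - c ^ 2) (jost q (kOf c k₁)) (jostDeriv q (kOf c k₁)) := by
  rw [← kOf_sq]; exact hq.right.solPair_jost (kOf_im_nonneg c hk)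

theorem solPair_left (hq : StepPotential c q) (hk : 0 ≤ k₁.im) :
    SolPair q (k₁ ^ 2 - c ^ 2) (leftJost q c k₁) (leftJostDeriv q c k₁) := by
  have h := (hq.left.solPair_jost hk).reflect (-c ^ 2)
  have h1 : (fun x => reflected c q (-x) + -c ^ 2) = q := by
    funext x; simp [reflected]
  rw [h1] at h
  have e : k₁ ^ 2 + ((-c ^ 2 : ℝ) : ℂ) = k₁ ^ 2 - c ^ 2 := by push_cast; ring
  rw [e] at h
  exact h

theorem jostRight_eq (hq : StepPotential c q) (hk : 0 ≤ k₁.im) :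
    jostRight q c k₁ = jost q (kOf c k₁) :=
  hq.right.eq_jost (kOf_im_nonneg c hk)
    (Classical.epsilon_spec (p := IsRightJost q (kOf c k₁))
      ⟨_, hq.right.isRightJost_jost (kOf_im_nonneg c hk)⟩)

theorem tendsto_exp_mul_leftJost (hq : StepPotential c q) (hk : 0 ≤ k₁.im) :
    Tendsto (fun x : ℝ => Complex.exp (Complex.I * k₁ * x) * leftJost q c k₁ x) atBot (𝓝 1) := by
  refine ((hq.left.tendsto_jostM hk).comp tendsto_neg_atBot_atTop).congr fun x => ?_
  simp only [Function.comp]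
  rw [← exp_neg_I_mul_jost, leftJost]
  congr 2; push_cast; ring

theorem isLeftJost_leftJost (hq : StepPotential c q) (hk : 0 ≤ k₁.im) :
    IsLeftJost q c k₁ (leftJost q c k₁) :=
  ⟨(hq.solPair_left hk).isSchrodingerSolution hq.right.cont, hq.tendsto_exp_mul_leftJost hk⟩

/-- Reflection turns the chosen solution into a right Jost solution of `reflected c q`, to which
uniqueness applies. -/
theorem jostLeft_eq (hq : StepPotential c q) (hk : 0 ≤ k₁.im) :
    jostLeft q c k₁ = leftJost q c k₁ := by
  obtain ⟨h1, h2⟩ := Classical.epsilon_spec (p := IsLeftJost q c k₁) ⟨_, hq.isLeftJost_leftJost hk⟩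
  have h3 : IsRightJost (reflected c q) k₁ (fun x => jostLeft q c k₁ (-x)) := by
    constructor
    · have := h1.solPair.reflect (c ^ 2)
      have e : k₁ ^ 2 - (c : ℂ) ^ 2 + ((c ^ 2 : ℝ) : ℂ) = k₁ ^ 2 := by push_cast; ring
      rw [e] at this
      exact this.isSchrodingerSolution hq.left.cont
    · refine (h2.comp tendsto_neg_atTop_atBot).congr fun x => ?_
      simp only [Function.comp]
      rw [jostLeft]
      congr 2; push_cast; ring
  have h4 := hq.left.eq_jost hk h3
  funext x
  have := congrFun h4 (-x)
  simpa [leftJost] using this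

theorem leftJost_ne_zero (hq : StepPotential c q) (hk : 0 ≤ k₁.im) : leftJost q c k₁ ≠ 0 := by
  intro h
  refine hq.left.jost_ne_zero hk (funext fun x => ?_)
  have := congrFun h (-x)
  simpa [leftJost] using this

theorem wronskian_eq (hq : StepPotential c q) (hk : 0 ≤ k₁.im) (x : ℝ) :
    jostWronskian q c k₁ = leftJost q c k₁ x * jostDeriv q (kOf c k₁) x -
      leftJostDeriv q c k₁ x * jost q (kOf c k₁) x := by
  rw [(hq.solPair_left hk).wronskian_const (hq.solPair_right hk) x 0, jostWronskian,
    hq.jostRight_eq hk, hq.jostLeft_eq hk, (hq.solPair_left hk).deriv_eq,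
    (hq.solPair_right hk).deriv_eq]

theorem continuousOn_leftJost (hq : StepPotential c q) (x : ℝ) :
    ContinuousOn (fun k₁ => leftJost q c k₁ x) upperClosed := by
  have := hq.left.continuousOn_jostM (-x)
  unfold leftJost jost
  fun_prop

theorem continuousOn_leftJostDeriv (hq : StepPotential c q) (x : ℝ) :
    ContinuousOn (fun k₁ => leftJostDeriv q c k₁ x) upperClosed := by
  have h1 := hq.left.continuousOn_jostM (-x)
  have h2 := hq.left.continuousOn_jostMDeriv (-x)
  unfold leftJostDeriv jostDeriv
  fun_prop

theorem differentiableOn_leftJost (hq : StepPotential c q) (x : ℝ) :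
    DifferentiableOn ℂ (fun k₁ => leftJost q c k₁ x) upperOpen := by
  have := hq.left.differentiableOn_jostM (-x)
  unfold leftJost jost
  fun_prop

theorem differentiableOn_leftJostDeriv (hq : StepPotential c q) (x : ℝ) :
    DifferentiableOn ℂ (fun k₁ => leftJostDeriv q c k₁ x) upperOpen := by
  have h1 := hq.left.differentiableOn_jostM (-x)
  have h2 := hq.left.differentiableOn_jostMDeriv (-x)
  unfold leftJostDeriv jostDeriv
  fun_prop

theorem mapsTo_kOf_closed (c : ℝ) : Set.MapsTo (kOf c) upperClosed upperClosed :=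
  fun _ hk => kOf_im_nonneg c hk

theorem mapsTo_kOf_open (c : ℝ) : Set.MapsTo (kOf c) upperOpen upperOpen :=
  fun _ hk => kOf_im_pos c hk

theorem continuousOn_rightJost (hq : StepPotential c q) (x : ℝ) :
    ContinuousOn (fun k₁ => jost q (kOf c k₁) x) upperClosed := by
  have h0 := continuousOn_kOf c
  have h1 := (hq.right.continuousOn_jostM x).comp h0 (mapsTo_kOf_closed c)
  simp only [Function.comp_def] at h1
  unfold jost
  fun_prop

theorem continuousOn_rightJostDeriv (hq : StepPotential c q) (x : ℝ) :
    ContinuousOn (fun k₁ => jostDeriv q (kOf c k₁) x) upperClosed := by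
  have h0 := continuousOn_kOf c
  have h1 := (hq.right.continuousOn_jostM x).comp h0 (mapsTo_kOf_closed c)
  have h2 := (hq.right.continuousOn_jostMDeriv x).comp h0 (mapsTo_kOf_closed c)
  simp only [Function.comp_def] at h1 h2
  unfold jostDeriv
  fun_prop

theorem differentiableOn_rightJost (hq : StepPotential c q) (x : ℝ) :
    DifferentiableOn ℂ (fun k₁ => jost q (kOf c k₁) x) upperOpen := by
  have h0 := differentiableOn_kOf c
  have h1 := (hq.right.differentiableOn_jostM x).comp h0 (mapsTo_kOf_open c)
  simp only [Function.comp_def] at h1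
  unfold jost
  fun_prop

theorem differentiableOn_rightJostDeriv (hq : StepPotential c q) (x : ℝ) :
    DifferentiableOn ℂ (fun k₁ => jostDeriv q (kOf c k₁) x) upperOpen := by
  have h0 := differentiableOn_kOf c
  have h1 := (hq.right.differentiableOn_jostM x).comp h0 (mapsTo_kOf_open c)
  have h2 := (hq.right.differentiableOn_jostMDeriv x).comp h0 (mapsTo_kOf_open c)
  simp only [Function.comp_def] at h1 h2
  unfold jostDeriv
  fun_prop

theorem continuousOn_wronskian (hq : StepPotential c q) :
    ContinuousOn (jostWronskian q c) upperClosed := by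
  refine ContinuousOn.congr ?_ fun k hk => hq.wronskian_eq hk 0
  exact ((hq.continuousOn_leftJost 0).mul (hq.continuousOn_rightJostDeriv 0)).sub
    ((hq.continuousOn_leftJostDeriv 0).mul (hq.continuousOn_rightJost 0))

theorem differentiableOn_wronskian (hq : StepPotential c q) :
    DifferentiableOn ℂ (jostWronskian q c) upperOpen := by
  refine DifferentiableOn.congr ?_ fun k hk => hq.wronskian_eq (upperOpen_subset hk) 0
  exact ((hq.differentiableOn_leftJost 0).mul (hq.differentiableOn_rightJostDeriv 0)).sub
    ((hq.differentiableOn_leftJostDeriv 0).mul (hq.differentiableOn_rightJost 0))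

end StepPotential
end StepKdV
end

noncomputable section
namespace StepKdV

/-! ### High-energy asymptotics -/

theorem ShortRange.tendsto_jostM_param {V : ℝ → ℝ} (hV : ShortRange V) (x : ℝ) {a : ℝ → ℝ}
    (ha : Tendsto a atTop atTop) :
    Tendsto (fun s => jostM V (Complex.I * a s) x) atTop (𝓝 1) := by
  rw [tendsto_iff_norm_sub_tendsto_zero]
  have h1 : Tendsto (fun s => 2 * (weight V x * tail V x) * (a s)⁻¹) atTop (𝓝 0) := by
    simpa using (tendsto_inv_atTop_zero.comp ha).const_mul (2 * (weight V x * tail V x))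
  refine squeeze_zero' (Eventually.of_forall fun _ => norm_nonneg _) ?_ h1
  filter_upwards [ha.eventually_gt_atTop 0] with s hs
  have h2 := hV.norm_two_I_mul_jostM_sub_one_le (k := Complex.I * a s) (by simpa using hs.le) x
  rw [norm_mul, Complex.norm_I, one_mul, Complex.norm_real, Real.norm_eq_abs, abs_of_pos hs] at h2
  rw [← div_eq_mul_inv, le_div_iff₀ hs]
  linarith

/-- `√(s² + c²)`. -/
def kappaOf (c s : ℝ) : ℝ := Real.sqrt (s ^ 2 + c ^ 2)

theorem le_kappaOf {c s : ℝ} : s ≤ kappaOf c s :=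
  Real.le_sqrt_of_sq_le (by nlinarith [sq_nonneg c])

theorem tendsto_kappaOf (c : ℝ) : Tendsto (kappaOf c) atTop atTop :=
  tendsto_atTop_mono (fun _ => le_kappaOf) tendsto_id

/-- From `κ² - s² = c²` one gets `κ - s ≤ c²/s`. This controls the mismatch between `e^{ikx}` and
`e^{-ik₁x}` in the first entry along the imaginary axis. -/
theorem tendsto_kappaOf_sub (c : ℝ) : Tendsto (fun s => kappaOf c s - s) atTop (𝓝 0) := by
  have h1 : Tendsto (fun s : ℝ => c ^ 2 * s⁻¹) atTop (𝓝 0) := by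
    simpa using tendsto_inv_atTop_zero.const_mul (c ^ 2)
  refine squeeze_zero' (Eventually.of_forall fun s => sub_nonneg.2 le_kappaOf) ?_ h1
  filter_upwards [eventually_gt_atTop 0] with s hs
  rw [← div_eq_mul_inv, le_div_iff₀ hs]
  have h2 : kappaOf c s ^ 2 = s ^ 2 + c ^ 2 := Real.sq_sqrt (by positivity)
  have h3 : s ≤ kappaOf c s := le_kappaOf
  nlinarith

theorem tendsto_kappaOf_div (c : ℝ) : Tendsto (fun s => kappaOf c s / s) atTop (𝓝 1) := by
  have h1 : Tendsto (fun s => (kappaOf c s - s) * s⁻¹ + 1) atTop (𝓝 (0 * 0 + 1)) :=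
    ((tendsto_kappaOf_sub c).mul tendsto_inv_atTop_zero).add_const 1
  rw [mul_zero, zero_add] at h1
  refine h1.congr' ?_
  filter_upwards [eventually_gt_atTop 0] with s hs
  field_simp
  ring

namespace StepPotential

variable {c : ℝ} {q : ℝ → ℝ} {k₁ : ℂ}

theorem wronskian_eq_jostM (hq : StepPotential c q) (hk : 0 ≤ k₁.im) :
    jostWronskian q c k₁ =
      Complex.I * (kOf c k₁ + k₁) * (jostM (reflected c q) k₁ 0 * jostM q (kOf c k₁) 0) +
      (jostM (reflected c q) k₁ 0 * jostMDeriv q (kOf c k₁) 0 +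
        jostMDeriv (reflected c q) k₁ 0 * jostM q (kOf c k₁) 0) := by
  rw [hq.wronskian_eq hk 0]
  simp only [leftJost, leftJostDeriv, jost, jostDeriv, neg_zero, Complex.ofReal_zero, mul_zero,
    Complex.exp_zero]
  ring

/-- In `wronskian_eq_jostM` the term `i(k + k₁) m m₁` dominates, the terms with derivatives being
bounded. Thus `W ~ 2ik₁`, which yields `T₁ → 1` and also bounds the discrete spectrum. -/
theorem tendsto_wronskian_div (hq : StepPotential c q) :
    Tendsto (fun s : ℝ => jostWronskian q c (Complex.I * s) / (2 * Complex.I * (Complex.I * s)))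
      atTop (𝓝 1) := by
  have h1 := hq.left.tendsto_jostM_param 0 tendsto_id
  have h2 := hq.right.tendsto_jostM_param 0 (tendsto_kappaOf c)
  have hinv : Tendsto (fun s : ℝ => ((s⁻¹ : ℝ) : ℂ)) atTop (𝓝 0) := by
    simpa [Function.comp_def] using (Complex.continuous_ofReal.tendsto 0).comp tendsto_inv_atTop_zero
  have hdiv : Tendsto (fun s : ℝ => ((kappaOf c s / s : ℝ) : ℂ)) atTop (𝓝 1) := by
    simpa [Function.comp_def] using (Complex.continuous_ofReal.tendsto 1).comp (tendsto_kappaOf_div c)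
  have hb : ∀ {V : ℝ → ℝ}, ShortRange V → ∀ a : ℝ → ℝ, (∀ᶠ s in atTop, 0 ≤ a s) →
      Tendsto (fun s : ℝ => ((s⁻¹ : ℝ) : ℂ) * jostMDeriv V (Complex.I * a s) 0) atTop (𝓝 0) := by
    intro V hV a ha
    have h3 : Tendsto (fun s : ℝ => s⁻¹ * (2 * (weight V 0 * tail V 0))) atTop (𝓝 0) := by
      simpa using tendsto_inv_atTop_zero.mul_const (2 * (weight V 0 * tail V 0))
    refine squeeze_zero_norm' ?_ h3
    filter_upwards [eventually_gt_atTop 0, ha] with s hs has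
    rw [norm_mul, Complex.norm_real, Real.norm_eq_abs, abs_of_pos (inv_pos.2 hs)]
    exact mul_le_mul_of_nonneg_left (hV.norm_jostMDeriv_le (by simpa using has) 0)
      (inv_pos.2 hs).le
  have h3 := hb hq.left id (eventually_ge_atTop 0)
  have h4 := hb hq.right (kappaOf c) ((tendsto_kappaOf c).eventually_ge_atTop 0)
  have h5 := ((hdiv.add_const 1).div_const 2).mul (h1.mul h2)
  have h6 := ((h1.mul h4).add (h3.mul h2)).const_mul (-(1 / 2) : ℂ)
  have h7 := h5.add h6
  norm_num at h7
  refine h7.congr' ?_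
  filter_upwards [eventually_gt_atTop 0] with s hs
  have hs0 : (s : ℂ) ≠ 0 := by exact_mod_cast hs.ne'
  have hk : kOf c (Complex.I * s) = Complex.I * (kappaOf c s : ℝ) := kOf_I_mul c hs
  have hI : (2 * Complex.I * (Complex.I * s) : ℂ) = -2 * s := by
    linear_combination (2 * s : ℂ) * Complex.I_sq
  rw [hq.wronskian_eq_jostM (by simpa using hs.le), hk, hI]
  generalize jostM (reflected c q) (Complex.I * s) 0 = a
  generalize jostM q (Complex.I * (kappaOf c s : ℝ)) 0 = b
  generalize jostMDeriv (reflected c q) (Complex.I * s) 0 = a'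
  generalize jostMDeriv q (Complex.I * (kappaOf c s : ℝ)) 0 = b'
  field_simp
  linear_combination ((kappaOf c s : ℂ) + s) * a * b * Complex.I_sq

theorem tendsto_leftTransmission (hq : StepPotential c q) :
    Tendsto (fun s : ℝ => leftTransmission q c (Complex.I * s)) atTop (𝓝 1) := by
  have := hq.tendsto_wronskian_div.inv₀ one_ne_zero
  rw [inv_one] at this
  refine this.congr fun s => ?_
  rw [leftTransmission, inv_div]

theorem tendsto_leftVector (hq : StepPotential c q) (x : ℝ) :
    Tendsto (fun s : ℝ => leftVector q c x (Complex.I * s)) atTop (𝓝 ![1, 1]) := by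
  have h1 := hq.left.tendsto_jostM_param (-x) tendsto_id
  have h2 := hq.right.tendsto_jostM_param x (tendsto_kappaOf c)
  have h3 : Tendsto (fun s : ℝ => Complex.exp (-(((kappaOf c s - s : ℝ) : ℂ) * x))) atTop (𝓝 1) := by
    have h4 := ((Complex.continuous_ofReal.tendsto 0).comp (tendsto_kappaOf_sub c)).mul_const (x : ℂ)
    simpa [Function.comp_def] using (Complex.continuous_exp.tendsto _).comp h4.neg
  have h5 := (hq.tendsto_leftTransmission.mul (h2.mul h3))
  norm_num at h5
  refine tendsto_pi_nhds.2 fun i => ?_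
  fin_cases i
  · refine h5.congr' ?_
    filter_upwards [eventually_gt_atTop 0] with s hs
    have him : 0 < (Complex.I * (s : ℂ)).im := by simpa using hs
    simp only [leftVector, him, if_true, Fin.zero_eta, Matrix.cons_val_zero]
    rw [hq.jostRight_eq him.le, kOf_I_mul c hs, jost]
    change _ * (jostM q (Complex.I * ((kappaOf c s : ℝ) : ℂ)) x * _) =
      _ * (Complex.exp (Complex.I * (Complex.I * ((kappaOf c s : ℝ) : ℂ)) * x) *
        jostM q (Complex.I * ((kappaOf c s : ℝ) : ℂ)) x) * _
    have : Complex.exp (-(((kappaOf c s : ℂ) - s) * x)) =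
        Complex.exp (Complex.I * (Complex.I * ((kappaOf c s : ℝ) : ℂ)) * x) *
        Complex.exp (-Complex.I * (Complex.I * s) * x) := by
      rw [← Complex.exp_add]
      congr 1
      linear_combination (-((kappaOf c s : ℂ) - s) * x) * Complex.I_sq
    rw [this]; ring
  · refine h1.congr' ?_
    filter_upwards [eventually_gt_atTop 0] with s hs
    have him : 0 < (Complex.I * (s : ℂ)).im := by simpa using hs
    simp only [leftVector, him, if_true, Fin.mk_one, Matrix.cons_val_one, Matrix.cons_val_fin_one]
    rw [hq.jostLeft_eq him.le, leftJost, ← exp_neg_I_mul_jost, mul_comm]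
    simp

/-! ### The real axis -/

theorem wronskian_leftJost_conj (hq : StepPotential c q) (s x : ℝ) :
    leftJost q c s x * (starRingEnd ℂ) (leftJostDeriv q c s x) -
      leftJostDeriv q c s x * (starRingEnd ℂ) (leftJost q c s x) = 2 * Complex.I * s := by
  have := hq.left.wronskian_jost_conj s (-x)
  simp only [leftJost, leftJostDeriv, map_neg]
  linear_combination -this

theorem solPair_left_conj (hq : StepPotential c q) (s : ℝ) :
    SolPair q ((s : ℂ) ^ 2 - c ^ 2) (fun x => (starRingEnd ℂ) (leftJost q c s x))
      (fun x => (starRingEnd ℂ) (leftJostDeriv q c s x)) := by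
  have := (hq.solPair_left (k₁ := s) (by simp)).conj
  simpa using this

theorem rightJost_real (hq : StepPotential c q) {s : ℝ} (hs : s ∈ Set.Icc (-c) c) (x : ℝ) :
    (starRingEnd ℂ) (jost q (kOf c s) x) = jost q (kOf c s) x ∧
    (starRingEnd ℂ) (jostDeriv q (kOf c s) x) = jostDeriv q (kOf c s) x := by
  have h1 := hq.right.jost_conj (kOf_im_nonneg c (k₁ := (s : ℂ)) (by simp)) x
  have h2 : -(starRingEnd ℂ) (kOf c s) = kOf c s := by
    rw [kOf_of_mem hs, map_mul, Complex.conj_I, Complex.conj_ofReal]; ring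
  rw [h2] at h1
  exact ⟨h1.1.symm, h1.2.symm⟩

/-- Here `r` is `k` where `k` is real, with the sign of `s`, and `0` on `[-c, c]`, where `φ` is
real. Only the sign of `r s` is used afterwards. -/
theorem wronskian_rightJost_conj (hq : StepPotential c q) (hc : 0 < c) (s x : ℝ) :
    ∃ r : ℝ, 0 ≤ r * s ∧ jost q (kOf c s) x * (starRingEnd ℂ) (jostDeriv q (kOf c s) x) -
      jostDeriv q (kOf c s) x * (starRingEnd ℂ) (jost q (kOf c s) x) = -(2 * Complex.I * r) := by
  by_cases h : s ∈ Set.Icc (-c) c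
  · refine ⟨0, by simp, ?_⟩
    obtain ⟨h1, h2⟩ := hq.rightJost_real h x
    rw [h1, h2]; simp; ring
  · rw [Set.mem_Icc, not_and_or, not_le, not_le] at h
    rcases h with h | h
    · rw [kOf_of_lt hc.le h]
      refine ⟨_, ?_, hq.right.wronskian_jost_conj _ x⟩
      have : 0 ≤ Real.sqrt (-s + c) * Real.sqrt (-s - c) := by positivity
      nlinarith
    · rw [kOf_of_gt hc.le h]
      refine ⟨_, ?_, hq.right.wronskian_jost_conj _ x⟩
      have : 0 ≤ Real.sqrt (s - c) * Real.sqrt (s + c) := by positivity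
      nlinarith

/-- If `W = 0`, then `φ = μ φ₁` with `μ ≠ 0`. Comparing the Wronskians of both sides with their
conjugates gives `|μ|² s = -r`, against `r s ≥ 0`. -/
theorem wronskian_ne_zero_of_real (hq : StepPotential c q) (hc : 0 < c) {s : ℝ} (hs : s ≠ 0) :
    jostWronskian q c s ≠ 0 := by
  intro hW
  have him : 0 ≤ (s : ℂ).im := by simp
  rw [hq.wronskian_eq him 0] at hW
  obtain ⟨μ, hμ⟩ := (hq.solPair_left him).exists_eq_mul hq.right.cont (hq.solPair_right him)
    (hq.leftJost_ne_zero him) hW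
  have hμ0 : μ ≠ 0 := by
    rintro rfl
    refine hq.right.jost_ne_zero (kOf_im_nonneg c him) (funext fun x => ?_)
    rw [(hμ x).1]; simp
  obtain ⟨r, hr, h1⟩ := hq.wronskian_rightJost_conj hc s 0
  have h2 := hq.wronskian_leftJost_conj s 0
  rw [(hμ 0).1, (hμ 0).2, map_mul, map_mul] at h1
  have h3 : μ * (starRingEnd ℂ) μ * (2 * Complex.I * s) = -(2 * Complex.I * r) := by
    rw [← h2, ← h1]; ring
  rw [Complex.mul_conj] at h3
  have h4 : (Complex.normSq μ : ℂ) * s = -r :=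
    mul_left_cancel₀ (mul_ne_zero two_ne_zero Complex.I_ne_zero) (by linear_combination h3)
  have h5 : Complex.normSq μ * s = -r := by exact_mod_cast h4
  have h6 : 0 < Complex.normSq μ := Complex.normSq_pos.2 hμ0
  have h7 : 0 < s ^ 2 := by positivity
  have h8 : Complex.normSq μ * s ^ 2 = -(r * s) := by linear_combination s * h5
  linarith [mul_pos h6 h7]

/-- The scattering relation, with its derivative. -/
theorem scattering_relation (hq : StepPotential c q) {s : ℝ} (hW : jostWronskian q c s ≠ 0) (x : ℝ) :
    leftTransmission q c s * jost q (kOf c s) x =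
      (starRingEnd ℂ) (leftJost q c s x) + leftReflection q c s * leftJost q c s x ∧
    leftTransmission q c s * jostDeriv q (kOf c s) x =
      (starRingEnd ℂ) (leftJostDeriv q c s x) + leftReflection q c s * leftJostDeriv q c s x := by
  have him : 0 ≤ (s : ℂ).im := by simp
  have hL := hq.solPair_left him
  have hex : ∃ r : ℂ, ∀ x : ℝ,
      leftTransmission q c s * jost q (kOf c s) x =
        (starRingEnd ℂ) (leftJost q c s x) + r * leftJost q c s x := by
    -- `T₁ φ - conj φ₁` has zero Wronskian with `φ₁`, because `T₁ W = 2is` is also the Wronskian of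
    -- `φ₁` and `conj φ₁`.
    obtain ⟨r, hr⟩ := hL.exists_eq_mul hq.right.cont
      ((hq.solPair_right him).lincomb (hq.solPair_left_conj s) (leftTransmission q c s) (-1))
      (hq.leftJost_ne_zero him) (by
        have h1 := hq.wronskian_eq him 0
        have h2 := hq.wronskian_leftJost_conj s 0
        have h3 : leftTransmission q c s * jostWronskian q c s = 2 * Complex.I * s := by
          rw [leftTransmission]; field_simp
        rw [h1] at h3
        linear_combination h3 - h2)
    exact ⟨r, fun x => by linear_combination (hr x).1⟩
  have hspec : ∀ x : ℝ, leftTransmission q c s * jost q (kOf c s) x =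
      (starRingEnd ℂ) (leftJost q c s x) + leftReflection q c s * leftJost q c s x := by
    have h : ∀ x : ℝ, leftTransmission q c s * jostRight q c s x =
        (starRingEnd ℂ) (jostLeft q c s x) + leftReflection q c s * jostLeft q c s x :=
      Classical.epsilon_spec (p := fun r : ℂ => ∀ x : ℝ,
        leftTransmission q c s * jostRight q c s x =
          (starRingEnd ℂ) (jostLeft q c s x) + r * jostLeft q c s x)
        (by simpa only [hq.jostRight_eq him, hq.jostLeft_eq him] using hex)
    intro x
    have h' := h x
    rwa [hq.jostRight_eq him, hq.jostLeft_eq him] at h'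
  refine ⟨hspec x, ?_⟩
  have h1 := ((hq.solPair_right him).fst x).const_mul (leftTransmission q c s)
  have h2 := ((hq.solPair_left_conj s).fst x).add ((hL.fst x).const_mul (leftReflection q c s))
  have h3 : (fun x => leftTransmission q c s * jost q (kOf c s) x) =
      (fun x => (starRingEnd ℂ) (leftJost q c s x)) +
        fun x => leftReflection q c s * leftJost q c s x := funext hspec
  rw [h3] at h1
  exact h1.unique h2

/-- The numerator of `T₁` vanishes at `k₁ = 0` and `φ₁` is real there, so the scattering relation
reads `0 = (1 + R₁) φ₁`. The point is separate because the Wronskian argument elsewhere divides by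
`s`. -/
theorem leftReflection_zero (hq : StepPotential c q) (hW : jostWronskian q c (0 : ℝ) ≠ 0) :
    leftReflection q c 0 = -1 := by
  have hne := hq.leftJost_ne_zero (k₁ := (0 : ℝ)) (by simp)
  obtain ⟨x, hx⟩ := Function.ne_iff.1 hne
  have h1 := (hq.scattering_relation hW x).1
  have h2 : (starRingEnd ℂ) (leftJost q c (0 : ℝ) x) = leftJost q c (0 : ℝ) x := by
    have := (hq.left.jost_conj (k := (0 : ℝ)) (by simp) (-x)).1
    simpa [leftJost] using this.symm
  rw [h2] at h1
  have h3 : leftTransmission q c ((0 : ℝ) : ℂ) = 0 := by simp [leftTransmission]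
  rw [h3, zero_mul] at h1
  have h4 : (1 + leftReflection q c 0) * leftJost q c ((0 : ℝ) : ℂ) x = 0 := by
    linear_combination -h1
  rcases mul_eq_zero.1 h4 with h | h
  · linear_combination h
  · exact absurd h hx

/-- On `[-c, c]` the solution `φ` is real, so `T₁ φ` and its conjugate have zero Wronskian.
Inserting the scattering relation turns this into `2is (|R₁|² - 1) = 0`. -/
theorem norm_leftReflection (hq : StepPotential c q) {s : ℝ} (hs : s ∈ Set.Icc (-c) c)
    (hW : jostWronskian q c s ≠ 0) :
    leftReflection q c s * (starRingEnd ℂ) (leftReflection q c s) = 1 := by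
  have him : 0 ≤ (s : ℂ).im := by simp
  by_cases h0 : s = 0
  · subst h0
    rw [hq.leftReflection_zero hW]; simp
  · obtain ⟨h1, h2⟩ := hq.scattering_relation hW 0
    obtain ⟨r1, r2⟩ := hq.rightJost_real hs 0
    have h3 := congrArg (starRingEnd ℂ) h1
    have h4 := congrArg (starRingEnd ℂ) h2
    simp only [map_mul, map_add, Complex.conj_conj, r1, r2] at h3 h4
    have h5 := hq.wronskian_leftJost_conj s 0
    have hne : (2 * Complex.I * s : ℂ) ≠ 0 :=
      mul_ne_zero (mul_ne_zero two_ne_zero Complex.I_ne_zero) (by exact_mod_cast h0)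
    have h6 : (2 * Complex.I * s) *
        (leftReflection q c s * (starRingEnd ℂ) (leftReflection q c s)) = (2 * Complex.I * s) * 1 := by
      rw [← h5]
      set T := leftTransmission q c s
      set R := leftReflection q c s
      set a := leftJost q c s 0
      set b := leftJostDeriv q c s 0
      set f := jost q (kOf c s) 0
      set g := jostDeriv q (kOf c s) 0
      linear_combination ((starRingEnd ℂ) T * f) * h2 - ((starRingEnd ℂ) T * g) * h1
        - ((starRingEnd ℂ) a + R * a) * h4 + ((starRingEnd ℂ) b + R * b) * h3
    exact mul_left_cancel₀ hne h6

end StepPotential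
end StepKdV
end

noncomputable section
namespace StepKdV

/-! ### Decay and square integrability -/

theorem integrableOn_sq_of_exp_decay {f : ℝ → ℂ} (hf : Continuous f) {C δ : ℝ} (hδ : 0 < δ)
    (hb : ∀ x, 0 ≤ x → ‖f x‖ ≤ C * Real.exp (-(δ * x))) :
    IntegrableOn (fun x => ‖f x‖ ^ 2) (Set.Ioi 0) := by
  refine Integrable.mono' (g := fun x => C ^ 2 * Real.exp (-(2 * δ) * x))
    ((exp_neg_integrableOn_Ioi 0 (by positivity : 0 < 2 * δ)).const_mul _)
    (hf.norm.pow 2).aestronglyMeasurable ?_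
  refine (ae_restrict_iff' measurableSet_Ioi).2 (Eventually.of_forall fun x hx => ?_)
  rw [Real.norm_eq_abs, abs_of_nonneg (by positivity)]
  calc ‖f x‖ ^ 2 ≤ (C * Real.exp (-(δ * x))) ^ 2 := by
        gcongr; exact hb x (le_of_lt hx)
    _ = _ := by
      rw [mul_pow, ← Real.exp_nat_mul]; congr 2; push_cast; ring

theorem integrableOn_Iic_of_comp_neg {f : ℝ → ℝ} (h : IntegrableOn (fun x => f (-x)) (Set.Ioi 0)) :
    IntegrableOn f (Set.Iic 0) := by
  rw [integrableOn_Iic_iff_integrableOn_Iio]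
  have h1 := (Measure.measurePreserving_neg (volume : Measure ℝ)).integrableOn_comp_preimage
    (Homeomorph.neg ℝ).measurableEmbedding (f := f) (s := Set.Iio 0)
  refine h1.1 ?_
  have : (Neg.neg ⁻¹' Set.Iio (0 : ℝ)) = Set.Ioi 0 := by ext x; simp
  rw [this]; exact h

theorem integrable_sq_of_exp_decay {f : ℝ → ℂ} (hf : Continuous f) {C δ C' δ' : ℝ} (hδ : 0 < δ)
    (hδ' : 0 < δ') (hb : ∀ x, 0 ≤ x → ‖f x‖ ≤ C * Real.exp (-(δ * x)))
    (hb' : ∀ x, 0 ≤ x → ‖f (-x)‖ ≤ C' * Real.exp (-(δ' * x))) :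
    Integrable (fun x => ‖f x‖ ^ 2) := by
  rw [← integrableOn_univ, ← Set.Iic_union_Ioi (a := (0 : ℝ))]
  exact (integrableOn_Iic_of_comp_neg
    (integrableOn_sq_of_exp_decay (f := fun x => f (-x)) (by fun_prop) hδ' hb')).union
    (integrableOn_sq_of_exp_decay hf hδ hb)

theorem memLp_of_exp_decay {f : ℝ → ℂ} (hf : Continuous f) {C δ C' δ' : ℝ} (hδ : 0 < δ)
    (hδ' : 0 < δ') (hb : ∀ x, 0 ≤ x → ‖f x‖ ≤ C * Real.exp (-(δ * x)))
    (hb' : ∀ x, 0 ≤ x → ‖f (-x)‖ ≤ C' * Real.exp (-(δ' * x))) : MemLp f 2 volume :=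
  (memLp_two_iff_integrable_sq_norm hf.aestronglyMeasurable).2
    (integrable_sq_of_exp_decay hf hδ hδ' hb hb')

theorem tendsto_const_mul_exp_neg (C : ℝ) {δ : ℝ} (hδ : 0 < δ) :
    Tendsto (fun x : ℝ => C * Real.exp (-(δ * x))) atTop (𝓝 0) := by
  have h1 : Tendsto (fun x : ℝ => δ * x) atTop atTop := tendsto_id.const_mul_atTop hδ
  simpa [Function.comp_def] using (Real.tendsto_exp_neg_atTop_nhds_zero.comp h1).const_mul C

/-- A product rule at the zero of the first factor asking only continuity of the second; integrals
that appear as remainders then need not be differentiated. -/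
theorem hasDerivAt_sub_mul_of_continuousAt {𝕜 E : Type*} [NontriviallyNormedField 𝕜]
    [NormedAddCommGroup E] [NormedSpace 𝕜 E] {h : 𝕜 → E} {a : 𝕜} (hh : ContinuousAt h a) :
    HasDerivAt (fun t => (t - a) • h t) (h a) a := by
  rw [hasDerivAt_iff_tendsto_slope]
  refine (hh.tendsto.mono_left nhdsWithin_le_nhds).congr' ?_
  filter_upwards [self_mem_nhdsWithin] with t ht
  have : t - a ≠ 0 := sub_ne_zero.2 ht
  simp [slope, smul_smul, this]

namespace ShortRange

variable {V : ℝ → ℝ} {k : ℂ}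

theorem exists_decay (hV : ShortRange V) (hk : 0 ≤ k.im) :
    ∃ C, ∀ x, 0 ≤ x → ‖jost V k x‖ ≤ C * Real.exp (-(k.im * x)) ∧
      ‖jostDeriv V k x‖ ≤ C * Real.exp (-(k.im * x)) := by
  refine ⟨2 * weight V 0 + (‖k‖ * (2 * weight V 0) + 2 * (weight V 0 * tail V 0)), fun x hx => ?_⟩
  have h1 := hV.weight_antitone hx
  have h2 := hV.tail_antitone hx
  have h3 := (weight_pos V 0).le
  have h4 := tail_nonneg V 0
  have h5 := tail_nonneg V x
  have h6 := (Real.exp_pos (-(k.im * x))).le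
  constructor
  · refine (hV.norm_jost_le hk x).trans ?_
    rw [mul_comm]
    refine mul_le_mul_of_nonneg_right ?_ h6
    have : 0 ≤ ‖k‖ * (2 * weight V 0) + 2 * (weight V 0 * tail V 0) := by positivity
    linarith
  · refine (hV.norm_jostDeriv_le hk x).trans ?_
    rw [mul_comm]
    refine mul_le_mul_of_nonneg_right ?_ h6
    have e1 : ‖k‖ * (2 * weight V x) ≤ ‖k‖ * (2 * weight V 0) := by gcongr
    have e2 : weight V x * tail V x ≤ weight V 0 * tail V 0 := by gcongr
    linarith

theorem tendsto_jost (hV : ShortRange V) (hk : 0 < k.im) :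
    Tendsto (jost V k) atTop (𝓝 0) ∧ Tendsto (jostDeriv V k) atTop (𝓝 0) := by
  obtain ⟨C, hC⟩ := hV.exists_decay hk.le
  constructor
  · exact squeeze_zero_norm' ((eventually_ge_atTop 0).mono fun x hx => (hC x hx).1)
      (tendsto_const_mul_exp_neg C hk)
  · exact squeeze_zero_norm' ((eventually_ge_atTop 0).mono fun x hx => (hC x hx).2)
      (tendsto_const_mul_exp_neg C hk)

theorem integrableOn_jost_sq (hV : ShortRange V) (hk : 0 < k.im) :
    IntegrableOn (fun x => ‖jost V k x‖ ^ 2) (Set.Ioi 0) ∧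
    IntegrableOn (fun x => ‖jostDeriv V k x‖ ^ 2) (Set.Ioi 0) := by
  obtain ⟨C, hC⟩ := hV.exists_decay hk.le
  have hs := hV.solPair_jost hk.le
  exact ⟨integrableOn_sq_of_exp_decay hs.continuous_fst hk fun x hx => (hC x hx).1,
    integrableOn_sq_of_exp_decay hs.continuous_snd hk fun x hx => (hC x hx).2⟩

/-- A square integrable solution has vanishing Wronskian with the Jost solution. -/
theorem wronskian_eq_zero_of_memLp (hV : ShortRange V) (hk : 0 < k.im) {f g : ℝ → ℂ}
    (h : SolPair V (k ^ 2) f g) (hf : MemLp f 2 volume) (hg : MemLp g 2 volume) :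
    f 0 * jostDeriv V k 0 - g 0 * jost V k 0 = 0 := by
  have hs := hV.solPair_jost hk.le
  obtain ⟨i1, i2⟩ := hV.integrableOn_jost_sq hk
  have m1 : MemLp (jost V k) 2 (volume.restrict (Set.Ioi 0)) :=
    (memLp_two_iff_integrable_sq_norm hs.continuous_fst.aestronglyMeasurable).2 i1
  have m2 : MemLp (jostDeriv V k) 2 (volume.restrict (Set.Ioi 0)) :=
    (memLp_two_iff_integrable_sq_norm hs.continuous_snd.aestronglyMeasurable).2 i2
  have hint := ((hf.restrict (Set.Ioi 0)).integrable_mul m2).sub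
    ((hg.restrict (Set.Ioi 0)).integrable_mul m1)
  -- The Wronskian is constant, and as a sum of products of square integrable functions it is
  -- integrable on a half-line of infinite measure.
  have hconst : (f * jostDeriv V k - g * jost V k) =
      fun _ => f 0 * jostDeriv V k 0 - g 0 * jost V k 0 :=
    funext fun x => h.wronskian_const hs x 0
  rw [hconst] at hint
  by_contra hne
  rw [integrable_const_iff] at hint
  rcases hint with h0 | h0
  · exact hne h0
  · have := h0.measure_univ_lt_top
    simp at this

/-- The Wronskian of Jost solutions at two energies. -/
theorem wronskian_two_energies (hV : ShortRange V) {k₀ : ℂ} (hk₀ : 0 < k₀.im) (hk : 0 < k.im) :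
    jost V k₀ 0 * jostDeriv V k 0 - jostDeriv V k₀ 0 * jost V k 0 =
      (k ^ 2 - k₀ ^ 2) * ∫ x in Set.Ioi 0, jost V k₀ x * jost V k x := by
  have hs := hV.solPair_jost hk.le
  have hs₀ := hV.solPair_jost hk₀.le
  have m1 : MemLp (jost V k) 2 (volume.restrict (Set.Ioi 0)) :=
    (memLp_two_iff_integrable_sq_norm hs.continuous_fst.aestronglyMeasurable).2
      (hV.integrableOn_jost_sq hk).1
  have m2 : MemLp (jost V k₀) 2 (volume.restrict (Set.Ioi 0)) :=
    (memLp_two_iff_integrable_sq_norm hs₀.continuous_fst.aestronglyMeasurable).2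
      (hV.integrableOn_jost_sq hk₀).1
  have hint : IntegrableOn (fun x => (k₀ ^ 2 - k ^ 2) * (jost V k₀ x * jost V k x)) (Set.Ioi 0) :=
    (m2.integrable_mul m1).const_mul _
  have h := integral_Ioi_of_hasDerivAt_of_tendsto' (a := 0) (m := 0 * 0 - 0 * 0)
    (f := fun x => jost V k₀ x * jostDeriv V k x - jostDeriv V k₀ x * jost V k x)
    (fun x _ => (((hs₀.fst x).mul (hs.snd x)).sub ((hs₀.snd x).mul (hs.fst x))).congr_deriv
      (by ring)) hint
    (((hV.tendsto_jost hk₀).1.mul (hV.tendsto_jost hk).2).sub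
      ((hV.tendsto_jost hk₀).2.mul (hV.tendsto_jost hk).1))
  rw [integral_const_mul] at h
  linear_combination h

/-- The exponential decay of the fixed factor at `k₀` dominates the integrand by itself; the other
factor is merely bounded, uniformly in `k`. -/
theorem continuousOn_integral_jost_mul (hV : ShortRange V) {k₀ : ℂ} (hk₀ : 0 < k₀.im) :
    ContinuousOn (fun k => ∫ x in Set.Ioi 0, jost V k₀ x * jost V k x) upperOpen := by
  obtain ⟨C, hC⟩ := hV.exists_decay hk₀.le
  refine continuousOn_of_dominated
    (bound := fun x => C * (2 * weight V 0) * Real.exp (-k₀.im * x)) (fun k hk => ?_)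
    (fun k hk => ?_) ((exp_neg_integrableOn_Ioi 0 hk₀).const_mul _) ?_
  · exact ((hV.solPair_jost hk₀.le).continuous_fst.mul
      (hV.solPair_jost (upperOpen_subset hk)).continuous_fst).aestronglyMeasurable
  · refine (ae_restrict_iff' measurableSet_Ioi).2 (Eventually.of_forall fun x hx => ?_)
    have hx : 0 ≤ x := le_of_lt hx
    have hk' : 0 ≤ k.im := upperOpen_subset hk
    rw [norm_mul]
    have h1 := (hC x hx).1
    have h2 : ‖jost V k x‖ ≤ 2 * weight V 0 := by
      refine (hV.norm_jost_le hk' x).trans ?_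
      have e1 : Real.exp (-(k.im * x)) ≤ 1 := by
        rw [Real.exp_le_one_iff]; have := mul_nonneg hk' hx; linarith
      calc _ ≤ 1 * (2 * weight V 0) := by
            gcongr
            · exact mul_nonneg zero_le_two (weight_pos V x).le
            · exact hV.weight_antitone hx
        _ = _ := one_mul _
    calc _ ≤ C * Real.exp (-(k₀.im * x)) * (2 * weight V 0) :=
          mul_le_mul h1 h2 (norm_nonneg _) ((norm_nonneg _).trans h1)
      _ = _ := by rw [neg_mul]; ring
  · refine Eventually.of_forall fun x => ?_
    have := (hV.continuousOn_jostM x).mono upperOpen_subset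
    unfold jost
    fun_prop

end ShortRange

/-! ### Zeros of the Wronskian and eigenvalues -/

/-- The sign of `a` makes `G` monotone or antitone, and a monotone function with limit zero at both
ends vanishes. -/
theorem eq_zero_of_monotone_of_tendsto {G h : ℝ → ℝ} {a : ℝ} (hG : ∀ x, HasDerivAt G (a * h x) x)
    (hh : ∀ x, 0 ≤ h x) (ht : Tendsto G atTop (𝓝 0)) (hb : Tendsto G atBot (𝓝 0)) (x : ℝ) :
    a * h x = 0 := by
  have key : G = fun _ => 0 := by
    rcases le_total 0 a with ha | ha
    · have hm : Monotone G := monotone_of_hasDerivAt_nonneg hG fun x => mul_nonneg ha (hh x)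
      exact funext fun y => le_antisymm (hm.ge_of_tendsto ht y) (hm.le_of_tendsto hb y)
    · have hm : Antitone G := antitone_of_hasDerivAt_nonpos hG fun x =>
        mul_nonpos_of_nonpos_of_nonneg ha (hh x)
      exact funext fun y => le_antisymm (hm.ge_of_tendsto hb y) (hm.le_of_tendsto ht y)
  have h1 := hG x
  rw [key] at h1
  exact h1.unique (hasDerivAt_const x 0)

namespace StepPotential

variable {c : ℝ} {q : ℝ → ℝ} {k₁ : ℂ}

theorem exists_proportional (hq : StepPotential c q) (hk : 0 ≤ k₁.im)
    (hW : jostWronskian q c k₁ = 0) :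
    ∃ μ : ℂ, μ ≠ 0 ∧ ∀ x, jost q (kOf c k₁) x = μ * leftJost q c k₁ x ∧
      jostDeriv q (kOf c k₁) x = μ * leftJostDeriv q c k₁ x := by
  rw [hq.wronskian_eq hk 0] at hW
  obtain ⟨μ, hμ⟩ := (hq.solPair_left hk).exists_eq_mul hq.right.cont (hq.solPair_right hk)
    (hq.leftJost_ne_zero hk) hW
  refine ⟨μ, ?_, hμ⟩
  rintro rfl
  refine hq.right.jost_ne_zero (kOf_im_nonneg c hk) (funext fun x => ?_)
  rw [(hμ x).1]; simp

/-- At a zero of `W` the left solution is a multiple of the right one and so also decays at `+∞`,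
besides its own decay at `-∞`. -/
theorem exists_decay_of_wronskian_eq_zero (hq : StepPotential c q) (hk : 0 < k₁.im)
    (hW : jostWronskian q c k₁ = 0) :
    ∃ C C', (∀ x, 0 ≤ x → ‖leftJost q c k₁ x‖ ≤ C * Real.exp (-((kOf c k₁).im * x)) ∧
        ‖leftJostDeriv q c k₁ x‖ ≤ C * Real.exp (-((kOf c k₁).im * x))) ∧
      ∀ x, 0 ≤ x → ‖leftJost q c k₁ (-x)‖ ≤ C' * Real.exp (-(k₁.im * x)) ∧
        ‖leftJostDeriv q c k₁ (-x)‖ ≤ C' * Real.exp (-(k₁.im * x)) := by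
  obtain ⟨μ, hμ0, hμ⟩ := hq.exists_proportional hk.le hW
  obtain ⟨C, hC⟩ := hq.right.exists_decay (kOf_im_nonneg c hk.le)
  obtain ⟨C', hC'⟩ := hq.left.exists_decay hk.le
  refine ⟨‖μ‖⁻¹ * C, C', fun x hx => ?_, fun x hx => ?_⟩
  · have hp : 0 < ‖μ‖ := norm_pos_iff.2 hμ0
    have h1 := (hC x hx).1
    have h2 := (hC x hx).2
    rw [(hμ x).1, norm_mul] at h1
    rw [(hμ x).2, norm_mul] at h2
    rw [mul_assoc, inv_mul_eq_div]
    exact ⟨(le_div_iff₀' hp).2 h1, (le_div_iff₀' hp).2 h2⟩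
  · simpa [leftJost, leftJostDeriv] using hC' x hx

/-- Self-adjointness: `Im(ψ' conj ψ)` has derivative `-Im(k₁² - c²) |ψ|²` and vanishes at both ends,
so `2 Re k₁ Im k₁ = 0`. -/
theorem re_eq_zero_of_wronskian_eq_zero (hq : StepPotential c q) (hk : 0 < k₁.im)
    (hW : jostWronskian q c k₁ = 0) : k₁.re = 0 := by
  obtain ⟨C, C', hC, hC'⟩ := hq.exists_decay_of_wronskian_eq_zero hk hW
  have hs := hq.solPair_left hk.le
  set ψ := leftJost q c k₁ with hψ
  set ψ' := leftJostDeriv q c k₁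
  have hkk := kOf_im_pos c hk
  have t1 : Tendsto ψ atTop (𝓝 0) :=
    squeeze_zero_norm' ((eventually_ge_atTop 0).mono fun x hx => (hC x hx).1)
      (tendsto_const_mul_exp_neg C hkk)
  have t2 : Tendsto ψ' atTop (𝓝 0) :=
    squeeze_zero_norm' ((eventually_ge_atTop 0).mono fun x hx => (hC x hx).2)
      (tendsto_const_mul_exp_neg C hkk)
  have t3 : Tendsto ψ atBot (𝓝 0) := by
    have : Tendsto (fun x => ψ (-x)) atTop (𝓝 0) :=
      squeeze_zero_norm' ((eventually_ge_atTop 0).mono fun x hx => (hC' x hx).1)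
        (tendsto_const_mul_exp_neg C' hk)
    simpa [Function.comp_def] using this.comp tendsto_neg_atBot_atTop
  have t4 : Tendsto ψ' atBot (𝓝 0) := by
    have : Tendsto (fun x => ψ' (-x)) atTop (𝓝 0) :=
      squeeze_zero_norm' ((eventually_ge_atTop 0).mono fun x hx => (hC' x hx).2)
        (tendsto_const_mul_exp_neg C' hk)
    simpa [Function.comp_def] using this.comp tendsto_neg_atBot_atTop
  have hd : ∀ x, HasDerivAt (fun x => (ψ' x * (starRingEnd ℂ) (ψ x)).im)
      (-(k₁ ^ 2 - (c : ℂ) ^ 2).im * Complex.normSq (ψ x)) x := by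
    intro x
    have h1 := (hs.snd x).mul (hs.fst x).star
    have h2 := Complex.imCLM.hasFDerivAt.comp_hasDerivAt x h1
    refine h2.congr_deriv ?_
    simp only [Complex.imCLM_apply]
    change ((q x - (k₁ ^ 2 - (c : ℂ) ^ 2)) * ψ x * (starRingEnd ℂ) (ψ x) +
      ψ' x * (starRingEnd ℂ) (ψ' x)).im = _
    rw [mul_assoc, Complex.mul_conj, Complex.mul_conj, Complex.add_im, Complex.ofReal_im, add_zero,
      Complex.im_mul_ofReal, Complex.sub_im, Complex.ofReal_im, zero_sub]
  have hlim : ∀ l : Filter ℝ, Tendsto ψ l (𝓝 0) → Tendsto ψ' l (𝓝 0) →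
      Tendsto (fun x => (ψ' x * (starRingEnd ℂ) (ψ x)).im) l (𝓝 0) := by
    intro l h1 h2
    have := (Complex.continuous_im.tendsto _).comp
      (h2.mul ((Complex.continuous_conj.tendsto _).comp h1))
    simpa [Function.comp_def] using this
  have hzero := eq_zero_of_monotone_of_tendsto hd (fun x => Complex.normSq_nonneg _)
    (hlim _ t1 t2) (hlim _ t3 t4)
  obtain ⟨x, hx⟩ := Function.ne_iff.1 (hq.leftJost_ne_zero hk.le)
  rcases mul_eq_zero.1 (hzero x) with h | h
  · have h1 : (k₁ ^ 2 - (c : ℂ) ^ 2).im = 2 * k₁.re * k₁.im := by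
      rw [Complex.sub_im, sq, Complex.mul_im, ← Complex.ofReal_pow, Complex.ofReal_im]; ring
    rw [h1] at h
    have h2 : k₁.re * k₁.im = 0 := by linarith
    exact (mul_eq_zero.1 h2).resolve_right hk.ne'
  · exact absurd (Complex.normSq_eq_zero.1 h) hx

/-- A square integrable eigenfunction has zero Wronskian with both Jost solutions, which are
therefore multiples of it. Conversely, at a zero of `W` the left Jost solution decays at both ends;
the bound on `q` enters only for its second derivative. -/
theorem mem_leftDiscreteSpectrum_iff (hq : StepPotential c q) {B : ℝ} (hB : ∀ x, |q x| ≤ B)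
    {κ : ℝ} (hκ : 0 < κ) :
    κ ∈ leftDiscreteSpectrum q c ↔ jostWronskian q c (Complex.I * κ) = 0 := by
  have him : 0 < (Complex.I * (κ : ℂ)).im := by simpa using hκ
  have hE : (((-(κ ^ 2 + c ^ 2) : ℝ)) : ℂ) = (Complex.I * κ) ^ 2 - c ^ 2 := by
    rw [mul_pow, Complex.I_sq]; push_cast; ring
  constructor
  · rintro ⟨-, ψ, hne, hψ, m0, m1, -⟩
    have hs := hψ.solPair
    rw [hE] at hs
    have w1 := hq.right.wronskian_eq_zero_of_memLp (kOf_im_pos c him) (by rwa [kOf_sq]) m0 m1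
    have hs' := hs.reflect (c ^ 2)
    have e : (Complex.I * (κ : ℂ)) ^ 2 - (c : ℂ) ^ 2 + ((c ^ 2 : ℝ) : ℂ) = (Complex.I * κ) ^ 2 := by
      push_cast; ring
    rw [e] at hs'
    have w2 := hq.left.wronskian_eq_zero_of_memLp him hs'
      (m0.comp_measurePreserving (Measure.measurePreserving_neg volume))
      (m1.comp_measurePreserving (Measure.measurePreserving_neg volume)).neg
    obtain ⟨a, ha⟩ := hs.exists_eq_mul hq.right.cont (hq.solPair_right him.le) hne w1
    obtain ⟨b, hb⟩ := hs.exists_eq_mul hq.right.cont (hq.solPair_left him.le) hne (by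
      simp only [leftJost, leftJostDeriv, neg_zero] at w2 ⊢
      linear_combination -w2)
    rw [hq.wronskian_eq him.le 0, (ha 0).1, (ha 0).2, (hb 0).1, (hb 0).2]
    ring
  · intro hW
    obtain ⟨C, C', hC, hC'⟩ := hq.exists_decay_of_wronskian_eq_zero him hW
    have hs := hq.solPair_left him.le
    have hkk := kOf_im_pos c him
    refine ⟨hκ, leftJost q c (Complex.I * κ), hq.leftJost_ne_zero him.le, ?_, ?_, ?_, ?_⟩
    · rw [hE]; exact hs.isSchrodingerSolution hq.right.cont
    · exact memLp_of_exp_decay hs.continuous_fst hkk him (fun x hx => (hC x hx).1)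
        fun x hx => (hC' x hx).1
    · rw [hs.deriv_eq]
      exact memLp_of_exp_decay hs.continuous_snd hkk him (fun x hx => (hC x hx).2)
        fun x hx => (hC' x hx).2
    · rw [hs.deriv_eq, show deriv (leftJostDeriv q c (Complex.I * κ)) = _ from
        funext fun x => (hs.snd x).deriv]
      have hbd : ∀ x, ‖(q x : ℂ) - ((Complex.I * κ) ^ 2 - c ^ 2)‖ ≤
          B + ‖(Complex.I * (κ : ℂ)) ^ 2 - c ^ 2‖ := fun x => by
        refine (norm_sub_le _ _).trans (add_le_add_left ?_ _)
        rw [Complex.norm_real]; exact hB x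
      refine memLp_of_exp_decay (C := (B + ‖(Complex.I * (κ : ℂ)) ^ 2 - c ^ 2‖) * C)
        (C' := (B + ‖(Complex.I * (κ : ℂ)) ^ 2 - c ^ 2‖) * C') ?_ hkk him (fun x hx => ?_)
        fun x hx => ?_
      · have h1 := hs.continuous_fst
        have h2 := hq.right.cont
        fun_prop
      · rw [norm_mul, mul_assoc]
        exact mul_le_mul (hbd x) (hC x hx).1 (norm_nonneg _) ((norm_nonneg _).trans (hbd x))
      · rw [norm_mul, mul_assoc]
        exact mul_le_mul (hbd _) (hC' x hx).1 (norm_nonneg _) ((norm_nonneg _).trans (hbd x))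

/-- Reality makes `φ₁² = |φ₁|²`, which is how the norm of `φ₁` enters the derivative of the
Wronskian. -/
theorem leftJost_real (hq : StepPotential c q) {κ : ℝ} (hκ : 0 ≤ κ) (x : ℝ) :
    (starRingEnd ℂ) (leftJost q c (Complex.I * κ) x) = leftJost q c (Complex.I * κ) x := by
  have := (hq.left.jost_conj (k := Complex.I * κ) (by simpa using hκ) (-x)).1
  rw [leftJost, ← this]
  simp

theorem integrable_leftJost_sq (hq : StepPotential c q) (hk : 0 < k₁.im)
    (hW : jostWronskian q c k₁ = 0) : Integrable (fun x => ‖leftJost q c k₁ x‖ ^ 2) := by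
  obtain ⟨C, C', hC, hC'⟩ := hq.exists_decay_of_wronskian_eq_zero hk hW
  exact integrable_sq_of_exp_decay (hq.solPair_left hk.le).continuous_fst (kOf_im_pos c hk) hk
    (fun x hx => (hC x hx).1) fun x hx => (hC' x hx).1

theorem integral_leftJost_sq_pos (hq : StepPotential c q) (hk : 0 < k₁.im)
    (hW : jostWronskian q c k₁ = 0) : 0 < ∫ x, ‖leftJost q c k₁ x‖ ^ 2 := by
  obtain ⟨x, hx⟩ := Function.ne_iff.1 (hq.leftJost_ne_zero hk.le)
  exact integral_pos_of_integrable_nonneg_nonzero (x := x)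
    ((hq.solPair_left hk.le).continuous_fst.norm.pow 2) (hq.integrable_leftJost_sq hk hW)
    (fun _ => by positivity) (by simpa using hx)

/-- The derivative of the Wronskian at an eigenvalue. -/
theorem hasDerivAt_wronskian (hq : StepPotential c q) {κ : ℝ} (hκ : 0 < κ) {μ : ℂ} (hμ0 : μ ≠ 0)
    (hμ : ∀ x, jost q (kOf c (Complex.I * κ)) x = μ * leftJost q c (Complex.I * κ) x ∧
      jostDeriv q (kOf c (Complex.I * κ)) x = μ * leftJostDeriv q c (Complex.I * κ) x)
    (hW : jostWronskian q c (Complex.I * κ) = 0) :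
    HasDerivAt (jostWronskian q c)
      (2 * (Complex.I * κ) * μ * (∫ x, ‖leftJost q c (Complex.I * κ) x‖ ^ 2 : ℝ))
      (Complex.I * κ) := by
  set z : ℂ := Complex.I * κ with hz
  have him : 0 < z.im := by simpa [hz] using hκ
  have hzmem : upperOpen ∈ 𝓝 z := isOpen_upperOpen.mem_nhds him
  have hkk := kOf_im_pos c him
  set IR : ℂ → ℂ := fun k => ∫ x in Set.Ioi 0, jost q (kOf c z) x * jost q (kOf c k) x with hIR
  set IL : ℂ → ℂ := fun k =>
    ∫ x in Set.Ioi 0, jost (reflected c q) z x * jost (reflected c q) k x with hIL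
  have cR : ContinuousAt IR z :=
    ((hq.right.continuousOn_integral_jost_mul hkk).comp
      ((continuousOn_kOf c).mono upperOpen_subset) (mapsTo_kOf_open c)).continuousAt hzmem
  have cL : ContinuousAt IL z :=
    (hq.left.continuousOn_integral_jost_mul him).continuousAt hzmem
  have dA := ((hq.differentiableOn_leftJost 0) z him).differentiableAt hzmem
  have dA' := ((hq.differentiableOn_leftJostDeriv 0) z him).differentiableAt hzmem
  have dB := ((hq.differentiableOn_rightJost 0) z him).differentiableAt hzmem
  have dB' := ((hq.differentiableOn_rightJostDeriv 0) z him).differentiableAt hzmem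
  -- Expanding `W(k)` around `z`, the terms with increments in both Jost solutions are of second
  -- order and contribute nothing.
  have hrest : HasDerivAt (fun k =>
      (leftJost q c k 0 - leftJost q c z 0) *
        (jostDeriv q (kOf c k) 0 - jostDeriv q (kOf c z) 0) -
      (leftJostDeriv q c k 0 - leftJostDeriv q c z 0) *
        (jost q (kOf c k) 0 - jost q (kOf c z) 0)) 0 z := by
    refine (((dA.hasDerivAt.sub_const _).mul (dB'.hasDerivAt.sub_const _)).sub
      ((dA'.hasDerivAt.sub_const _).mul (dB.hasDerivAt.sub_const _))).congr_deriv ?_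
    simp
  -- The remaining terms have one Jost solution frozen at `z`. There proportionality reduces them to
  -- two Wronskians at different energies, each `k² - z²` times an integral over a half-line that is
  -- continuous in `k`.
  have hmain : HasDerivAt (fun k => (k - z) • ((k + z) * (μ⁻¹ * IR k + μ * IL k)))
      ((z + z) * (μ⁻¹ * IR z + μ * IL z)) z :=
    hasDerivAt_sub_mul_of_continuousAt (by fun_prop)
  have hsum := hmain.add hrest
  have hint := hq.integrable_leftJost_sq him hW
  have hsq : ∀ x, leftJost q c z x * leftJost q c z x = ((‖leftJost q c z x‖ ^ 2 : ℝ) : ℂ) := by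
    intro x
    have h1 := hq.leftJost_real hκ.le x
    rw [← hz] at h1
    nth_rw 2 [← h1]
    rw [Complex.mul_conj, Complex.normSq_eq_norm_sq]
  have eR : IR z = μ ^ 2 * ((∫ x in Set.Ioi 0, ‖leftJost q c z x‖ ^ 2 : ℝ) : ℂ) := by
    rw [hIR, ← integral_complex_ofReal, ← integral_const_mul]
    refine integral_congr_ae (Eventually.of_forall fun x => ?_)
    simp only
    rw [(hμ x).1, ← hsq]; ring
  have eL : IL z = ((∫ x in Set.Iic 0, ‖leftJost q c z x‖ ^ 2 : ℝ) : ℂ) := by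
    have h1 := integral_comp_neg_Iic (0 : ℝ)
      (fun x => jost (reflected c q) z x * jost (reflected c q) z x)
    rw [neg_zero] at h1
    rw [hIL, ← integral_complex_ofReal]
    simp only
    rw [← h1]
    refine integral_congr_ae (Eventually.of_forall fun x => ?_)
    simp only
    rw [← hsq]; rfl
  have hsplit : ∫ x, ‖leftJost q c z x‖ ^ 2 = (∫ x in Set.Iic 0, ‖leftJost q c z x‖ ^ 2) +
      ∫ x in Set.Ioi 0, ‖leftJost q c z x‖ ^ 2 :=
    (intervalIntegral.integral_Iic_add_Ioi hint.integrableOn hint.integrableOn).symm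
  refine (hsum.congr_deriv ?_).congr_of_eventuallyEq ?_
  · rw [eR, eL, hsplit]
    push_cast
    field_simp
    ring
  · filter_upwards [hzmem] with k hk
    have hk : 0 < k.im := hk
    have w1 := hq.right.wronskian_two_energies hkk (kOf_im_pos c hk)
    have w2 := hq.left.wronskian_two_energies him hk
    rw [kOf_sq, kOf_sq] at w1
    rw [hq.wronskian_eq him.le 0] at hW
    have e1 : IR k = ∫ x in Set.Ioi 0, jost q (kOf c z) x * jost q (kOf c k) x := rfl
    have e2 : IL k = ∫ x in Set.Ioi 0, jost (reflected c q) z x * jost (reflected c q) k x := rfl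
    rw [← e1] at w1
    rw [← e2] at w2
    simp only [Pi.add_apply, smul_eq_mul]
    rw [hq.wronskian_eq hk.le 0]
    have m1 := (hμ 0).1
    have m2 := (hμ 0).2
    rw [m1, m2] at w1
    have w1' : leftJost q c z 0 * jostDeriv q (kOf c k) 0 -
        leftJostDeriv q c z 0 * jost q (kOf c k) 0 = μ⁻¹ * ((k ^ 2 - z ^ 2) * IR k) := by
      field_simp
      linear_combination w1
    simp only [leftJost, leftJostDeriv, neg_zero] at w1' w2 m1 m2 hW ⊢
    rw [m1, m2]
    linear_combination w1' + μ * w2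

/-- By `W ~ 2ik₁` the zeros `iκ` have `κ` in a compact interval `[0, K]`. An accumulation point
would again be a zero: at `0` nonresonance forbids it, and at a positive point the nonzero
derivative of `W` isolates it. -/
theorem finite_leftDiscreteSpectrum (hq : StepPotential c q) {B : ℝ} (hB : ∀ x, |q x| ≤ B)
    (hres : jostWronskian q c 0 ≠ 0) : (leftDiscreteSpectrum q c).Finite := by
  by_contra hinf
  have hinf : (leftDiscreteSpectrum q c).Infinite := hinf
  have hzero : ∀ κ ∈ leftDiscreteSpectrum q c, 0 < κ ∧ jostWronskian q c (Complex.I * κ) = 0 :=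
    fun κ hκ => ⟨hκ.1, (hq.mem_leftDiscreteSpectrum_iff hB hκ.1).1 hκ⟩
  obtain ⟨K, hK⟩ : ∃ K : ℝ, ∀ s, K ≤ s → jostWronskian q c (Complex.I * s) ≠ 0 := by
    have h1 := hq.tendsto_wronskian_div.eventually (isOpen_ne.mem_nhds one_ne_zero)
    obtain ⟨K, hK⟩ := eventually_atTop.1 h1
    exact ⟨K, fun s hs h0 => hK s hs (by rw [h0, zero_div])⟩
  have hcont : ContinuousOn (fun s : ℝ => jostWronskian q c (Complex.I * s)) (Set.Ici 0) :=
    hq.continuousOn_wronskian.comp (by fun_prop) fun s hs => by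
      simpa [upperClosed] using hs
  have hsub : leftDiscreteSpectrum q c ⊆ Set.Icc 0 K := fun κ hκ =>
    ⟨(hzero κ hκ).1.le, le_of_not_ge fun h => hK κ h (hzero κ hκ).2⟩
  obtain ⟨a, ha, hacc⟩ := hinf.exists_accPt_of_subset_isCompact isCompact_Icc hsub
  rw [accPt_iff_frequently] at hacc
  have hWa : jostWronskian q c (Complex.I * a) = 0 := by
    by_contra hne
    have h1 := (hcont a ha.1).eventually_ne hne
    rw [eventually_nhdsWithin_iff] at h1
    obtain ⟨κ, hκ, hκ2⟩ := (hacc.and_eventually h1).exists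
    exact hκ2 (hzero κ hκ.2).1.le (hzero κ hκ.2).2
  have ha0 : 0 < a := by
    refine lt_of_le_of_ne ha.1 fun h => hres ?_
    rw [← h] at hWa
    simpa using hWa
  have him : 0 < (Complex.I * (a : ℂ)).im := by simpa using ha0
  obtain ⟨μ, hμ0, hμ⟩ := hq.exists_proportional him.le hWa
  have hd := hq.hasDerivAt_wronskian ha0 hμ0 hμ hWa
  have hne := hd.eventually_ne (c := 0) (by
    have h1 := hq.integral_leftJost_sq_pos him hWa
    have h2 : ((∫ x, ‖leftJost q c (Complex.I * a) x‖ ^ 2 : ℝ) : ℂ) ≠ 0 := by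
      exact_mod_cast h1.ne'
    have h3 : (a : ℂ) ≠ 0 := by exact_mod_cast ha0.ne'
    exact mul_ne_zero (mul_ne_zero (mul_ne_zero two_ne_zero
      (mul_ne_zero Complex.I_ne_zero h3)) hμ0) h2)
  rw [eventually_nhdsWithin_iff] at hne
  have hlim : Tendsto (fun s : ℝ => Complex.I * (s : ℂ)) (𝓝 a) (𝓝 (Complex.I * a)) :=
    Continuous.tendsto (by fun_prop) a
  obtain ⟨κ, hκ, hκ2⟩ := (hacc.and_eventually (hlim.eventually hne)).exists
  refine hκ2 ?_ (hzero κ hκ.2).2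
  intro h
  have h1 := mul_left_cancel₀ Complex.I_ne_zero h
  exact hκ.1 (by exact_mod_cast h1)

end StepPotential
end StepKdV
end

noncomputable section
namespace StepKdV

/-! ### The Lax pair -/

/-- `Q` solves `Q_t = 6 (Q - a) Q_x - Q_xxx`, with jointly continuous derivatives `Q₁, Q₂, Q₃` in
`x` and with first moments at `+∞` locally bounded in time. -/
structure LaxPotential (a : ℝ) (Q Q₁ Q₂ Q₃ : ℝ → ℝ → ℝ) : Prop where
  deriv_zero : ∀ x t, HasDerivAt (fun y => Q y t) (Q₁ x t) x
  deriv_one : ∀ x t, HasDerivAt (fun y => Q₁ y t) (Q₂ x t) x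
  deriv_two : ∀ x t, HasDerivAt (fun y => Q₂ y t) (Q₃ x t) x
  cont_zero : Continuous fun p : ℝ × ℝ => Q p.1 p.2
  cont_one : Continuous fun p : ℝ × ℝ => Q₁ p.1 p.2
  cont_two : Continuous fun p : ℝ × ℝ => Q₂ p.1 p.2
  cont_three : Continuous fun p : ℝ × ℝ => Q₃ p.1 p.2
  evolution : ∀ x t, HasDerivAt (fun s => Q x s) (6 * (Q x t - a) * Q₁ x t - Q₃ x t) t
  short : ∀ t, ShortRange fun x => Q x t
  bound : ∀ τ : ℝ, ∃ M : ℝ, ∀ t, |t| ≤ τ → ∫ y in Set.Ioi 0, y * |Q y t| ≤ M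

/-- `P f = (2 Q + 4 E - 6 a) f' - Q_x f`, with `f = u`, `f' = v`. -/
def laxP (a : ℝ) (Q Q₁ : ℝ → ℝ → ℝ) (E : ℂ) (x t : ℝ) (u v : ℂ) : ℂ :=
  (2 * Q x t + 4 * E - 6 * a) * v - Q₁ x t * u

/-- The `x`-derivative of `P f` for a solution `f` of the Schrödinger equation. -/
def laxPDeriv (a : ℝ) (Q Q₁ Q₂ : ℝ → ℝ → ℝ) (E : ℂ) (x t : ℝ) (u v : ℂ) : ℂ :=
  Q₁ x t * v + ((2 * Q x t + 4 * E - 6 * a) * (Q x t - E) - Q₂ x t) * u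

/-- The derivative of the mixed Wronskian is `(V₂ - V₁) f₁ f₂`. Applied to one potential at two
times, it measures the change of a solution in time. -/
theorem SolPair.two_potentials {V₁ V₂ : ℝ → ℝ} {E : ℂ} {f₁ g₁ f₂ g₂ : ℝ → ℂ}
    (hV₁ : Continuous V₁) (hV₂ : Continuous V₂) (h₁ : SolPair V₁ E f₁ g₁)
    (h₂ : SolPair V₂ E f₂ g₂) (x : ℝ) :
    f₁ x * g₂ x - g₁ x * f₂ x = f₁ 0 * g₂ 0 - g₁ 0 * f₂ 0 +
      ∫ y in (0 : ℝ)..x, ((V₂ y : ℂ) - V₁ y) * (f₁ y * f₂ y) := by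
  have hc : Continuous fun y => ((V₂ y : ℂ) - V₁ y) * (f₁ y * f₂ y) := by
    have := h₁.continuous_fst
    have := h₂.continuous_fst
    fun_prop
  rw [intervalIntegral.integral_eq_sub_of_hasDerivAt
    (f := fun y => f₁ y * g₂ y - g₁ y * f₂ y)
    (fun y _ => (((h₁.fst y).mul (h₂.snd y)).sub ((h₁.snd y).mul (h₂.fst y))).congr_deriv (by ring))
    (hc.intervalIntegrable _ _)]
  ring

namespace LaxPotential

variable {a : ℝ} {Q Q₁ Q₂ Q₃ : ℝ → ℝ → ℝ} {E : ℂ}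

theorem continuous_dt (h : LaxPotential a Q Q₁ Q₂ Q₃) :
    Continuous fun p : ℝ × ℝ => 6 * (Q p.1 p.2 - a) * Q₁ p.1 p.2 - Q₃ p.1 p.2 := by
  have h0 := h.cont_zero
  have h1 := h.cont_one
  have h3 := h.cont_three
  fun_prop

theorem hasDerivAt_laxP (h : LaxPotential a Q Q₁ Q₂ Q₃) {f g : ℝ → ℂ} {t : ℝ}
    (hs : SolPair (fun x => Q x t) E f g) (x : ℝ) :
    HasDerivAt (fun x => laxP a Q Q₁ E x t (f x) (g x)) (laxPDeriv a Q Q₁ Q₂ E x t (f x) (g x)) x := by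
  have h0 := (h.deriv_zero x t).ofReal_comp
  have h1 := (h.deriv_one x t).ofReal_comp
  refine ((((h0.const_mul 2).add_const (4 * E)).sub_const (6 * (a : ℂ))).mul (hs.snd x)
    |>.sub (h1.mul (hs.fst x))).congr_deriv ?_
  simp only [laxPDeriv]
  ring

/-- The Lax equation in Wronskian form: the evolution equation says `(P f)'' - (Q - E) P f = Q_t f`,
while `u'' = (Q - E) u`. -/
theorem hasDerivAt_wronskian_laxP (h : LaxPotential a Q Q₁ Q₂ Q₃) {f g u v : ℝ → ℂ} {t : ℝ}
    (hs : SolPair (fun x => Q x t) E f g) (hu : SolPair (fun x => Q x t) E u v) (x : ℝ) :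
    HasDerivAt (fun x => u x * laxPDeriv a Q Q₁ Q₂ E x t (f x) (g x) -
        v x * laxP a Q Q₁ E x t (f x) (g x))
      (((6 * (Q x t - a) * Q₁ x t - Q₃ x t : ℝ) : ℂ) * (u x * f x)) x := by
  have h0 := (h.deriv_zero x t).ofReal_comp
  have h1 := (h.deriv_one x t).ofReal_comp
  have h2 := (h.deriv_two x t).ofReal_comp
  have hP' : HasDerivAt (fun x => laxPDeriv a Q Q₁ Q₂ E x t (f x) (g x)) _ x :=
    (h1.mul (hs.snd x)).add ((((((h0.const_mul 2).add_const (4 * E)).sub_const (6 * (a : ℂ))).mul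
      (h0.sub_const E)).sub h2).mul (hs.fst x))
  refine ((hu.fst x).mul hP' |>.sub ((hu.snd x).mul (h.hasDerivAt_laxP hs x))).congr_deriv ?_
  simp only [laxP, laxPDeriv, Pi.mul_apply, Pi.sub_apply]
  push_cast
  ring

theorem integral_dt_mul (h : LaxPotential a Q Q₁ Q₂ Q₃) {f g u v : ℝ → ℂ} {t : ℝ}
    (hs : SolPair (fun x => Q x t) E f g) (hu : SolPair (fun x => Q x t) E u v) (x : ℝ) :
    ∫ y in (0 : ℝ)..x, ((6 * (Q y t - a) * Q₁ y t - Q₃ y t : ℝ) : ℂ) * (u y * f y) =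
      (u x * laxPDeriv a Q Q₁ Q₂ E x t (f x) (g x) - v x * laxP a Q Q₁ E x t (f x) (g x)) -
      (u 0 * laxPDeriv a Q Q₁ Q₂ E 0 t (f 0) (g 0) - v 0 * laxP a Q Q₁ E 0 t (f 0) (g 0)) := by
  refine intervalIntegral.integral_eq_sub_of_hasDerivAt
    (f := fun x => u x * laxPDeriv a Q Q₁ Q₂ E x t (f x) (g x) -
        v x * laxP a Q Q₁ E x t (f x) (g x))
    (fun y _ => h.hasDerivAt_wronskian_laxP hs hu y) (Continuous.intervalIntegrable ?_ _ _)
  have h1 := hs.continuous_fst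
  have h2 := hu.continuous_fst
  have h3 : Continuous fun y => 6 * (Q y t - a) * Q₁ y t - Q₃ y t :=
    h.continuous_dt.comp (continuous_id.prodMk continuous_const)
  fun_prop

/-- The difference quotient of `Q` in time. -/
def quotient (a : ℝ) (Q Q₁ Q₃ : ℝ → ℝ → ℝ) (s y t : ℝ) : ℝ :=
  ∫ θ in (0 : ℝ)..1, (6 * (Q y (s + (t - s) * θ) - a) * Q₁ y (s + (t - s) * θ) -
    Q₃ y (s + (t - s) * θ))

/-- Writing the difference quotient as an average of the time derivative over `[0, 1]` makes it
continuous across `t = s` as well. -/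
theorem continuous_quotient (h : LaxPotential a Q Q₁ Q₂ Q₃) (s : ℝ) :
    Continuous fun p : ℝ × ℝ => quotient a Q Q₁ Q₃ s p.1 p.2 := by
  refine intervalIntegral.continuous_parametric_intervalIntegral_of_continuous'
    (f := fun (p : ℝ × ℝ) θ => 6 * (Q p.1 (s + (p.2 - s) * θ) - a) * Q₁ p.1 (s + (p.2 - s) * θ) -
    Q₃ p.1 (s + (p.2 - s) * θ)) ?_ 0 1
  exact h.continuous_dt.comp (f := fun r : (ℝ × ℝ) × ℝ => (r.1.1, s + (r.1.2 - s) * r.2))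
    (by fun_prop)

theorem sub_eq_quotient (h : LaxPotential a Q Q₁ Q₂ Q₃) (s y t : ℝ) :
    Q y t - Q y s = (t - s) * quotient a Q Q₁ Q₃ s y t := by
  have hc : Continuous fun r => 6 * (Q y r - a) * Q₁ y r - Q₃ y r :=
    h.continuous_dt.comp (continuous_const.prodMk continuous_id)
  have h1 := intervalIntegral.integral_eq_sub_of_hasDerivAt (a := s) (b := t)
    (fun r _ => h.evolution y r) (hc.intervalIntegrable _ _)
  have h2 := intervalIntegral.smul_integral_comp_add_mul (a := 0) (b := 1)
    (fun r => 6 * (Q y r - a) * Q₁ y r - Q₃ y r) (t - s) s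
  rw [mul_zero, add_zero, mul_one, add_sub_cancel, h1] at h2
  rw [← h2]; rfl

theorem quotient_self (s y : ℝ) :
    quotient a Q Q₁ Q₃ s y s = 6 * (Q y s - a) * Q₁ y s - Q₃ y s := by
  simp [quotient]

/-- With `u` frozen at time `s`, the Wronskian at time `t` is a constant plus `t - s` times a
continuous integral, so its derivative is `∫ Q_t u f`. The Lax equation turns this integral into
boundary terms. -/
theorem hasDerivAt_wronskian_time (h : LaxPotential a Q Q₁ Q₂ Q₃) {f g : ℝ → ℝ → ℂ}
    (hs : ∀ t, SolPair (fun x => Q x t) E (fun x => f x t) (fun x => g x t))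
    (hf : Continuous fun p : ℝ × ℝ => f p.1 p.2) (hf0 : ∀ t t', f 0 t = f 0 t')
    (hg0 : ∀ t t', g 0 t = g 0 t') {u v : ℝ → ℂ} {s : ℝ}
    (hu : SolPair (fun x => Q x s) E u v) (x : ℝ) :
    HasDerivAt (fun t => u x * g x t - v x * f x t)
      ((u x * laxPDeriv a Q Q₁ Q₂ E x s (f x s) (g x s) - v x * laxP a Q Q₁ E x s (f x s) (g x s)) -
      (u 0 * laxPDeriv a Q Q₁ Q₂ E 0 s (f 0 s) (g 0 s) - v 0 * laxP a Q Q₁ E 0 s (f 0 s) (g 0 s)))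
      s := by
  rw [← h.integral_dt_mul (hs s) hu x]
  have huc := hu.continuous_fst
  have hq := h.continuous_quotient s
  have hcont : Continuous fun t => ∫ y in (0 : ℝ)..x,
      (quotient a Q Q₁ Q₃ s y t : ℂ) * (u y * f y t) := by
    refine intervalIntegral.continuous_parametric_intervalIntegral_of_continuous'
      (f := fun t y => (quotient a Q Q₁ Q₃ s y t : ℂ) * (u y * f y t)) ?_ 0 x
    have e1 : Continuous fun p : ℝ × ℝ => quotient a Q Q₁ Q₃ s p.2 p.1 := hq.comp continuous_swap
    have e2 : Continuous fun p : ℝ × ℝ => f p.2 p.1 := hf.comp continuous_swap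
    simp only [Function.uncurry_def]
    fun_prop
  have hd := (hasDerivAt_sub_mul_of_continuousAt (a := s) hcont.continuousAt).const_add
    (u 0 * g 0 s - v 0 * f 0 s)
  have key : (fun t => u x * g x t - v x * f x t) = fun t => u 0 * g 0 s - v 0 * f 0 s +
      (t - s) • ∫ y in (0 : ℝ)..x, (quotient a Q Q₁ Q₃ s y t : ℂ) * (u y * f y t) := by
    funext t
    have hcQ : ∀ t, Continuous fun x => Q x t := fun t =>
      h.cont_zero.comp (continuous_id.prodMk continuous_const)
    rw [hu.two_potentials (hcQ s) (hcQ t) (hs t) x, hf0 t s, hg0 t s,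
      ← intervalIntegral.integral_smul]
    congr 1
    refine intervalIntegral.integral_congr fun y _ => ?_
    simp only [Complex.real_smul]
    have e : (Q y t : ℂ) - Q y s = (t - s : ℝ) * quotient a Q Q₁ Q₃ s y t := by
      exact_mod_cast h.sub_eq_quotient s y t
    rw [e]; ring
  rw [key]
  simpa only [quotient_self] using hd

/-- The evolution in time of the solutions with fixed data at `x = 0`. -/
theorem hasDerivAt_time (h : LaxPotential a Q Q₁ Q₂ Q₃) {f g c c' s s' : ℝ → ℝ → ℂ}
    (hfg : ∀ t, SolPair (fun x => Q x t) E (fun x => f x t) (fun x => g x t))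
    (hf : Continuous fun p : ℝ × ℝ => f p.1 p.2) (hf0 : ∀ t t', f 0 t = f 0 t')
    (hg0 : ∀ t t', g 0 t = g 0 t')
    (hc : ∀ t, SolPair (fun x => Q x t) E (fun x => c x t) (fun x => c' x t))
    (hc0 : ∀ t, c 0 t = 1) (hc0' : ∀ t, c' 0 t = 0)
    (hs : ∀ t, SolPair (fun x => Q x t) E (fun x => s x t) (fun x => s' x t))
    (hs0 : ∀ t, s 0 t = 0) (hs0' : ∀ t, s' 0 t = 1) (x t : ℝ) :
    HasDerivAt (fun r => f x r) (laxP a Q Q₁ E x t (f x t) (g x t) -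
      (laxP a Q Q₁ E 0 t (f 0 t) (g 0 t) * c x t +
        laxPDeriv a Q Q₁ Q₂ E 0 t (f 0 t) (g 0 t) * s x t)) t := by
  have hW : c x t * s' x t - c' x t * s x t = 1 := by
    rw [(hc t).wronskian_const (hs t) x 0, hc0, hc0', hs0, hs0']; ring
  have d1 := h.hasDerivAt_wronskian_time hfg hf hf0 hg0 (hc t) x
  have d2 := h.hasDerivAt_wronskian_time hfg hf hf0 hg0 (hs t) x
  have d3 := (d1.mul_const (s x t)).sub (d2.mul_const (c x t))
  -- Cramer's rule with the solutions `c`, `s` frozen at time `t`, whose Wronskian is one.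
  have key : (fun r => f x r) = (fun r => (c x t * g x r - c' x t * f x r) * s x t) -
      fun r => (s x t * g x r - s' x t * f x r) * c x t := by
    funext r
    simp only [Pi.sub_apply]
    linear_combination (-f x r) * hW
  rw [key]
  refine d3.congr_deriv ?_
  rw [hc0, hc0', hs0, hs0']
  linear_combination (laxP a Q Q₁ E x t (f x t) (g x t)) * hW

end LaxPotential

/-! ### A priori bounds -/

/-- Growth of solutions for `Im k ≥ 0`, `k ≠ 0`. -/
theorem ShortRange.norm_solution_le {V : ℝ → ℝ} (hV : ShortRange V) {k : ℂ} (hk : 0 ≤ k.im)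
    (hk0 : k ≠ 0) {f g : ℝ → ℂ} (h : SolPair V (k ^ 2) f g) {x : ℝ} (hx : 0 ≤ x) :
    ‖Complex.exp (Complex.I * k * x) * (g x - Complex.I * k * f x)‖ ≤
        Real.exp (tail V 0 / ‖k‖) * (2 * (‖g 0‖ + ‖k‖ * ‖f 0‖)) ∧
      ‖Complex.exp (Complex.I * k * x) * (g x + Complex.I * k * f x)‖ ≤
        Real.exp (tail V 0 / ‖k‖) * (2 * (‖g 0‖ + ‖k‖ * ‖f 0‖)) := by
  have hkp : 0 < ‖k‖ := norm_pos_iff.2 hk0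
  set e : ℝ → ℂ := fun x => Complex.exp (Complex.I * k * x) with he
  -- For `V = 0` and `f = α e^{ikx} + β e^{-ikx}`, `r` is the constant `-2ikβ` and `p = 2ikα
  -- e^{2ikx}` is bounded, so only the potential can make them grow.
  set r : ℝ → ℂ := fun x => e x * (g x - Complex.I * k * f x) with hr
  set p : ℝ → ℂ := fun x => e x * (g x + Complex.I * k * f x) with hp
  have dr : ∀ x, HasDerivAt r (V x * (e x * f x)) x := fun x =>
    ((hasDerivAt_exp_mul (Complex.I * k) x).mul
      ((h.snd x).sub ((h.fst x).const_mul (Complex.I * k)))).congr_deriv (by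
        simp only [he, Pi.sub_apply]
        linear_combination (-Complex.exp (Complex.I * k * x) * k ^ 2 * f x) * Complex.I_sq)
  have dp : ∀ x, HasDerivAt p (2 * Complex.I * k * p x + V x * (e x * f x)) x := fun x =>
    ((hasDerivAt_exp_mul (Complex.I * k) x).mul
      ((h.snd x).add ((h.fst x).const_mul (Complex.I * k)))).congr_deriv (by
        simp only [he, hp, Pi.add_apply]
        linear_combination (-Complex.exp (Complex.I * k * x) * k ^ 2 * f x) * Complex.I_sq)
  set S : ℝ → ℝ := fun x => ‖r x‖ ^ 2 + ‖p x‖ ^ 2 with hS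
  have hef : ∀ x, 2 * ‖k‖ * ‖e x * f x‖ ≤ ‖r x‖ + ‖p x‖ := by
    intro x
    have h1 : p x - r x = 2 * Complex.I * k * (e x * f x) := by simp only [hp, hr]; ring
    have h2 : ‖p x - r x‖ = 2 * ‖k‖ * ‖e x * f x‖ := by rw [h1]; simp
    rw [← h2]
    linarith [norm_sub_le (p x) (r x)]
  have hinner : ∀ z w : ℂ, inner ℝ z w ≤ ‖z‖ * ‖w‖ := fun z w => real_inner_le_norm z w
  have dS : ∀ x, HasDerivAt S (2 * inner ℝ (r x) (V x * (e x * f x)) +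
      2 * inner ℝ (p x) (2 * Complex.I * k * p x + V x * (e x * f x))) x := fun x =>
    (dr x).norm_sq.add (dp x).norm_sq
  have hdS : ∀ x, 2 * inner ℝ (r x) (V x * (e x * f x)) +
      2 * inner ℝ (p x) (2 * Complex.I * k * p x + V x * (e x * f x)) ≤
      2 * |V x| / ‖k‖ * S x := by
    intro x
    rw [inner_add_right]
    -- The free evolution of `p` does not increase its modulus, by `Im k ≥ 0`.
    have e1 : inner ℝ (p x) (2 * Complex.I * k * p x) ≤ 0 := by
      have : inner ℝ (p x) (2 * Complex.I * k * p x) = -2 * k.im * Complex.normSq (p x) := by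
        rw [Complex.inner, mul_assoc, Complex.mul_conj, Complex.re_mul_ofReal]
        simp
      rw [this]
      have := mul_nonneg hk (Complex.normSq_nonneg (p x))
      linarith
    have hn : ‖(V x : ℂ) * (e x * f x)‖ = |V x| * ‖e x * f x‖ := by
      rw [norm_mul, Complex.norm_real, Real.norm_eq_abs]
    have e2 := hinner (r x) (V x * (e x * f x))
    have e3 := hinner (p x) (V x * (e x * f x))
    rw [hn] at e2 e3
    have e4 := hef x
    have e5 : ‖e x * f x‖ ≤ (‖r x‖ + ‖p x‖) / (2 * ‖k‖) := by
      rw [le_div_iff₀ (by positivity)]; linarith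
    have e6 : (‖r x‖ + ‖p x‖) * (|V x| * ‖e x * f x‖) ≤
        (‖r x‖ + ‖p x‖) * (|V x| * ((‖r x‖ + ‖p x‖) / (2 * ‖k‖))) := by gcongr
    have e7 : 2 * ((‖r x‖ + ‖p x‖) * (|V x| * ((‖r x‖ + ‖p x‖) / (2 * ‖k‖)))) =
        |V x| / ‖k‖ * (‖r x‖ + ‖p x‖) ^ 2 := by field_simp
    have e8 : (‖r x‖ + ‖p x‖) ^ 2 ≤ 2 * S x := by
      simp only [hS]; nlinarith [sq_nonneg (‖r x‖ - ‖p x‖)]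
    have e9 : |V x| / ‖k‖ * (‖r x‖ + ‖p x‖) ^ 2 ≤ |V x| / ‖k‖ * (2 * S x) := by gcongr
    have e10 : 2 * |V x| / ‖k‖ * S x = |V x| / ‖k‖ * (2 * S x) := by ring
    rw [e10]
    nlinarith
  -- Gronwall's inequality with the integrating factor written through `tail`, whose derivative is
  -- `-|V|`.
  have hanti : Antitone fun x => S x * Real.exp (2 * tail V x / ‖k‖) := by
    refine antitone_of_hasDerivAt_nonpos (fun x => (dS x).mul
      (((hV.hasDerivAt_tail x).const_mul 2).div_const ‖k‖).exp) fun x => ?_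
    simp only [Pi.zero_apply]
    have h1 := hdS x
    have h2 := Real.exp_pos (2 * tail V x / ‖k‖)
    have h3 : 2 * -|V x| / ‖k‖ = -(2 * |V x| / ‖k‖) := by ring
    rw [h3]
    nlinarith
  have h1 := hanti hx
  simp only at h1
  have h2 : 1 ≤ Real.exp (2 * tail V x / ‖k‖) :=
    Real.one_le_exp (by have := tail_nonneg V x; positivity)
  have hS0 : 0 ≤ S x := by positivity
  have h3 : S x ≤ S 0 * Real.exp (2 * tail V 0 / ‖k‖) := by nlinarith
  have h4 : S 0 ≤ 2 * (‖g 0‖ + ‖k‖ * ‖f 0‖) ^ 2 := by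
    have e0 : e 0 = 1 := by simp [he]
    have n1 : ‖r 0‖ ≤ ‖g 0‖ + ‖k‖ * ‖f 0‖ := by
      simp only [hr, e0, one_mul]
      refine (norm_sub_le _ _).trans (le_of_eq ?_)
      simp
    have n2 : ‖p 0‖ ≤ ‖g 0‖ + ‖k‖ * ‖f 0‖ := by
      simp only [hp, e0, one_mul]
      refine (norm_add_le _ _).trans (le_of_eq ?_)
      simp
    simp only [hS]
    have := pow_le_pow_left₀ (norm_nonneg _) n1 2
    have := pow_le_pow_left₀ (norm_nonneg _) n2 2
    linarith
  have h5 : S x ≤ (Real.exp (tail V 0 / ‖k‖) * (2 * (‖g 0‖ + ‖k‖ * ‖f 0‖))) ^ 2 := by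
    have h6 : Real.exp (2 * tail V 0 / ‖k‖) = Real.exp (tail V 0 / ‖k‖) ^ 2 := by
      rw [← Real.exp_nat_mul]; congr 1; push_cast; ring
    rw [h6] at h3
    have h7 := mul_le_mul_of_nonneg_right h4 (sq_nonneg (Real.exp (tail V 0 / ‖k‖)))
    have h8 : 0 ≤ (‖g 0‖ + ‖k‖ * ‖f 0‖) ^ 2 * Real.exp (tail V 0 / ‖k‖) ^ 2 := by positivity
    nlinarith
  have hpos : 0 ≤ Real.exp (tail V 0 / ‖k‖) * (2 * (‖g 0‖ + ‖k‖ * ‖f 0‖)) := by positivity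
  have hr2 := sq_nonneg ‖r x‖
  have hp2 := sq_nonneg ‖p x‖
  constructor
  · exact abs_le_of_sq_le_sq' (by simp only [hS] at h5; linarith) hpos |>.2
  · exact abs_le_of_sq_le_sq' (by simp only [hS] at h5; linarith) hpos |>.2

namespace LaxPotential

variable {a : ℝ} {Q Q₁ Q₂ Q₃ : ℝ → ℝ → ℝ}

/-- The first moment gives no control near `y = 0`, so `[0, 1]` is handled by compactness and only
the tail beyond `1` by the moment. -/
theorem exists_tail_le (h : LaxPotential a Q Q₁ Q₂ Q₃) (τ : ℝ) :
    ∃ M, ∀ t, |t| ≤ τ → tail (fun x => Q x t) 0 ≤ M := by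
  obtain ⟨M, hM⟩ := h.bound τ
  obtain ⟨B, hB⟩ := ((isCompact_Icc (a := (0 : ℝ)) (b := 1)).prod
    (isCompact_Icc (a := -τ) (b := τ))).exists_bound_of_continuousOn h.cont_zero.continuousOn
  refine ⟨B + M, fun t ht => ?_⟩
  have hV := h.short t
  have h1 := integral_Ioi_eq_sub hV.cont.abs (hV.integrableOn_abs 1) 0
  have h2 : ‖∫ y in (1 : ℝ)..0, |Q y t|‖ ≤ B * |0 - 1| := by
    refine intervalIntegral.norm_integral_le_of_norm_le_const fun y hy => ?_
    rw [Set.uIoc_of_ge zero_le_one] at hy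
    have := hB (y, t) ⟨⟨hy.1.le, hy.2⟩, abs_le.1 ht⟩
    simpa using this
  have h3 := hV.mul_tail_le zero_le_one
  have h4 := hV.moment_tail_le zero_le_one
  have h5 := hM t ht
  have h6 : tail (fun x => Q x t) 0 = tail (fun x => Q x t) 1 - ∫ y in (1 : ℝ)..0, |Q y t| := h1
  rw [h6]
  rw [Real.norm_eq_abs] at h2
  have h7 := neg_abs_le (∫ y in (1 : ℝ)..0, |Q y t|)
  norm_num at h2
  linarith

theorem exists_weight_le (h : LaxPotential a Q Q₁ Q₂ Q₃) (τ : ℝ) :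
    ∃ M, ∀ t, |t| ≤ τ → weight (fun x => Q x t) 0 ≤ M := by
  obtain ⟨M, hM⟩ := h.bound τ
  refine ⟨Real.exp (2 * M), fun t ht => Real.exp_le_exp.2 ?_⟩
  linarith [(h.short t).tailTwo_zero_le, hM t ht]

end LaxPotential
end StepKdV
end

noncomputable section
namespace StepKdV

/-! ### Averages at infinity -/

/-- A polynomial bump on `[0, 1]` with integral one, vanishing to second order at the ends. -/
def bump (u : ℝ) : ℝ := 30 * u ^ 2 * (1 - u) ^ 2

/-- The derivative of the bump. -/
def bumpOne (u : ℝ) : ℝ := 60 * u * (1 - u) * (1 - 2 * u)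

/-- The second derivative of the bump. -/
def bumpTwo (u : ℝ) : ℝ := 60 * (1 - 6 * u + 6 * u ^ 2)

theorem continuous_bump : Continuous bump := by unfold bump; fun_prop

theorem continuous_bumpOne : Continuous bumpOne := by unfold bumpOne; fun_prop

theorem continuous_bumpTwo : Continuous bumpTwo := by unfold bumpTwo; fun_prop

theorem hasDerivAt_bump (u : ℝ) : HasDerivAt bump (bumpOne u) u := by
  have h1 := hasDerivAt_id' u
  refine (((h1.pow 2).const_mul 30).mul ((h1.const_sub 1).pow 2)).congr_deriv ?_
  simp [bumpOne]; ring

theorem hasDerivAt_bumpOne (u : ℝ) : HasDerivAt bumpOne (bumpTwo u) u := by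
  have h1 := hasDerivAt_id' u
  refine (((h1.const_mul 60).mul (h1.const_sub 1)).mul ((h1.const_mul 2).const_sub 1)).congr_deriv ?_
  simp [bumpTwo]; ring

theorem bump_nonneg (u : ℝ) : 0 ≤ bump u := by unfold bump; positivity

theorem integral_bump (n : ℝ) : ∫ x in n..n + 1, bump (x - n) = 1 := by
  rw [intervalIntegral.integral_comp_sub_right, sub_self, add_sub_cancel_left,
    intervalIntegral.integral_eq_sub_of_hasDerivAt
      (f := fun u => 10 * u ^ 3 - 15 * u ^ 4 + 6 * u ^ 5) (fun u _ => ?_)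
      (continuous_bump.intervalIntegrable _ _)]
  · norm_num
  · have h1 := hasDerivAt_id' u
    refine ((((h1.pow 3).const_mul 10).sub ((h1.pow 4).const_mul 15)).add
      ((h1.pow 5).const_mul 6)).congr_deriv ?_
    simp [bump]; ring

/-- The weight `(χ' + 2 i k χ) e^{ikx}` for the bump `χ` on `[n, n + 1]`. -/
def testFun (k : ℂ) (n x : ℝ) : ℂ :=
  (bumpOne (x - n) + 2 * Complex.I * k * bump (x - n)) * Complex.exp (Complex.I * k * x)

/-- The derivative of `testFun`. -/
def testFunDeriv (k : ℂ) (n x : ℝ) : ℂ :=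
  (bumpTwo (x - n) + 3 * Complex.I * k * bumpOne (x - n) - 2 * k ^ 2 * bump (x - n)) *
    Complex.exp (Complex.I * k * x)

theorem continuous_testFun (k : ℂ) (n : ℝ) : Continuous (testFun k n) := by
  have h1 := continuous_bump
  have h2 := continuous_bumpOne
  unfold testFun; fun_prop

theorem continuous_testFunDeriv (k : ℂ) (n : ℝ) : Continuous (testFunDeriv k n) := by
  have h1 := continuous_bump
  have h2 := continuous_bumpOne
  have h3 := continuous_bumpTwo
  unfold testFunDeriv; fun_prop

theorem hasDerivAt_bump_sub (n x : ℝ) :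
    HasDerivAt (fun x : ℝ => (bump (x - n) : ℂ)) (bumpOne (x - n)) x :=
  ((hasDerivAt_bump (x - n)).comp_sub_const x n).ofReal_comp

theorem hasDerivAt_testFun (k : ℂ) (n x : ℝ) :
    HasDerivAt (testFun k n) (testFunDeriv k n x) x := by
  have h1 := hasDerivAt_bump_sub n x
  have h2 := ((hasDerivAt_bumpOne (x - n)).comp_sub_const x n).ofReal_comp
  refine ((h2.add (h1.const_mul (2 * Complex.I * k))).mul
    (hasDerivAt_exp_mul (Complex.I * k) x)).congr_deriv ?_
  simp only [testFunDeriv, Pi.add_apply]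
  linear_combination (2 * k ^ 2 * bump (x - n) * Complex.exp (Complex.I * k * x)) * Complex.I_sq

theorem exists_bump_bound (k : ℂ) : ∃ K : ℝ, 0 ≤ K ∧ ∀ u ∈ Set.Icc (0 : ℝ) 1,
    ‖(bump u : ℂ)‖ ≤ K ∧ ‖(bumpOne u : ℂ) + 2 * Complex.I * k * bump u‖ ≤ K ∧
    ‖(bumpTwo u : ℂ) + 3 * Complex.I * k * bumpOne u - 2 * k ^ 2 * bump u‖ ≤ K := by
  have h1 := continuous_bump
  have h2 := continuous_bumpOne
  have h3 := continuous_bumpTwo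
  obtain ⟨A, hA⟩ := (isCompact_Icc (a := (0 : ℝ)) (b := 1)).exists_bound_of_continuousOn
    (f := fun u => (bump u : ℂ)) (by fun_prop)
  obtain ⟨B, hB⟩ := (isCompact_Icc (a := (0 : ℝ)) (b := 1)).exists_bound_of_continuousOn
    (f := fun u => (bumpOne u : ℂ) + 2 * Complex.I * k * bump u) (by fun_prop)
  obtain ⟨C, hC⟩ := (isCompact_Icc (a := (0 : ℝ)) (b := 1)).exists_bound_of_continuousOn
    (f := fun u => (bumpTwo u : ℂ) + 3 * Complex.I * k * bumpOne u - 2 * k ^ 2 * bump u)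
    (by fun_prop)
  have h0 : (0 : ℝ) ∈ Set.Icc (0 : ℝ) 1 := ⟨le_rfl, zero_le_one⟩
  refine ⟨max A (max B C), ((norm_nonneg _).trans (hA 0 h0)).trans (le_max_left _ _),
    fun u hu => ⟨(hA u hu).trans (le_max_left _ _), (hB u hu).trans ?_, (hC u hu).trans ?_⟩⟩
  · exact (le_max_left _ _).trans (le_max_right _ _)
  · exact (le_max_right _ _).trans (le_max_right _ _)

/-- The average of a solution against `testFun` over `[n, n + 1]`. -/
def average (k : ℂ) (n : ℝ) (f : ℝ → ℂ) : ℂ := ∫ x in n..n + 1, testFun k n x * f x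

/-- The two integrands differ by the derivative of `χ e^{ikx} f`, which vanishes at both ends. The
right side is a smeared Wronskian with `e^{ikx}`; the left side contains no derivative of `f`, so
only `f_t` is needed to differentiate it in time. -/
theorem SolPair.average_eq {V : ℝ → ℝ} {E k : ℂ} {f g : ℝ → ℂ} (h : SolPair V E f g) (n : ℝ) :
    average k n f = ∫ x in n..n + 1, (bump (x - n) : ℂ) *
      -(Complex.exp (Complex.I * k * x) * (g x - Complex.I * k * f x)) := by
  have c1 := continuous_bump
  have c2 := continuous_testFun k n
  have c3 := h.continuous_fst
  have c4 := h.continuous_snd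
  rw [average, ← sub_eq_zero, ← intervalIntegral.integral_sub
    (Continuous.intervalIntegrable (by fun_prop) _ _)
    (Continuous.intervalIntegrable (by fun_prop) _ _)]
  rw [intervalIntegral.integral_eq_sub_of_hasDerivAt
    (f := fun x => (bump (x - n) : ℂ) * (Complex.exp (Complex.I * k * x) * f x))
    (fun x _ => ((hasDerivAt_bump_sub n x).mul
      ((hasDerivAt_exp_mul (Complex.I * k) x).mul (h.fst x))).congr_deriv ?_)
    (Continuous.intervalIntegrable (by fun_prop) _ _)]
  · simp [bump]
  · simp only [testFun, Pi.mul_apply]; ring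

/-- The remainder in the evolution equation of the averages. -/
def averageError (a : ℝ) (V : ℝ → ℝ) (k : ℂ) (n : ℝ) (f g : ℝ → ℂ) (x : ℝ) : ℂ :=
  V x * (3 * (testFun k n x * g x) + testFunDeriv k n x * f x -
    (4 * k ^ 2 - 6 * a) * (bump (x - n) * (Complex.exp (Complex.I * k * x) * f x)))

/-- Integration by parts moves the derivative off `Q₁`, so the error contains only the
undifferentiated potential, the one quantity known to be integrable at infinity. -/
theorem LaxPotential.integral_testFun_laxP {a : ℝ} {Q Q₁ Q₂ Q₃ : ℝ → ℝ → ℝ}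
    (hQ : LaxPotential a Q Q₁ Q₂ Q₃) {k : ℂ} {f g : ℝ → ℂ} {t : ℝ}
    (h : SolPair (fun x => Q x t) (k ^ 2) f g) (n : ℝ) :
    ∫ x in n..n + 1, testFun k n x * laxP a Q Q₁ (k ^ 2) x t (f x) (g x) =
      -(Complex.I * k * (4 * k ^ 2 - 6 * a)) * average k n f +
        ∫ x in n..n + 1, averageError a (fun x => Q x t) k n f g x := by
  have c1 := continuous_bump
  have c2 := continuous_testFun k n
  have c3 := h.continuous_fst
  have c4 := h.continuous_snd
  have c5 := continuous_testFunDeriv k n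
  have c6 : Continuous fun x => Q x t := (hQ.short t).cont
  have c7 : Continuous fun x => Q₁ x t := hQ.cont_one.comp (continuous_id.prodMk continuous_const)
  have c8 : Continuous fun x => testFun k n x * laxP a Q Q₁ (k ^ 2) x t (f x) (g x) := by
    unfold laxP; fun_prop
  have c9 : Continuous fun x => averageError a (fun x => Q x t) k n f g x := by
    unfold averageError; fun_prop
  rw [average, ← intervalIntegral.integral_const_mul, ← intervalIntegral.integral_add
    (Continuous.intervalIntegrable (by fun_prop) _ _) (c9.intervalIntegrable _ _), ← sub_eq_zero,
    ← intervalIntegral.integral_sub (c8.intervalIntegrable _ _)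
    (Continuous.intervalIntegrable (by fun_prop) _ _)]
  have hq := (hQ.deriv_zero · t |>.ofReal_comp)
  -- The primitive for both integrations by parts; it vanishes at the ends because the bump and its
  -- first derivative do.
  have hd : ∀ x, HasDerivAt (fun x => (4 * k ^ 2 - 6 * a) * ((bump (x - n) : ℂ) *
      (Complex.exp (Complex.I * k * x) * (g x + Complex.I * k * f x))) -
      (Q x t : ℂ) * (testFun k n x * f x))
      (testFun k n x * laxP a Q Q₁ (k ^ 2) x t (f x) (g x) -
        (-(Complex.I * k * (4 * k ^ 2 - 6 * a)) * (testFun k n x * f x) +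
          averageError a (fun x => Q x t) k n f g x)) x := fun x => by
    refine ((((hasDerivAt_bump_sub n x).mul ((hasDerivAt_exp_mul (Complex.I * k) x).mul
      ((h.snd x).add ((h.fst x).const_mul (Complex.I * k))))).const_mul _).sub
      ((hq x).mul ((hasDerivAt_testFun k n x).mul (h.fst x)))).congr_deriv ?_
    simp only [averageError, laxP, Pi.mul_apply, Pi.add_apply]
    unfold testFun
    linear_combination (-(4 * k ^ 2 - 6 * a) * k ^ 2 * f x * bump (x - n) *
      Complex.exp (Complex.I * k * x)) * Complex.I_sq
  rw [intervalIntegral.integral_eq_sub_of_hasDerivAt (fun x _ => hd x)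
    (Continuous.intervalIntegrable (by fun_prop) _ _)]
  simp [bump, testFun, bumpOne]

/-! ### Uniform bounds and limits of the averages -/

section Bounds

variable {V : ℝ → ℝ} {k : ℂ} {f g : ℝ → ℂ}

/-- The constant in `ShortRange.norm_solution_le`. -/
def growthConst (V : ℝ → ℝ) (k : ℂ) (f g : ℝ → ℂ) : ℝ :=
  Real.exp (tail V 0 / ‖k‖) * (2 * (‖g 0‖ + ‖k‖ * ‖f 0‖))

theorem growthConst_nonneg (V : ℝ → ℝ) (k : ℂ) (f g : ℝ → ℂ) : 0 ≤ growthConst V k f g := by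
  unfold growthConst; positivity

namespace ShortRange

theorem norm_exp_mul_solution_le (hV : ShortRange V) (hk : 0 ≤ k.im) (hk0 : k ≠ 0)
    (h : SolPair V (k ^ 2) f g) {x : ℝ} (hx : 0 ≤ x) :
    ‖Complex.exp (Complex.I * k * x) * f x‖ ≤ growthConst V k f g / ‖k‖ ∧
      ‖Complex.exp (Complex.I * k * x) * g x‖ ≤ growthConst V k f g := by
  obtain ⟨h1, h2⟩ := hV.norm_solution_le hk hk0 h hx
  have hkp : 0 < ‖k‖ := norm_pos_iff.2 hk0
  change _ ≤ growthConst V k f g at h1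
  change _ ≤ growthConst V k f g at h2
  set e := Complex.exp (Complex.I * k * x)
  constructor
  · rw [le_div_iff₀ hkp]
    have e1 : ‖e * (g x + Complex.I * k * f x) - e * (g x - Complex.I * k * f x)‖ =
        2 * (‖e * f x‖ * ‖k‖) := by
      rw [show e * (g x + Complex.I * k * f x) - e * (g x - Complex.I * k * f x) =
        2 * Complex.I * k * (e * f x) by ring]
      simp; ring
    have e2 := norm_sub_le (e * (g x + Complex.I * k * f x)) (e * (g x - Complex.I * k * f x))
    linarith
  · have e1 : ‖e * (g x + Complex.I * k * f x) + e * (g x - Complex.I * k * f x)‖ =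
        2 * ‖e * g x‖ := by
      rw [show e * (g x + Complex.I * k * f x) + e * (g x - Complex.I * k * f x) =
        2 * (e * g x) by ring]
      simp
    have e2 := norm_add_le (e * (g x + Complex.I * k * f x)) (e * (g x - Complex.I * k * f x))
    linarith

theorem norm_average_le (hV : ShortRange V) (hk : 0 ≤ k.im) (hk0 : k ≠ 0)
    (h : SolPair V (k ^ 2) f g) {n : ℝ} (hn : 0 ≤ n) :
    ‖average k n f‖ ≤ growthConst V k f g := by
  rw [h.average_eq]
  have h1 := intervalIntegral.norm_integral_le_of_norm_le (a := n) (b := n + 1) (μ := volume)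
    (f := fun x => (bump (x - n) : ℂ) *
      -(Complex.exp (Complex.I * k * x) * (g x - Complex.I * k * f x)))
    (g := fun x => bump (x - n) * growthConst V k f g) (by linarith)
    (Eventually.of_forall fun x hx => by
      rw [norm_mul, norm_neg, Complex.norm_real, Real.norm_eq_abs, abs_of_nonneg (bump_nonneg _)]
      exact mul_le_mul_of_nonneg_left
        (hV.norm_solution_le hk hk0 h (hn.trans hx.1.le)).1 (bump_nonneg _))
    (Continuous.intervalIntegrable (by have := continuous_bump; fun_prop) _ _)
  rw [intervalIntegral.integral_mul_const, integral_bump, one_mul] at h1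
  exact h1

/-- With `φ = e^{ikx} m`, the smeared quantity differs from the constant Wronskian `ℓ` by terms
containing `m - 1` or `m'`. Both are bounded by a constant times `tail V n` on `[n, n+1]`. -/
theorem tendsto_average (hV : ShortRange V) (hk : 0 ≤ k.im) (hk0 : k ≠ 0)
    (h : SolPair V (k ^ 2) f g) :
    Tendsto (fun n : ℕ => average k n f) atTop
      (𝓝 (f 0 * jostDeriv V k 0 - g 0 * jost V k 0)) := by
  set ℓ := f 0 * jostDeriv V k 0 - g 0 * jost V k 0 with hℓ
  set D := growthConst V k f g with hD
  have hD0 : 0 ≤ D := growthConst_nonneg V k f g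
  have hkp : 0 < ‖k‖ := norm_pos_iff.2 hk0
  have hs := hV.solPair_jost hk
  have hpt : ∀ n : ℕ, ∀ x : ℝ, (n : ℝ) ≤ x →
      ‖-(Complex.exp (Complex.I * k * x) * (g x - Complex.I * k * f x)) - ℓ‖ ≤
        4 * D * weight V 0 / ‖k‖ * tail V n := by
    intro n x hx
    have hx0 : 0 ≤ x := (Nat.cast_nonneg n).trans hx
    have e1 : ℓ = f x * jostDeriv V k x - g x * jost V k x := (h.wronskian_const hs x 0).symm
    have e2 : -(Complex.exp (Complex.I * k * x) * (g x - Complex.I * k * f x)) - ℓ =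
        Complex.exp (Complex.I * k * x) * (g x - Complex.I * k * f x) * (jostM V k x - 1) -
          Complex.exp (Complex.I * k * x) * f x * jostMDeriv V k x := by
      rw [e1]; simp only [jost, jostDeriv]; ring
    rw [e2]
    have n1 : ‖Complex.exp (Complex.I * k * x) * (g x - Complex.I * k * f x)‖ ≤ D :=
      (hV.norm_solution_le hk hk0 h hx0).1
    have n2 : ‖Complex.exp (Complex.I * k * x) * f x‖ ≤ D / ‖k‖ :=
      (hV.norm_exp_mul_solution_le hk hk0 h hx0).1
    have hw : weight V x * tail V x ≤ weight V 0 * tail V n :=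
      mul_le_mul (hV.weight_antitone hx0) (hV.tail_antitone hx) (tail_nonneg V x)
        (weight_pos V 0).le
    have n3 : ‖jostM V k x - 1‖ ≤ 2 * (weight V 0 * tail V n) / ‖k‖ := by
      rw [le_div_iff₀ hkp]
      linarith [hV.norm_two_I_mul_jostM_sub_one_le hk x]
    have n4 : ‖jostMDeriv V k x‖ ≤ 2 * (weight V 0 * tail V n) := by
      linarith [hV.norm_jostMDeriv_le hk x]
    refine (norm_sub_le _ _).trans ?_
    rw [norm_mul, norm_mul _ (jostMDeriv V k x)]
    calc _ ≤ D * (2 * (weight V 0 * tail V n) / ‖k‖) + D / ‖k‖ * (2 * (weight V 0 * tail V n)) := by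
          gcongr
      _ = _ := by ring
  rw [tendsto_iff_norm_sub_tendsto_zero]
  have hlim : Tendsto (fun n : ℕ => 4 * D * weight V 0 / ‖k‖ * tail V n) atTop (𝓝 0) := by
    have := ((tendsto_tail V).comp tendsto_natCast_atTop_atTop).const_mul
      (4 * D * weight V 0 / ‖k‖)
    simpa [Function.comp_def] using this
  refine squeeze_zero (fun _ => norm_nonneg _) (fun n => ?_) hlim
  have c1 := continuous_bump
  have c3 := h.continuous_fst
  have c4 := h.continuous_snd
  have e3 : average k n f - ℓ = ∫ x in (n : ℝ)..n + 1, (bump (x - n) : ℂ) *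
      (-(Complex.exp (Complex.I * k * x) * (g x - Complex.I * k * f x)) - ℓ) := by
    have e4 : ∫ x in (n : ℝ)..n + 1, (bump (x - n) : ℂ) * ℓ = ℓ := by
      rw [intervalIntegral.integral_mul_const, intervalIntegral.integral_ofReal, integral_bump]
      simp
    nth_rw 1 [← e4]
    rw [h.average_eq, ← intervalIntegral.integral_sub
      (Continuous.intervalIntegrable (by fun_prop) _ _)
      (Continuous.intervalIntegrable (by fun_prop) _ _)]
    refine intervalIntegral.integral_congr fun x _ => ?_
    ring
  rw [e3]
  have h1 := intervalIntegral.norm_integral_le_of_norm_le (a := (n : ℝ)) (b := n + 1) (μ := volume)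
    (f := fun x => (bump (x - n) : ℂ) *
      (-(Complex.exp (Complex.I * k * x) * (g x - Complex.I * k * f x)) - ℓ))
    (g := fun x => bump (x - n) * (4 * D * weight V 0 / ‖k‖ * tail V n)) (by linarith)
    (Eventually.of_forall fun x hx => by
      rw [norm_mul, Complex.norm_real, Real.norm_eq_abs, abs_of_nonneg (bump_nonneg _)]
      exact mul_le_mul_of_nonneg_left (hpt n x hx.1.le) (bump_nonneg _))
    (Continuous.intervalIntegrable (by fun_prop) _ _)
  rw [intervalIntegral.integral_mul_const, integral_bump, one_mul] at h1
  exact h1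

/-- The constant `K` precedes the potential and the solution, so the same one serves all times. -/
theorem exists_norm_averageError_le (a : ℝ) (hk : 0 ≤ k.im) (hk0 : k ≠ 0) :
    ∃ K, 0 ≤ K ∧ ∀ {V : ℝ → ℝ} {f g : ℝ → ℂ}, ShortRange V → SolPair V (k ^ 2) f g → ∀ n : ℕ,
      ‖∫ x in (n : ℝ)..n + 1, averageError a V k n f g x‖ ≤ K * growthConst V k f g * tail V n := by
  obtain ⟨K, hK0, hK⟩ := exists_bump_bound k
  have hkp : 0 < ‖k‖ := norm_pos_iff.2 hk0
  refine ⟨3 * K + K / ‖k‖ + ‖4 * k ^ 2 - 6 * (a : ℂ)‖ * (K / ‖k‖), by positivity,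
    fun {V f g} hV h n => ?_⟩
  set D := growthConst V k f g
  have hD0 : 0 ≤ D := growthConst_nonneg V k f g
  set L := 3 * K + K / ‖k‖ + ‖4 * k ^ 2 - 6 * (a : ℂ)‖ * (K / ‖k‖)
  have hint : IntegrableOn (fun x => L * D * |V x|) (Set.Ioi (n : ℝ)) :=
    (hV.integrableOn_abs n).const_mul _
  have hL0 : 0 ≤ L := by positivity
  have h1 := intervalIntegral.norm_integral_le_of_norm_le (a := (n : ℝ)) (b := n + 1) (μ := volume)
    (f := averageError a V k n f g) (g := fun x => L * D * |V x|) (by linarith)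
    (Eventually.of_forall fun x hx => by
      have hx0 : 0 ≤ x := (Nat.cast_nonneg n).trans hx.1.le
      obtain ⟨b1, b2, b3⟩ := hK (x - n) ⟨by linarith [hx.1], by linarith [hx.2]⟩
      obtain ⟨s1, s2⟩ := hV.norm_exp_mul_solution_le hk hk0 h hx0
      have t1 : ‖testFun k n x * g x‖ ≤ K * D := by
        rw [testFun, mul_assoc, norm_mul]
        exact mul_le_mul b2 s2 (norm_nonneg _) hK0
      have t2 : ‖testFunDeriv k n x * f x‖ ≤ K * (D / ‖k‖) := by
        rw [testFunDeriv, mul_assoc, norm_mul]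
        exact mul_le_mul b3 s1 (norm_nonneg _) hK0
      have t3 : ‖(bump (x - n) : ℂ) * (Complex.exp (Complex.I * k * x) * f x)‖ ≤ K * (D / ‖k‖) := by
        rw [norm_mul]
        exact mul_le_mul b1 s1 (norm_nonneg _) hK0
      rw [averageError, norm_mul, Complex.norm_real, Real.norm_eq_abs, mul_comm]
      refine mul_le_mul_of_nonneg_right ?_ (abs_nonneg _)
      refine (norm_sub_le _ _).trans ((add_le_add_left (norm_add_le _ _) _).trans ?_)
      rw [norm_mul (3 : ℂ), norm_mul (4 * k ^ 2 - 6 * (a : ℂ))]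
      have t4 := mul_le_mul_of_nonneg_left t3 (norm_nonneg (4 * k ^ 2 - 6 * (a : ℂ)))
      have t5 : ‖(3 : ℂ)‖ = 3 := by simp
      rw [t5]
      have t6 : L * D = 3 * (K * D) + K * (D / ‖k‖) +
          ‖4 * k ^ 2 - 6 * (a : ℂ)‖ * (K * (D / ‖k‖)) := by simp only [L]; ring
      rw [t6]
      linarith)
    (Continuous.intervalIntegrable (by have := hV.cont; fun_prop) _ _)
  refine h1.trans ?_
  rw [intervalIntegral.integral_const_mul]
  refine mul_le_mul_of_nonneg_left ?_ (mul_nonneg hL0 hD0)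
  have h2 := integral_Ioi_eq_sub hV.cont.abs (hV.integrableOn_abs n) (n + 1)
  have h3 := tail_nonneg V (n + 1)
  have h4 : tail V (n + 1) = tail V n - ∫ y in (n : ℝ)..n + 1, |V y| := h2
  linarith

end ShortRange
end Bounds
end StepKdV
end

noncomputable section
namespace StepKdV

/-! ### Limits of differentiable functions with locally bounded derivatives -/

section LimitLemmas

variable {y g : ℕ → ℝ → ℂ} {Y G : ℝ → ℂ}

/-- A common local Lipschitz bound passes to the pointwise limit. -/
theorem continuous_of_tendsto_of_deriv_bound (hy : ∀ n t, HasDerivAt (y n) (g n t) t)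
    (hb : ∀ τ : ℝ, ∃ M : ℝ, ∀ n t, |t| ≤ τ → ‖g n t‖ ≤ M)
    (hY : ∀ t, Tendsto (fun n => y n t) atTop (𝓝 (Y t))) : Continuous Y := by
  refine continuous_iff_continuousAt.2 fun t₀ => ?_
  obtain ⟨M, hM⟩ := hb (|t₀| + 1)
  have hball : ∀ t ∈ Metric.ball t₀ 1, |t| ≤ |t₀| + 1 := fun t ht => by
    have h1 : |t - t₀| < 1 := by simpa [Real.dist_eq] using ht
    have := abs_add_le (t - t₀) t₀
    rw [sub_add_cancel] at this
    linarith
  have hlip : ∀ t ∈ Metric.ball t₀ 1, ‖Y t - Y t₀‖ ≤ M * ‖t - t₀‖ := fun t ht =>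
    le_of_tendsto ((hY t).sub (hY t₀)).norm (Eventually.of_forall fun n =>
      (convex_ball t₀ 1).norm_image_sub_le_of_norm_hasDerivWithin_le
        (fun s hs => (hy n s).hasDerivWithinAt) (fun s hs => hM n s (hball s hs))
        (Metric.mem_ball_self one_pos) ht)
  rw [ContinuousAt, tendsto_iff_norm_sub_tendsto_zero]
  have hlim : Tendsto (fun t => M * ‖t - t₀‖) (𝓝 t₀) (𝓝 0) := by
    have : Continuous fun t : ℝ => M * ‖t - t₀‖ := by fun_prop
    simpa using this.tendsto t₀
  refine squeeze_zero' (Eventually.of_forall fun _ => norm_nonneg _) ?_ hlim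
  filter_upwards [Metric.ball_mem_nhds t₀ one_pos] with t ht using hlip t ht

/-- Dominated convergence in `y n t = y n 0 + ∫ g n`, followed by the fundamental theorem of
calculus, which needs `G` continuous. -/
theorem hasDerivAt_of_tendsto_of_deriv_bound (hy : ∀ n t, HasDerivAt (y n) (g n t) t)
    (hg : ∀ n, Continuous (g n)) (hb : ∀ τ : ℝ, ∃ M : ℝ, ∀ n t, |t| ≤ τ → ‖g n t‖ ≤ M)
    (hY : ∀ t, Tendsto (fun n => y n t) atTop (𝓝 (Y t)))
    (hG : ∀ t, Tendsto (fun n => g n t) atTop (𝓝 (G t))) (hGc : Continuous G) (t : ℝ) :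
    HasDerivAt Y (G t) t := by
  have key : Y = fun t => Y 0 + ∫ s in (0 : ℝ)..t, G s := by
    funext t
    obtain ⟨M, hM⟩ := hb |t|
    have h1 : Tendsto (fun n => ∫ s in (0 : ℝ)..t, g n s) atTop (𝓝 (∫ s in (0 : ℝ)..t, G s)) := by
      refine intervalIntegral.tendsto_integral_filter_of_dominated_convergence (fun _ => M)
        (Eventually.of_forall fun n => (hg n).aestronglyMeasurable)
        (Eventually.of_forall fun n => Eventually.of_forall fun s hs => hM n s ?_)
        intervalIntegrable_const (Eventually.of_forall fun s _ => hG s)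
      have := Set.abs_sub_left_of_mem_uIcc (Set.uIoc_subset_uIcc hs)
      simpa using this
    have h2 : ∀ n, ∫ s in (0 : ℝ)..t, g n s = y n t - y n 0 := fun n =>
      intervalIntegral.integral_eq_sub_of_hasDerivAt (fun s _ => hy n s)
        ((hg n).intervalIntegrable _ _)
    simp only [h2] at h1
    have h3 := tendsto_nhds_unique h1 ((hY t).sub (hY 0))
    rw [h3]; ring
  rw [key]
  exact (intervalIntegral.integral_hasDerivAt_right (hGc.intervalIntegrable _ _)
    (hGc.stronglyMeasurableAtFilter _ _) hGc.continuousAt).const_add (Y 0)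

end LimitLemmas

theorem hasDerivAt_integral_mul {w : ℝ → ℂ} {F F' : ℝ → ℝ → ℂ} (hw : Continuous w)
    (hF : Continuous fun p : ℝ × ℝ => F p.1 p.2) (hF' : Continuous fun p : ℝ × ℝ => F' p.1 p.2)
    (hd : ∀ x t, HasDerivAt (fun s => F x s) (F' x t) t) (a b t₀ : ℝ) :
    HasDerivAt (fun t => ∫ x in a..b, w x * F x t) (∫ x in a..b, w x * F' x t₀) t₀ := by
  have hc : ∀ t, Continuous fun x => w x * F x t := fun t =>
    hw.mul (hF.comp (continuous_id.prodMk continuous_const))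
  have hc' : Continuous fun p : ℝ × ℝ => w p.1 * F' p.1 p.2 := by fun_prop
  obtain ⟨B, hB⟩ := ((isCompact_uIcc (a := a) (b := b)).prod
    (isCompact_Icc (a := t₀ - 1) (b := t₀ + 1))).exists_bound_of_continuousOn hc'.continuousOn
  refine (intervalIntegral.hasDerivAt_integral_of_dominated_loc_of_deriv_le
    (F := fun t x => w x * F x t) (F' := fun t x => w x * F' x t) (bound := fun _ => B)
    (Metric.ball_mem_nhds t₀ one_pos) (Eventually.of_forall fun t => (hc t).aestronglyMeasurable)
    ((hc t₀).intervalIntegrable _ _)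
    (hc'.comp (continuous_id.prodMk continuous_const)).aestronglyMeasurable
    (Eventually.of_forall fun x hx t ht => hB (x, t) ⟨Set.uIoc_subset_uIcc hx, ?_⟩)
    intervalIntegrable_const
    (Eventually.of_forall fun x _ t _ => (hd x t).const_mul (w x))).2
  have h1 := abs_lt.1 (show |t - t₀| < 1 by simpa [Real.dist_eq] using ht)
  exact ⟨by linarith [h1.1], by linarith [h1.2]⟩

theorem continuous_integral_mul {w : ℝ → ℂ} {F : ℝ → ℝ → ℂ} (hw : Continuous w)
    (hF : Continuous fun p : ℝ × ℝ => F p.1 p.2) (a b : ℝ) :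
    Continuous fun t => ∫ x in a..b, w x * F x t := by
  refine intervalIntegral.continuous_parametric_intervalIntegral_of_continuous'
    (f := fun t x => w x * F x t) ?_ a b
  have h : Continuous fun p : ℝ × ℝ => F p.2 p.1 := hF.comp continuous_swap
  simp only [Function.uncurry_def]
  fun_prop

/-! ### Time evolution of the Jost solution -/

namespace LaxPotential

variable {a : ℝ} {Q Q₁ Q₂ Q₃ : ℝ → ℝ → ℝ} {k : ℂ}

/-- The `t`-derivative of the pairing `z φ'(0,t) - w φ(0,t)`. -/
def pairingDeriv (a : ℝ) (Q Q₁ Q₂ : ℝ → ℝ → ℝ) (k z w : ℂ) (t : ℝ) : ℂ :=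
  -(Complex.I * k * (4 * k ^ 2 - 6 * a)) *
      (z * jostDeriv (fun x => Q x t) k 0 - w * jost (fun x => Q x t) k 0) -
    (laxP a Q Q₁ (k ^ 2) 0 t z w * jostDeriv (fun x => Q x t) k 0 -
      laxPDeriv a Q Q₁ Q₂ (k ^ 2) 0 t z w * jost (fun x => Q x t) k 0)

set_option maxHeartbeats 1000000 in
-- The pairing is the Wronskian of `φ` with the solution of Cauchy data `(z, w)` at `x = 0`, a limit
-- of averages that can be differentiated in `t`. Continuity comes first and without assumption,
-- because the formula for the derivative contains `φ(0,t)` and `φ'(0,t)`, whose continuity is not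
-- yet known.
theorem pairing (h : LaxPotential a Q Q₁ Q₂ Q₃) (hk : 0 ≤ k.im) (hk0 : k ≠ 0) (z w : ℂ) :
    Continuous (fun t => z * jostDeriv (fun x => Q x t) k 0 - w * jost (fun x => Q x t) k 0) ∧
    (Continuous (pairingDeriv a Q Q₁ Q₂ k z w) → ∀ t,
      HasDerivAt (fun t => z * jostDeriv (fun x => Q x t) k 0 - w * jost (fun x => Q x t) k 0)
        (pairingDeriv a Q Q₁ Q₂ k z w t) t) := by
  obtain ⟨f, g, hfg, cf, cg, hf0, hg0⟩ := exists_solPair h.cont_zero (k ^ 2) z w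
  obtain ⟨c, c', hc, cc, cc', hc0, hc0'⟩ := exists_solPair h.cont_zero (k ^ 2) 1 0
  obtain ⟨s, s', hs, cs, cs', hs0, hs0'⟩ := exists_solPair h.cont_zero (k ^ 2) 0 1
  have q0 := h.cont_zero
  have q1 := h.cont_one
  have q2 := h.cont_two
  have q00 : Continuous fun t => Q 0 t := q0.comp (continuous_const.prodMk continuous_id)
  have q10 : Continuous fun t => Q₁ 0 t := q1.comp (continuous_const.prodMk continuous_id)
  have q20 : Continuous fun t => Q₂ 0 t := q2.comp (continuous_const.prodMk continuous_id)
  set D : ℝ → ℝ → ℂ := fun x t => laxP a Q Q₁ (k ^ 2) x t (f x t) (g x t) -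
      (laxP a Q Q₁ (k ^ 2) 0 t z w * c x t + laxPDeriv a Q Q₁ Q₂ (k ^ 2) 0 t z w * s x t) with hD
  have cL : Continuous fun p : ℝ × ℝ => laxP a Q Q₁ (k ^ 2) p.1 p.2 (f p.1 p.2) (g p.1 p.2) := by
    unfold laxP; fun_prop
  have cL0 : Continuous fun t => laxP a Q Q₁ (k ^ 2) 0 t z w := by unfold laxP; fun_prop
  have cL1 : Continuous fun t => laxPDeriv a Q Q₁ Q₂ (k ^ 2) 0 t z w := by
    unfold laxPDeriv; fun_prop
  have cD : Continuous fun p : ℝ × ℝ => D p.1 p.2 := by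
    have e1 := cL0.comp (continuous_snd (X := ℝ) (Y := ℝ))
    have e2 := cL1.comp (continuous_snd (X := ℝ) (Y := ℝ))
    simp only [Function.comp_def] at e1 e2
    exact cL.sub ((e1.mul cc).add (e2.mul cs))
  have dD : ∀ x t, HasDerivAt (fun r => f x r) (D x t) t := fun x t => by
    have := h.hasDerivAt_time hfg cf (fun t t' => by rw [hf0, hf0]) (fun t t' => by rw [hg0, hg0])
      hc hc0 hc0' hs hs0 hs0' x t
    rwa [hf0, hg0] at this
  have hy : ∀ (n : ℕ) t, HasDerivAt (fun t => average k n (fun x => f x t))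
      (∫ x in (n : ℝ)..n + 1, testFun k n x * D x t) t := fun n t =>
    hasDerivAt_integral_mul (continuous_testFun k n) cf cD dD _ _ t
  have hg : ∀ n : ℕ, Continuous fun t => ∫ x in (n : ℝ)..n + 1, testFun k n x * D x t := fun n =>
    continuous_integral_mul (continuous_testFun k n) cD _ _
  -- In `f_t = P f - (…)` the correction is a combination of `c` and `s`, whose averages converge
  -- like that of `f`; only `P f` produces an error term.
  have hGeq : ∀ (n : ℕ) t, ∫ x in (n : ℝ)..n + 1, testFun k n x * D x t =
      (-(Complex.I * k * (4 * k ^ 2 - 6 * a)) * average k n (fun x => f x t) +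
        ∫ x in (n : ℝ)..n + 1, averageError a (fun x => Q x t) k n (fun x => f x t)
          (fun x => g x t) x) -
      (laxP a Q Q₁ (k ^ 2) 0 t z w * average k n (fun x => c x t) +
        laxPDeriv a Q Q₁ Q₂ (k ^ 2) 0 t z w * average k n (fun x => s x t)) := fun n t => by
    have t0 := continuous_testFun k n
    have t1 : Continuous fun x => laxP a Q Q₁ (k ^ 2) x t (f x t) (g x t) :=
      cL.comp (continuous_id.prodMk continuous_const)
    have t2 := (hc t).continuous_fst
    have t3 := (hs t).continuous_fst
    rw [← h.integral_testFun_laxP (hfg t) n]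
    simp only [average]
    rw [← intervalIntegral.integral_const_mul, ← intervalIntegral.integral_const_mul,
      ← intervalIntegral.integral_add (Continuous.intervalIntegrable (by fun_prop) _ _)
        (Continuous.intervalIntegrable (by fun_prop) _ _),
      ← intervalIntegral.integral_sub (Continuous.intervalIntegrable (by fun_prop) _ _)
        (Continuous.intervalIntegrable (by fun_prop) _ _)]
    refine intervalIntegral.integral_congr fun x _ => ?_
    simp only [hD]
    ring
  obtain ⟨K, hK0, hK⟩ := ShortRange.exists_norm_averageError_le a hk hk0
  have hY : ∀ t, Tendsto (fun n : ℕ => average k n (fun x => f x t)) atTop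
      (𝓝 (z * jostDeriv (fun x => Q x t) k 0 - w * jost (fun x => Q x t) k 0)) := fun t => by
    have := (h.short t).tendsto_average hk hk0 (hfg t)
    rwa [hf0, hg0] at this
  have hcl : ∀ t, Tendsto (fun n : ℕ => average k n (fun x => c x t)) atTop
      (𝓝 (jostDeriv (fun x => Q x t) k 0)) := fun t => by
    have := (h.short t).tendsto_average hk hk0 (hc t)
    rwa [hc0, hc0', one_mul, zero_mul, sub_zero] at this
  have hsl : ∀ t, Tendsto (fun n : ℕ => average k n (fun x => s x t)) atTop
      (𝓝 (-jost (fun x => Q x t) k 0)) := fun t => by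
    have := (h.short t).tendsto_average hk hk0 (hs t)
    rwa [hs0, hs0', one_mul, zero_mul, zero_sub] at this
  have hG : ∀ t, Tendsto (fun n : ℕ => ∫ x in (n : ℝ)..n + 1, testFun k n x * D x t) atTop
      (𝓝 (pairingDeriv a Q Q₁ Q₂ k z w t)) := fun t => by
    simp only [hGeq]
    have herr : Tendsto (fun n : ℕ => ∫ x in (n : ℝ)..n + 1, averageError a (fun x => Q x t) k n
        (fun x => f x t) (fun x => g x t) x) atTop (𝓝 0) := by
      refine squeeze_zero_norm (fun n => hK (h.short t) (hfg t) n) ?_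
      simpa [Function.comp_def] using
        ((ShortRange.tendsto_tail fun x => Q x t).comp tendsto_natCast_atTop_atTop).const_mul
          (K * growthConst (fun x => Q x t) k (fun x => f x t) fun x => g x t)
    have := (((hY t).const_mul (-(Complex.I * k * (4 * k ^ 2 - 6 * a)))).add herr).sub
      (((hcl t).const_mul (laxP a Q Q₁ (k ^ 2) 0 t z w)).add
        ((hsl t).const_mul (laxPDeriv a Q Q₁ Q₂ (k ^ 2) 0 t z w)))
    refine this.trans (le_of_eq ?_)
    congr 1
    unfold pairingDeriv
    ring
  -- All growth constants depend on the time only through `tail` at `0`, which is locally bounded in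
  -- `t`.
  have hb : ∀ τ : ℝ, ∃ M : ℝ, ∀ (n : ℕ) t, |t| ≤ τ →
      ‖∫ x in (n : ℝ)..n + 1, testFun k n x * D x t‖ ≤ M := fun τ => by
    obtain ⟨A, hA⟩ := h.exists_tail_le τ
    obtain ⟨B₀, hB₀⟩ := (isCompact_Icc (a := -τ) (b := τ)).exists_bound_of_continuousOn
      cL0.continuousOn
    obtain ⟨B₁, hB₁⟩ := (isCompact_Icc (a := -τ) (b := τ)).exists_bound_of_continuousOn
      cL1.continuousOn
    have hgc : ∀ t, |t| ≤ τ → ∀ {u v : ℝ → ℂ}, growthConst (fun x => Q x t) k u v ≤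
        Real.exp (A / ‖k‖) * (2 * (‖v 0‖ + ‖k‖ * ‖u 0‖)) := fun t ht u v => by
      unfold growthConst
      have := hA t ht
      gcongr
    set Gf := Real.exp (A / ‖k‖) * (2 * (‖w‖ + ‖k‖ * ‖z‖))
    set Gc := Real.exp (A / ‖k‖) * (2 * (‖(0 : ℂ)‖ + ‖k‖ * ‖(1 : ℂ)‖))
    set Gs := Real.exp (A / ‖k‖) * (2 * (‖(1 : ℂ)‖ + ‖k‖ * ‖(0 : ℂ)‖))
    refine ⟨‖-(Complex.I * k * (4 * k ^ 2 - 6 * a))‖ * Gf + K * Gf * A + (B₀ * Gc + B₁ * Gs),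
      fun n t ht => ?_⟩
    have n0 : (0 : ℝ) ≤ n := Nat.cast_nonneg n
    have b1 : ‖average k n (fun x => f x t)‖ ≤ Gf := by
      have := ((h.short t).norm_average_le hk hk0 (hfg t) n0).trans (hgc t ht)
      rwa [hf0, hg0] at this
    have b2 : ‖average k n (fun x => c x t)‖ ≤ Gc := by
      have := ((h.short t).norm_average_le hk hk0 (hc t) n0).trans (hgc t ht)
      rwa [hc0, hc0'] at this
    have b3 : ‖average k n (fun x => s x t)‖ ≤ Gs := by
      have := ((h.short t).norm_average_le hk hk0 (hs t) n0).trans (hgc t ht)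
      rwa [hs0, hs0'] at this
    have b4 := hK (h.short t) (hfg t) n
    have b5 : growthConst (fun x => Q x t) k (fun x => f x t) (fun x => g x t) ≤ Gf := by
      have := hgc t ht (u := fun x => f x t) (v := fun x => g x t)
      rwa [hf0, hg0] at this
    have b6 : tail (fun x => Q x t) n ≤ A := ((h.short t).tail_antitone n0).trans (hA t ht)
    have b7 := hB₀ t (abs_le.1 ht)
    have b8 := hB₁ t (abs_le.1 ht)
    have b9 := tail_nonneg (fun x => Q x t) n
    have b10 := growthConst_nonneg (fun x => Q x t) k (fun x => f x t) (fun x => g x t)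
    rw [hGeq]
    refine (norm_sub_le _ _).trans (add_le_add ((norm_add_le _ _).trans (add_le_add ?_ ?_))
      ((norm_add_le _ _).trans (add_le_add ?_ ?_)))
    · rw [norm_mul]; gcongr
    · exact b4.trans (by gcongr)
    · rw [norm_mul]
      exact mul_le_mul b7 b2 (norm_nonneg _) ((norm_nonneg _).trans b7)
    · rw [norm_mul]
      exact mul_le_mul b8 b3 (norm_nonneg _) ((norm_nonneg _).trans b8)
  exact ⟨continuous_of_tendsto_of_deriv_bound hy hb hY, fun hGc =>
    hasDerivAt_of_tendsto_of_deriv_bound hy hg hb hY hG hGc⟩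

/-- The right-hand side of the evolution equation of `φ` at `x = 0`. -/
def jostRhs (a : ℝ) (Q Q₁ : ℝ → ℝ → ℝ) (k : ℂ) (t : ℝ) (u v : ℂ) : ℂ :=
  laxP a Q Q₁ (k ^ 2) 0 t u v - Complex.I * (k * (4 * k ^ 2 - 6 * a)) * u

/-- The right-hand side of the evolution equation of `φ'` at `x = 0`. -/
def jostDerivRhs (a : ℝ) (Q Q₁ Q₂ : ℝ → ℝ → ℝ) (k : ℂ) (t : ℝ) (u v : ℂ) : ℂ :=
  laxPDeriv a Q Q₁ Q₂ (k ^ 2) 0 t u v - Complex.I * (k * (4 * k ^ 2 - 6 * a)) * v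

theorem continuous_rhs (h : LaxPotential a Q Q₁ Q₂ Q₃) (k : ℂ) {u v : ℝ → ℂ} (hu : Continuous u)
    (hv : Continuous v) : Continuous (fun t => jostRhs a Q Q₁ k t (u t) (v t)) ∧
      Continuous fun t => jostDerivRhs a Q Q₁ Q₂ k t (u t) (v t) := by
  have q00 : Continuous fun t => Q 0 t := h.cont_zero.comp (continuous_const.prodMk continuous_id)
  have q10 : Continuous fun t => Q₁ 0 t := h.cont_one.comp (continuous_const.prodMk continuous_id)
  have q20 : Continuous fun t => Q₂ 0 t := h.cont_two.comp (continuous_const.prodMk continuous_id)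
  unfold jostRhs jostDerivRhs laxP laxPDeriv
  constructor <;> fun_prop

/-- The data `(0, -1)` and `(1, 0)` extract `φ` and `φ'` from the pairing. -/
theorem continuous_jost_of_ne_zero (h : LaxPotential a Q Q₁ Q₂ Q₃) (hk : 0 ≤ k.im) (hk0 : k ≠ 0) :
    Continuous (fun t => jost (fun x => Q x t) k 0) ∧
      Continuous fun t => jostDeriv (fun x => Q x t) k 0 := by
  have h1 := (h.pairing hk hk0 0 (-1)).1
  have h2 := (h.pairing hk hk0 1 0).1
  simp only [zero_mul, one_mul, neg_mul, sub_zero, zero_sub, neg_neg] at h1 h2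
  exact ⟨h1, h2⟩

/-- Bootstrap: the continuity just obtained makes the candidate derivative continuous, which
releases the second half of `pairing`. -/
theorem hasDerivAt_jost_of_ne_zero (h : LaxPotential a Q Q₁ Q₂ Q₃) (hk : 0 ≤ k.im) (hk0 : k ≠ 0)
    (t : ℝ) :
    HasDerivAt (fun t => jost (fun x => Q x t) k 0)
        (jostRhs a Q Q₁ k t (jost (fun x => Q x t) k 0) (jostDeriv (fun x => Q x t) k 0)) t ∧
      HasDerivAt (fun t => jostDeriv (fun x => Q x t) k 0)
        (jostDerivRhs a Q Q₁ Q₂ k t (jost (fun x => Q x t) k 0)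
          (jostDeriv (fun x => Q x t) k 0)) t := by
  obtain ⟨c1, c2⟩ := h.continuous_jost_of_ne_zero hk hk0
  have c3 := h.continuous_rhs k c1 c2
  have e1 : pairingDeriv a Q Q₁ Q₂ k 0 (-1) = fun t => jostRhs a Q Q₁ k t
      (jost (fun x => Q x t) k 0) (jostDeriv (fun x => Q x t) k 0) := by
    funext t; simp only [pairingDeriv, jostRhs, laxP, laxPDeriv]; ring
  have e2 : pairingDeriv a Q Q₁ Q₂ k 1 0 = fun t => jostDerivRhs a Q Q₁ Q₂ k t
      (jost (fun x => Q x t) k 0) (jostDeriv (fun x => Q x t) k 0) := by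
    funext t; simp only [pairingDeriv, jostDerivRhs, laxP, laxPDeriv]; ring
  have h1 := (h.pairing hk hk0 0 (-1)).2 (by rw [e1]; exact c3.1) t
  have h2 := (h.pairing hk hk0 1 0).2 (by rw [e2]; exact c3.2) t
  rw [e1] at h1
  rw [e2] at h2
  simp only [zero_mul, one_mul, neg_mul, sub_zero, zero_sub, neg_neg] at h1 h2
  exact ⟨h1, h2⟩

theorem norm_rhs_le (h : LaxPotential a Q Q₁ Q₂ Q₃) (τ L C : ℝ) : ∃ M, ∀ t, |t| ≤ τ →
    ∀ k u v : ℂ, ‖k‖ ≤ L → ‖u‖ ≤ C → ‖v‖ ≤ C →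
      ‖jostRhs a Q Q₁ k t u v‖ ≤ M ∧ ‖jostDerivRhs a Q Q₁ Q₂ k t u v‖ ≤ M := by
  have q00 : Continuous fun t => Q 0 t := h.cont_zero.comp (continuous_const.prodMk continuous_id)
  have q10 : Continuous fun t => Q₁ 0 t := h.cont_one.comp (continuous_const.prodMk continuous_id)
  have q20 : Continuous fun t => Q₂ 0 t := h.cont_two.comp (continuous_const.prodMk continuous_id)
  have hcomp := (isCompact_Icc (a := -τ) (b := τ)).prod ((isCompact_closedBall (0 : ℂ) L).prod
    ((isCompact_closedBall (0 : ℂ) C).prod (isCompact_closedBall (0 : ℂ) C)))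
  have c1 : Continuous fun p : ℝ × ℂ × ℂ × ℂ => jostRhs a Q Q₁ p.2.1 p.1 p.2.2.1 p.2.2.2 := by
    unfold jostRhs laxP; fun_prop
  have c2 : Continuous fun p : ℝ × ℂ × ℂ × ℂ => jostDerivRhs a Q Q₁ Q₂ p.2.1 p.1 p.2.2.1 p.2.2.2 := by
    unfold jostDerivRhs laxPDeriv; fun_prop
  obtain ⟨M₁, h₁⟩ := hcomp.exists_bound_of_continuousOn c1.continuousOn
  obtain ⟨M₂, h₂⟩ := hcomp.exists_bound_of_continuousOn c2.continuousOn
  refine ⟨max M₁ M₂, fun t ht k u v hk hu hv => ?_⟩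
  have hm : ((t, k, u, v) : ℝ × ℂ × ℂ × ℂ) ∈ Set.Icc (-τ) τ ×ˢ Metric.closedBall (0 : ℂ) L ×ˢ
      Metric.closedBall (0 : ℂ) C ×ˢ Metric.closedBall (0 : ℂ) C :=
    ⟨abs_le.1 ht, by simpa using hk, by simpa using hu, by simpa using hv⟩
  exact ⟨(h₁ _ hm).trans (le_max_left _ _), (h₂ _ hm).trans (le_max_right _ _)⟩

theorem continuous_jostRhs (a : ℝ) (Q Q₁ : ℝ → ℝ → ℝ) (t : ℝ) :
    Continuous fun p : ℂ × ℂ × ℂ => jostRhs a Q Q₁ p.1 t p.2.1 p.2.2 := by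
  unfold jostRhs laxP; fun_prop

theorem continuous_jostDerivRhs (a : ℝ) (Q Q₁ Q₂ : ℝ → ℝ → ℝ) (t : ℝ) :
    Continuous fun p : ℂ × ℂ × ℂ => jostDerivRhs a Q Q₁ Q₂ p.1 t p.2.1 p.2.2 := by
  unfold jostDerivRhs laxPDeriv; fun_prop

theorem tendsto_rhs (a : ℝ) (Q Q₁ Q₂ : ℝ → ℝ → ℝ) (t : ℝ) {κ u v : ℕ → ℂ} {u₀ v₀ : ℂ} (hκ : Tendsto κ atTop (𝓝 k))
    (hu : Tendsto u atTop (𝓝 u₀)) (hv : Tendsto v atTop (𝓝 v₀)) :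
    Tendsto (fun n => jostRhs a Q Q₁ (κ n) t (u n) (v n)) atTop (𝓝 (jostRhs a Q Q₁ k t u₀ v₀)) ∧
    Tendsto (fun n => jostDerivRhs a Q Q₁ Q₂ (κ n) t (u n) (v n)) atTop
      (𝓝 (jostDerivRhs a Q Q₁ Q₂ k t u₀ v₀)) := by
  have h := hκ.prodMk_nhds (hu.prodMk_nhds hv)
  have h₁ := ((continuous_jostRhs a Q Q₁ t).tendsto (k, u₀, v₀)).comp h
  have h₂ := ((continuous_jostDerivRhs a Q Q₁ Q₂ t).tendsto (k, u₀, v₀)).comp h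
  simp only [Function.comp_def] at h₁ h₂
  exact ⟨h₁, h₂⟩

set_option maxHeartbeats 1000000 in
/-- The evolution of the Jost solution at `x = 0`. -/
theorem hasDerivAt_jost (h : LaxPotential a Q Q₁ Q₂ Q₃) (hk : 0 ≤ k.im) (t : ℝ) :
    HasDerivAt (fun t => jost (fun x => Q x t) k 0)
        (jostRhs a Q Q₁ k t (jost (fun x => Q x t) k 0) (jostDeriv (fun x => Q x t) k 0)) t ∧
      HasDerivAt (fun t => jostDeriv (fun x => Q x t) k 0)
        (jostDerivRhs a Q Q₁ Q₂ k t (jost (fun x => Q x t) k 0)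
          (jostDeriv (fun x => Q x t) k 0)) t := by
  -- The growth bound for general solutions contains `1/‖k‖` and excludes `k = 0`. Approaching `k`
  -- from inside the half-plane avoids this: the bounds for the Jost solution itself, through
  -- `weight` and `tail`, stay uniform along the sequence.
  set κ : ℕ → ℂ := fun n => k + Complex.I * ((1 / ((n : ℝ) + 1) : ℝ) : ℂ) with hκ
  have hpos : ∀ n : ℕ, (0 : ℝ) < 1 / ((n : ℝ) + 1) := fun n => by positivity
  have hκim : ∀ n, 0 < (κ n).im := fun n => by
    have := hpos n
    simp only [hκ, Complex.add_im, Complex.mul_im, Complex.I_re, Complex.I_im, Complex.ofReal_re,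
      Complex.ofReal_im]
    linarith
  have hκ0 : ∀ n, κ n ≠ 0 := fun n hn => by simpa [hn] using hκim n
  have hκlim : Tendsto κ atTop (𝓝[upperClosed] k) := by
    refine tendsto_nhdsWithin_iff.2 ⟨?_, Eventually.of_forall fun n => (hκim n).le⟩
    have := ((Complex.continuous_ofReal.tendsto 0).comp
      tendsto_one_div_add_atTop_nhds_zero_nat).const_mul Complex.I |>.const_add k
    simpa [hκ, Function.comp_def] using this
  have hκle : ∀ n, ‖κ n‖ ≤ ‖k‖ + 1 := fun n => by
    refine (norm_add_le _ _).trans (add_le_add le_rfl ?_)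
    rw [norm_mul, Complex.norm_I, one_mul, Complex.norm_real, Real.norm_eq_abs,
      abs_of_pos (hpos n), div_le_one (by positivity)]
    linarith [(Nat.cast_nonneg n : (0 : ℝ) ≤ n)]
  have l1 : ∀ t, Tendsto (fun n => jost (fun x => Q x t) (κ n) 0) atTop
      (𝓝 (jost (fun x => Q x t) k 0)) := fun t => by
    have := ((h.short t).continuousOn_jostM 0 k hk).tendsto.comp hκlim
    simpa [jost, Function.comp_def] using this
  have hκlim' : Tendsto κ atTop (𝓝 k) := hκlim.mono_right nhdsWithin_le_nhds
  have l2 : ∀ t, Tendsto (fun n => jostDeriv (fun x => Q x t) (κ n) 0) atTop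
      (𝓝 (jostDeriv (fun x => Q x t) k 0)) := fun t => by
    have e1 := ((h.short t).continuousOn_jostM 0 k hk).tendsto.comp hκlim
    have e2 := ((h.short t).continuousOn_jostMDeriv 0 k hk).tendsto.comp hκlim
    have := ((hκlim'.const_mul Complex.I).mul e1).add e2
    simpa [jostDeriv, Function.comp_def] using this
  have d := fun n => h.hasDerivAt_jost_of_ne_zero (hκim n).le (hκ0 n)
  have cn := fun n => h.continuous_jost_of_ne_zero (hκim n).le (hκ0 n)
  have cr := fun n => h.continuous_rhs (κ n) (cn n).1 (cn n).2
  have hb : ∀ τ : ℝ, ∃ M : ℝ, ∀ n t, |t| ≤ τ →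
      ‖jostRhs a Q Q₁ (κ n) t (jost (fun x => Q x t) (κ n) 0)
        (jostDeriv (fun x => Q x t) (κ n) 0)‖ ≤ M ∧
      ‖jostDerivRhs a Q Q₁ Q₂ (κ n) t (jost (fun x => Q x t) (κ n) 0)
        (jostDeriv (fun x => Q x t) (κ n) 0)‖ ≤ M := fun τ => by
    obtain ⟨A, hA⟩ := h.exists_tail_le τ
    obtain ⟨B, hB⟩ := h.exists_weight_le τ
    obtain ⟨M, hM⟩ := h.norm_rhs_le τ (‖k‖ + 1)
      (max (2 * B) ((‖k‖ + 1) * (2 * B) + 2 * (B * A)))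
    refine ⟨M, fun n t ht => hM t ht _ _ _ (hκle n) ?_ ?_⟩
    · have := (h.short t).norm_jost_le (hκim n).le 0
      rw [mul_zero, neg_zero, Real.exp_zero, one_mul] at this
      exact (this.trans (by linarith [hB t ht])).trans (le_max_left _ _)
    · have := (h.short t).norm_jostDeriv_le (hκim n).le 0
      rw [mul_zero, neg_zero, Real.exp_zero, one_mul] at this
      have h1 := hB t ht
      have h2 := hA t ht
      have h3 := tail_nonneg (fun x => Q x t) 0
      have h4 := weight_pos (fun x => Q x t) 0
      have h5 := hκle n
      refine (this.trans ?_).trans (le_max_right _ _)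
      gcongr
      exact h4.le.trans h1
  have hb1 : ∀ τ : ℝ, ∃ M : ℝ, ∀ n t, |t| ≤ τ → ‖jostRhs a Q Q₁ (κ n) t
      (jost (fun x => Q x t) (κ n) 0) (jostDeriv (fun x => Q x t) (κ n) 0)‖ ≤ M := fun τ =>
    (hb τ).imp fun M hM n t ht => (hM n t ht).1
  have hb2 : ∀ τ : ℝ, ∃ M : ℝ, ∀ n t, |t| ≤ τ → ‖jostDerivRhs a Q Q₁ Q₂ (κ n) t
      (jost (fun x => Q x t) (κ n) 0) (jostDeriv (fun x => Q x t) (κ n) 0)‖ ≤ M := fun τ =>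
    (hb τ).imp fun M hM n t ht => (hM n t ht).2
  have c1 : Continuous fun t => jost (fun x => Q x t) k 0 :=
    continuous_of_tendsto_of_deriv_bound (fun n t => (d n t).1) hb1 l1
  have c2 : Continuous fun t => jostDeriv (fun x => Q x t) k 0 :=
    continuous_of_tendsto_of_deriv_bound (fun n t => (d n t).2) hb2 l2
  have c3 := h.continuous_rhs k c1 c2
  have r := fun t => tendsto_rhs a Q Q₁ Q₂ t hκlim' (l1 t) (l2 t)
  exact ⟨hasDerivAt_of_tendsto_of_deriv_bound (fun n t => (d n t).1) (fun n => (cr n).1) hb1 l1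
    (fun t => (r t).1) c3.1 t, hasDerivAt_of_tendsto_of_deriv_bound (fun n t => (d n t).2)
    (fun n => (cr n).2) hb2 l2 (fun t => (r t).2) c3.2 t⟩

end LaxPotential
end StepKdV
end

noncomputable section
namespace StepKdV

/-! ### Solutions of the Korteweg-de Vries equation -/

/-- The `i`-th derivative in `x` of `q(x,t)`. -/
def dx (q : ℝ → ℝ → ℝ) (i : ℕ) (x t : ℝ) : ℝ := iteratedDeriv i (fun y => q y t) x

namespace IsKdVSolution

variable {c : ℝ} {q : ℝ → ℝ → ℝ}

theorem hasDerivAt_dx (hq : IsKdVSolution c q) {i : ℕ} (hi : i < 3) (x t : ℝ) :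
    HasDerivAt (fun y => dx q i y t) (dx q (i + 1) x t) x := by
  have h := (hq.smooth t).differentiable_iteratedDeriv i (by exact_mod_cast hi)
  have := (h x).hasDerivAt
  rwa [← iteratedDeriv_succ] at this

theorem dx_zero (q : ℝ → ℝ → ℝ) : dx q 0 = q := by
  funext x t; simp [dx]

theorem continuous_dx (hq : IsKdVSolution c q) {i : ℕ} (hi : i ≤ 3) :
    Continuous fun p : ℝ × ℝ => dx q i p.1 p.2 := hq.continuous_deriv i hi

theorem continuous_self (hq : IsKdVSolution c q) : Continuous fun p : ℝ × ℝ => q p.1 p.2 := by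
  have := hq.continuous_dx (i := 0) (by norm_num)
  rwa [dx_zero] at this

theorem evolution (hq : IsKdVSolution c q) (x t : ℝ) :
    HasDerivAt (fun s => q x s) (6 * q x t * dx q 1 x t - dx q 3 x t) t := by
  have := hq.kdv x t
  rwa [← iteratedDeriv_one] at this

theorem moment_right (hq : IsKdVSolution c q) (t : ℝ) :
    IntegrableOn (fun y => y * |q y t|) (Set.Ioi 0) ∧
      ∫ y in Set.Ioi 0, y * |q y t| ≤
        ∫ x in Set.Ioi (0 : ℝ), |x| * (|q x t| + |q (-x) t + c ^ 2|) := by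
  have hc : Continuous fun y => q y t := (hq.smooth t).continuous
  have hle : ∀ y ∈ Set.Ioi (0 : ℝ), y * |q y t| ≤ |y| * (|q y t| + |q (-y) t + c ^ 2|) :=
    fun y hy => mul_le_mul (le_abs_self y) (le_add_of_nonneg_right (abs_nonneg _))
      (abs_nonneg _) (abs_nonneg _)
  have hint : IntegrableOn (fun y => y * |q y t|) (Set.Ioi 0) := by
    refine Integrable.mono' (hq.moment_integrable t)
      (by fun_prop : Continuous fun y => y * |q y t|).aestronglyMeasurable ?_
    refine (ae_restrict_iff' measurableSet_Ioi).2 (Eventually.of_forall fun y hy => ?_)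
    rw [Real.norm_eq_abs, abs_of_nonneg (mul_nonneg (le_of_lt hy) (abs_nonneg _))]
    exact hle y hy
  exact ⟨hint, setIntegral_mono_on hint (hq.moment_integrable t) measurableSet_Ioi hle⟩

theorem moment_left (hq : IsKdVSolution c q) (t : ℝ) :
    IntegrableOn (fun y => y * |q (-y) t + c ^ 2|) (Set.Ioi 0) ∧
      ∫ y in Set.Ioi 0, y * |q (-y) t + c ^ 2| ≤
        ∫ x in Set.Ioi (0 : ℝ), |x| * (|q x t| + |q (-x) t + c ^ 2|) := by
  have hc : Continuous fun y => q y t := (hq.smooth t).continuous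
  have hc' : Continuous fun y => q (-y) t := hc.comp continuous_neg
  have hle : ∀ y ∈ Set.Ioi (0 : ℝ), y * |q (-y) t + c ^ 2| ≤
      |y| * (|q y t| + |q (-y) t + c ^ 2|) :=
    fun y hy => mul_le_mul (le_abs_self y) (le_add_of_nonneg_left (abs_nonneg _))
      (abs_nonneg _) (abs_nonneg _)
  have hint : IntegrableOn (fun y => y * |q (-y) t + c ^ 2|) (Set.Ioi 0) := by
    refine Integrable.mono' (hq.moment_integrable t)
      (by fun_prop : Continuous fun y => y * |q (-y) t + c ^ 2|).aestronglyMeasurable ?_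
    refine (ae_restrict_iff' measurableSet_Ioi).2 (Eventually.of_forall fun y hy => ?_)
    rw [Real.norm_eq_abs, abs_of_nonneg (mul_nonneg (le_of_lt hy) (abs_nonneg _))]
    exact hle y hy
  exact ⟨hint, setIntegral_mono_on hint (hq.moment_integrable t) measurableSet_Ioi hle⟩

theorem stepPotential (hq : IsKdVSolution c q) (t : ℝ) : StepPotential c fun x => q x t where
  right := ⟨(hq.smooth t).continuous, (hq.moment_right t).1⟩
  left := ⟨((hq.smooth t).continuous.comp continuous_neg).add continuous_const,
    (hq.moment_left t).1⟩

theorem laxPotential_right (hq : IsKdVSolution c q) :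
    LaxPotential 0 q (dx q 1) (dx q 2) (dx q 3) where
  deriv_zero x t := by simpa only [dx_zero] using hq.hasDerivAt_dx (i := 0) (by norm_num) x t
  deriv_one := hq.hasDerivAt_dx (by norm_num)
  deriv_two := hq.hasDerivAt_dx (by norm_num)
  cont_zero := hq.continuous_self
  cont_one := hq.continuous_dx (by norm_num)
  cont_two := hq.continuous_dx (by norm_num)
  cont_three := hq.continuous_dx (by norm_num)
  evolution x t := by simpa only [sub_zero] using hq.evolution x t
  short t := (hq.stepPotential t).right
  bound τ := by
    obtain ⟨M, hM⟩ := hq.moment_bounded τ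
    exact ⟨M, fun t ht => (hq.moment_right t).2.trans (hM t ht)⟩

theorem continuous_comp_neg_neg {F : ℝ → ℝ → ℝ} (h : Continuous fun p : ℝ × ℝ => F p.1 p.2) :
    Continuous fun p : ℝ × ℝ => F (-p.1) (-p.2) :=
  h.comp (f := fun p : ℝ × ℝ => (-p.1, -p.2)) (by fun_prop)

/-- The Korteweg-de Vries equation is invariant under `(x, t) ↦ (-x, -t)`. Adding `c²` changes
`6QQ_x` into `6(Q - c²)Q_x`, the reason for the parameter `a`. -/
theorem laxPotential_left (hq : IsKdVSolution c q) :
    LaxPotential (c ^ 2) (fun x t => q (-x) (-t) + c ^ 2) (fun x t => -dx q 1 (-x) (-t))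
      (fun x t => dx q 2 (-x) (-t)) (fun x t => -dx q 3 (-x) (-t)) where
  deriv_zero x t := (((hq.laxPotential_right.deriv_zero (-x) (-t)).scomp x
    (hasDerivAt_neg x)).add_const _).congr_deriv (by simp)
  deriv_one x t := ((hq.laxPotential_right.deriv_one (-x) (-t)).scomp x
    (hasDerivAt_neg x)).neg.congr_deriv (by simp)
  deriv_two x t := ((hq.laxPotential_right.deriv_two (-x) (-t)).scomp x
    (hasDerivAt_neg x)).congr_deriv (by simp)
  cont_zero := (continuous_comp_neg_neg hq.continuous_self).add continuous_const
  cont_one := (continuous_comp_neg_neg (hq.continuous_dx (i := 1) (by norm_num))).neg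
  cont_two := continuous_comp_neg_neg (hq.continuous_dx (i := 2) (by norm_num))
  cont_three := (continuous_comp_neg_neg (hq.continuous_dx (i := 3) (by norm_num))).neg
  evolution x t := (((hq.evolution (-x) (-t)).scomp t (hasDerivAt_neg t)).add_const _).congr_deriv
    (by simp; ring)
  short t := (hq.stepPotential (-t)).left
  bound τ := by
    obtain ⟨M, hM⟩ := hq.moment_bounded τ
    exact ⟨M, fun t ht => (hq.moment_left (-t)).2.trans (hM (-t) (by rwa [abs_neg]))⟩

end IsKdVSolution

/-! ### The evolution of the data at `x = 0` -/

/-- `(u, v)` solves the `t`-part of the Lax pair at `x = 0`, shifted by `α`. -/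
structure LaxFlow (q : ℝ → ℝ → ℝ) (E α : ℂ) (u v : ℝ → ℂ) : Prop where
  fst : ∀ t, HasDerivAt u (laxP 0 q (dx q 1) E 0 t (u t) (v t) + α * u t) t
  snd : ∀ t, HasDerivAt v (laxPDeriv 0 q (dx q 1) (dx q 2) E 0 t (u t) (v t) + α * v t) t

namespace LaxFlow

variable {q : ℝ → ℝ → ℝ} {E α β : ℂ} {u v u₁ v₁ u₂ v₂ : ℝ → ℂ}

/-- The matrix of the unshifted `t`-part has trace zero, so only the shifts `α` and `β` drive the
Wronskian. -/
theorem wronskian (h₁ : LaxFlow q E α u₁ v₁) (h₂ : LaxFlow q E β u₂ v₂) (t : ℝ) :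
    u₁ t * v₂ t - v₁ t * u₂ t = Complex.exp ((α + β) * t) * (u₁ 0 * v₂ 0 - v₁ 0 * u₂ 0) := by
  have hd : ∀ t, HasDerivAt (fun t : ℝ => Complex.exp (-(α + β) * t) *
      (u₁ t * v₂ t - v₁ t * u₂ t)) 0 t := fun t => by
    refine ((hasDerivAt_exp_mul (-(α + β)) t).mul (((h₁.fst t).mul (h₂.snd t)).sub
      ((h₁.snd t).mul (h₂.fst t)))).congr_deriv ?_
    simp only [laxP, laxPDeriv, Pi.sub_apply, Pi.mul_apply]
    ring
  have h := is_const_of_deriv_eq_zero (fun t => (hd t).differentiableAt) (fun t => (hd t).deriv) t 0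
  simp only [Complex.ofReal_zero, mul_zero, Complex.exp_zero, one_mul] at h
  rw [← h, ← mul_assoc, ← Complex.exp_add, neg_mul, add_neg_cancel, Complex.exp_zero, one_mul]

theorem mul_exp (h : LaxFlow q E α u v) (β : ℂ) : LaxFlow q E (α + β)
    (fun t => Complex.exp (β * t) * u t) (fun t => Complex.exp (β * t) * v t) where
  fst t := ((hasDerivAt_exp_mul β t).mul (h.fst t)).congr_deriv (by simp only [laxP]; ring)
  snd t := ((hasDerivAt_exp_mul β t).mul (h.snd t)).congr_deriv (by simp only [laxPDeriv]; ring)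

theorem lincomb (h₁ : LaxFlow q E α u₁ v₁) (h₂ : LaxFlow q E α u₂ v₂) (a b : ℂ) :
    LaxFlow q E α (fun t => a * u₁ t + b * u₂ t) (fun t => a * v₁ t + b * v₂ t) where
  fst t := (((h₁.fst t).const_mul a).add ((h₂.fst t).const_mul b)).congr_deriv
    (by simp only [laxP]; ring)
  snd t := (((h₁.snd t).const_mul a).add ((h₂.snd t).const_mul b)).congr_deriv
    (by simp only [laxPDeriv]; ring)

theorem conj (h : LaxFlow q E α u v) : LaxFlow q ((starRingEnd ℂ) E) ((starRingEnd ℂ) α)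
    (fun t => (starRingEnd ℂ) (u t)) (fun t => (starRingEnd ℂ) (v t)) where
  fst t := (h.fst t).star.congr_deriv (by simp [laxP])
  snd t := (h.snd t).star.congr_deriv (by simp [laxPDeriv])

theorem exists_flow (h0 : Continuous fun t => q 0 t) (h1 : Continuous fun t => dx q 1 0 t)
    (h2 : Continuous fun t => dx q 2 0 t) (E z w : ℂ) :
    ∃ u v : ℝ → ℂ, LaxFlow q E 0 u v ∧ u 0 = z ∧ v 0 = w := by
  let F := ContinuousLinearMap.fst ℝ ℂ ℂ
  let S := ContinuousLinearMap.snd ℝ ℂ ℂ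
  let L := ContinuousLinearMap.inl ℝ ℂ ℂ
  let R := ContinuousLinearMap.inr ℝ ℂ ℂ
  -- Here `t` is the variable of the linear equation, and the second argument is a dummy parameter.
  let A : ℝ → ℝ → ℂ × ℂ →L[ℝ] ℂ × ℂ := fun t _ =>
    (2 * (q 0 t : ℂ) + 4 * E) • L.comp S - (dx q 1 0 t : ℂ) • L.comp F +
      ((dx q 1 0 t : ℂ) • R.comp S +
        ((2 * (q 0 t : ℂ) + 4 * E) * (q 0 t - E) - dx q 2 0 t) • R.comp F)
  have hA : Continuous fun p : ℝ × ℝ => A p.1 p.2 := by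
    have e0 := h0.comp (continuous_fst (X := ℝ) (Y := ℝ))
    have e1 := h1.comp (continuous_fst (X := ℝ) (Y := ℝ))
    have e2 := h2.comp (continuous_fst (X := ℝ) (Y := ℝ))
    simp only [Function.comp_def] at e0 e1 e2
    simp only [A]
    fun_prop
  obtain ⟨Y, -, hY2, hY3⟩ := exists_linear_solution (z, w) hA
  refine ⟨fun t => (Y t 0).1, fun t => (Y t 0).2, ⟨fun t => ?_, fun t => ?_⟩, by simp [hY2],
    by simp [hY2]⟩
  · have h := F.hasFDerivAt.comp_hasDerivAt t (hY3 t 0)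
    exact h.congr_deriv (by simp [A, F, S, L, R, laxP])
  · have h := S.hasFDerivAt.comp_hasDerivAt t (hY3 t 0)
    exact h.congr_deriv (by simp [A, F, S, L, R, laxPDeriv])

theorem eq_zero (h0 : Continuous fun t => q 0 t) (h1 : Continuous fun t => dx q 1 0 t)
    (h2 : Continuous fun t => dx q 2 0 t) (h : LaxFlow q E α u v) (hu : u 0 = 0) (hv : v 0 = 0)
    (t : ℝ) : u t = 0 ∧ v t = 0 := by
  obtain ⟨a, a', ha, a0, a0'⟩ := exists_flow h0 h1 h2 E 1 0
  obtain ⟨b, b', hb, b0, b0'⟩ := exists_flow h0 h1 h2 E 0 1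
  have e1 := ha.wronskian h t
  have e2 := hb.wronskian h t
  have e3 := ha.wronskian hb t
  simp only [a0, a0', b0, b0', hu, hv, mul_zero, zero_mul, sub_zero, add_zero, mul_one,
    Complex.exp_zero] at e1 e2 e3
  constructor
  · linear_combination (b t) * e1 - (a t) * e2 - (u t) * e3
  · linear_combination (b' t) * e1 - (a' t) * e2 - (v t) * e3

end LaxFlow

/-- The exponent `-4 i k³` of the right Jost solution. -/
def rightExponent (c : ℝ) (k₁ : ℂ) : ℂ := -(Complex.I * (4 * kOf c k₁ ^ 3))

/-- The exponent `i (4 k₁³ - 6 c² k₁)` of the left Jost solution. -/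
def leftExponent (c : ℝ) (k₁ : ℂ) : ℂ := Complex.I * (4 * k₁ ^ 3 - 6 * c ^ 2 * k₁)

namespace IsKdVSolution

variable {c : ℝ} {q : ℝ → ℝ → ℝ} {k₁ : ℂ}

theorem laxFlow_right (hq : IsKdVSolution c q) (hk : 0 ≤ k₁.im) :
    LaxFlow q (k₁ ^ 2 - c ^ 2) (rightExponent c k₁) (fun t => jost (fun x => q x t) (kOf c k₁) 0)
      (fun t => jostDeriv (fun x => q x t) (kOf c k₁) 0) := by
  have h := hq.laxPotential_right.hasDerivAt_jost (kOf_im_nonneg c hk)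
  rw [← kOf_sq]
  exact ⟨fun t => (h t).1.congr_deriv (by
      simp only [LaxPotential.jostRhs, rightExponent, Complex.ofReal_zero]; ring),
    fun t => (h t).2.congr_deriv (by
      simp only [LaxPotential.jostDerivRhs, rightExponent, Complex.ofReal_zero]; ring)⟩

/-- Undoing the time reversal changes the sign of the exponent `-ik₁(4k₁² - 6c²)`, while the shift
by `c²` restores the operator `P` for `q` at energy `k₁² - c²`. -/
theorem laxFlow_left (hq : IsKdVSolution c q) (hk : 0 ≤ k₁.im) :
    LaxFlow q (k₁ ^ 2 - c ^ 2) (leftExponent c k₁) (fun t => leftJost (fun x => q x t) c k₁ 0)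
      (fun t => leftJostDeriv (fun x => q x t) c k₁ 0) := by
  have h := hq.laxPotential_left.hasDerivAt_jost hk
  have e : ∀ t, (fun x => q (-x) t + c ^ 2) = reflected c fun x => q x t := fun t => rfl
  refine ⟨fun t => ?_, fun t => ?_⟩
  · have h1 := (h (-t)).1.scomp t (hasDerivAt_neg t)
    simp only [Function.comp_def, neg_neg, e] at h1
    simp only [leftJost, leftJostDeriv, neg_zero]
    refine h1.congr_deriv ?_
    simp only [LaxPotential.jostRhs, leftExponent, laxP, neg_zero, neg_neg, Complex.ofReal_add,
      Complex.ofReal_pow, Complex.ofReal_neg, neg_smul, one_smul, Complex.ofReal_zero]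
    ring
  · have h1 := ((h (-t)).2.scomp t (hasDerivAt_neg t)).neg
    simp only [Function.comp_def, neg_neg, e] at h1
    simp only [leftJost, leftJostDeriv, neg_zero]
    refine HasDerivAt.congr_deriv (f' := _) h1 ?_
    simp only [LaxPotential.jostDerivRhs, leftExponent, laxPDeriv, neg_zero, neg_neg,
      Complex.ofReal_add, Complex.ofReal_pow, Complex.ofReal_neg, neg_smul, one_smul,
      Complex.ofReal_zero]
    ring

theorem wronskian_time (hq : IsKdVSolution c q) (hk : 0 ≤ k₁.im) (t : ℝ) :
    jostWronskian (fun x => q x t) c k₁ =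
      Complex.exp ((leftExponent c k₁ + rightExponent c k₁) * t) *
        jostWronskian (fun x => q x 0) c k₁ := by
  rw [(hq.stepPotential t).wronskian_eq hk 0, (hq.stepPotential 0).wronskian_eq hk 0]
  exact (hq.laxFlow_left hk).wronskian (hq.laxFlow_right hk) t

theorem wronskian_eq_zero_iff (hq : IsKdVSolution c q) (hk : 0 ≤ k₁.im) (t : ℝ) :
    jostWronskian (fun x => q x t) c k₁ = 0 ↔ jostWronskian (fun x => q x 0) c k₁ = 0 := by
  rw [hq.wronskian_time hk t, mul_eq_zero, or_iff_right (Complex.exp_ne_zero _)]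

theorem leftTransmission_time (hq : IsKdVSolution c q) (hk : 0 ≤ k₁.im) (t : ℝ) :
    leftTransmission (fun x => q x t) c k₁ =
      Complex.exp (-((leftExponent c k₁ + rightExponent c k₁) * t)) *
        leftTransmission (fun x => q x 0) c k₁ := by
  rw [leftTransmission, leftTransmission, hq.wronskian_time hk t, Complex.exp_neg, div_mul_eq_div_div,
    div_right_comm, div_eq_inv_mul]

/-- By the scattering relation `2is R₁` is `T₁` times the Wronskian of `φ` and `conj φ₁`. The latter
flows with exponent `-leftExponent`, which is imaginary for real `s`. At `s = 0` both sides equal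
`-1`. -/
theorem leftReflection_time (hq : IsKdVSolution c q) {s : ℝ}
    (hW : jostWronskian (fun x => q x 0) c s ≠ 0) (t : ℝ) :
    leftReflection (fun x => q x t) c s =
      Complex.exp (-2 * leftExponent c s * t) * leftReflection (fun x => q x 0) c s := by
  have him : 0 ≤ (s : ℂ).im := by simp
  have hWt : ∀ t, jostWronskian (fun x => q x t) c s ≠ 0 := fun t =>
    (hq.wronskian_eq_zero_iff him t).not.2 hW
  by_cases hs : s = 0
  · subst hs
    rw [(hq.stepPotential t).leftReflection_zero (hWt t),
      (hq.stepPotential 0).leftReflection_zero (hWt 0)]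
    simp [leftExponent]
  · have hne : (2 * Complex.I * s : ℂ) ≠ 0 :=
      mul_ne_zero (mul_ne_zero two_ne_zero Complex.I_ne_zero) (by exact_mod_cast hs)
    have key : ∀ t, (2 * Complex.I * s) * leftReflection (fun x => q x t) c s =
        leftTransmission (fun x => q x t) c s *
          (jost (fun x => q x t) (kOf c s) 0 *
            (starRingEnd ℂ) (leftJostDeriv (fun x => q x t) c s 0) -
          jostDeriv (fun x => q x t) (kOf c s) 0 *
            (starRingEnd ℂ) (leftJost (fun x => q x t) c s 0)) := fun t => by
      obtain ⟨h1, h2⟩ := (hq.stepPotential t).scattering_relation (hWt t) 0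
      have h3 := (hq.stepPotential t).wronskian_leftJost_conj s 0
      linear_combination (-leftReflection (fun x => q x t) c s) * h3 -
        ((starRingEnd ℂ) (leftJostDeriv (fun x => q x t) c s 0)) * h1 +
        ((starRingEnd ℂ) (leftJost (fun x => q x t) c s 0)) * h2
    have hconj := (hq.laxFlow_left him).conj
    rw [show (starRingEnd ℂ) ((s : ℂ) ^ 2 - (c : ℂ) ^ 2) = (s : ℂ) ^ 2 - (c : ℂ) ^ 2 by simp] at hconj
    have hw := (hq.laxFlow_right him).wronskian hconj t
    have hle : (starRingEnd ℂ) (leftExponent c s) = -leftExponent c s := by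
      simp [leftExponent, Complex.conj_ofNat]
    refine mul_left_cancel₀ hne ?_
    rw [key t, hw, hq.leftTransmission_time him t, hle,
      show Complex.exp (-2 * leftExponent c s * t) =
        Complex.exp (-((leftExponent c s + rightExponent c s) * t)) *
          Complex.exp ((rightExponent c s + -leftExponent c s) * t) by
        rw [← Complex.exp_add]; congr 1; ring]
    linear_combination (-(Complex.exp (-((leftExponent c s + rightExponent c s) * t)) *
      Complex.exp ((rightExponent c s + -leftExponent c s) * t))) * key 0

/-- An exponential factor gives `φ₁` the same shift as `φ`. Uniqueness in `t` at `x = 0` preserves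
the relation of their Cauchy data, and uniqueness in `x` extends it to all positions. -/
theorem proportional_time (hq : IsKdVSolution c q) (hk : 0 ≤ k₁.im) {μ : ℂ}
    (hμ : ∀ x, jost (fun x => q x 0) (kOf c k₁) x = μ * leftJost (fun x => q x 0) c k₁ x ∧
      jostDeriv (fun x => q x 0) (kOf c k₁) x = μ * leftJostDeriv (fun x => q x 0) c k₁ x)
    (t x : ℝ) :
    jost (fun x => q x t) (kOf c k₁) x = Complex.exp ((rightExponent c k₁ - leftExponent c k₁) * t) *
        μ * leftJost (fun x => q x t) c k₁ x := by
  have hR := hq.laxFlow_right hk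
  have hL := (hq.laxFlow_left hk).mul_exp (rightExponent c k₁ - leftExponent c k₁)
  rw [add_sub_cancel] at hL
  have hpair (i : ℕ) (hi : i ≤ 3) : Continuous fun t => dx q i 0 t :=
    (hq.continuous_dx hi).comp (continuous_const.prodMk continuous_id)
  have h0 := hpair 0 (by norm_num)
  rw [dx_zero] at h0
  have h1 := (hR.lincomb hL 1 (-μ)).eq_zero h0 (hpair 1 (by norm_num)) (hpair 2 (by norm_num))
    (by simp [(hμ 0).1]) (by simp [(hμ 0).2]) t
  set e := Complex.exp ((rightExponent c k₁ - leftExponent c k₁) * t)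
  have hs := (hq.stepPotential t)
  have h2 := ((hs.solPair_right hk).lincomb (hs.solPair_left hk) 1 (-(e * μ))).eq_zero
    hs.right.cont (by linear_combination h1.1) (by linear_combination h1.2) x
  linear_combination h2.1

end IsKdVSolution
end StepKdV
end

noncomputable section
namespace StepKdV

/-! ### Removing poles in small discs -/

/-- The principal parts `C_j / (k - i κ_j)`, each one cut off to its disc. -/
def poleSum {N : ℕ} (ε : ℝ) (κ : Fin N → ℝ) (C : Fin N → ℂ) (k : ℂ) : ℂ :=
  ∑ j, if ‖k - Complex.I * κ j‖ < ε then C j / (k - Complex.I * κ j) else 0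

/-- `A` with its principal parts removed in the discs. -/
def corrected {N : ℕ} (ε : ℝ) (κ : Fin N → ℝ) (C : Fin N → ℂ) (A B : ℂ → ℂ) (k : ℂ) : ℂ :=
  A k - poleSum ε κ C k * B k

open Classical in
/-- `corrected`, with the limiting values at the centres. -/
def regularized {N : ℕ} (ε : ℝ) (κ : Fin N → ℝ) (C : Fin N → ℂ) (A B : ℂ → ℂ) (k : ℂ) : ℂ :=
  if ∃ j, k = Complex.I * κ j then limUnder (𝓝[≠] k) (corrected ε κ C A B)
  else corrected ε κ C A B k

/-- `A` and `B` are holomorphic in the upper half-plane, up to simple poles of `A` at `i κ_j` with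
residues `C_j B(i κ_j)`. -/
structure PoleData {N : ℕ} (ε : ℝ) (κ : Fin N → ℝ) (C : Fin N → ℂ) (A B : ℂ → ℂ) : Prop where
  pos : 0 < ε
  lower : ∀ j, 4 * ε < κ j
  separated : ∀ i j, i ≠ j → 4 * ε < |κ i - κ j|
  differentiableAt_fst : ∀ k : ℂ, 0 < k.im → (∀ j, k ≠ Complex.I * κ j) → DifferentiableAt ℂ A k
  differentiableAt_snd : ∀ k : ℂ, 0 < k.im → DifferentiableAt ℂ B k
  residue : ∀ j, Tendsto (fun k => (k - Complex.I * κ j) * A k) (𝓝[≠] (Complex.I * κ j))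
    (𝓝 (C j * B (Complex.I * κ j)))

theorem norm_I_mul_sub (a b : ℝ) : ‖Complex.I * (a : ℂ) - Complex.I * b‖ = |a - b| := by
  rw [← mul_sub, norm_mul, Complex.norm_I, one_mul, ← Complex.ofReal_sub, Complex.norm_real,
    Real.norm_eq_abs]

theorem sub_im_le_norm (k : ℂ) (a : ℝ) : |k.im - a| ≤ ‖k - Complex.I * a‖ := by
  simpa using Complex.abs_im_le_norm (k - Complex.I * a)

namespace PoleData

variable {N : ℕ} {ε : ℝ} {κ : Fin N → ℝ} {C : Fin N → ℂ} {A B : ℂ → ℂ}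

/-- Centres more than `4ε` apart have disjoint discs of radius `2ε`. The doubled radius makes the
formula usable on both sides of the circle of radius `ε`. -/
theorem poleSum_eq (h : PoleData ε κ C A B) {j : Fin N} {k : ℂ}
    (hk : ‖k - Complex.I * κ j‖ < 2 * ε) :
    poleSum ε κ C k = if ‖k - Complex.I * κ j‖ < ε then C j / (k - Complex.I * κ j) else 0 := by
  refine Finset.sum_eq_single j (fun i _ hij => if_neg ?_) (by simp)
  have h1 := h.separated i j hij
  rw [← norm_I_mul_sub] at h1
  have h2 := norm_sub_le_norm_sub_add_norm_sub (Complex.I * (κ i : ℂ)) k (Complex.I * κ j)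
  rw [norm_sub_rev (Complex.I * (κ i : ℂ)) k] at h2
  have := h.pos
  linarith

/-- All discs lie above height `3ε`, so nothing is corrected near the real line. -/
theorem poleSum_eq_zero (h : PoleData ε κ C A B) {k : ℂ} (hk : k.im < 3 * ε) :
    poleSum ε κ C k = 0 := by
  refine Finset.sum_eq_zero fun j _ => if_neg ?_
  have h1 := neg_le_of_abs_le (sub_im_le_norm k (κ j))
  have h2 := h.lower j
  linarith

theorem differentiableAt_poleSum {k : ℂ} (hc : ∀ j, k ≠ Complex.I * κ j)
    (hs : ∀ j, k ∉ Metric.sphere (Complex.I * (κ j : ℂ)) ε) :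
    DifferentiableAt ℂ (poleSum ε κ C) k := by
  unfold poleSum
  refine DifferentiableAt.fun_sum fun j _ => ?_
  rcases lt_trichotomy ‖k - Complex.I * κ j‖ ε with h | h | h
  · have hd : DifferentiableAt ℂ (fun k => C j / (k - Complex.I * κ j)) k :=
      (differentiableAt_const _).div (by fun_prop) (sub_ne_zero.2 (hc j))
    refine hd.congr_of_eventuallyEq ?_
    have ho : IsOpen {k : ℂ | ‖k - Complex.I * κ j‖ < ε} := isOpen_lt (by fun_prop) (by fun_prop)
    filter_upwards [ho.mem_nhds h] with z hz using if_pos hz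
  · exact absurd (by simpa [dist_eq_norm] using h) (hs j)
  · refine (differentiableAt_const (0 : ℂ)).congr_of_eventuallyEq ?_
    have ho : IsOpen {k : ℂ | ε < ‖k - Complex.I * κ j‖} := isOpen_lt (by fun_prop) (by fun_prop)
    filter_upwards [ho.mem_nhds h] with z hz using if_neg (not_lt.2 (le_of_lt hz))

theorem differentiableAt_corrected (h : PoleData ε κ C A B) {k : ℂ} (hk : 0 < k.im)
    (hc : ∀ j, k ≠ Complex.I * κ j) (hs : ∀ j, k ∉ Metric.sphere (Complex.I * (κ j : ℂ)) ε) :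
    DifferentiableAt ℂ (corrected ε κ C A B) k :=
  (h.differentiableAt_fst k hk hc).sub
    ((differentiableAt_poleSum hc hs).mul (h.differentiableAt_snd k hk))

theorem regularized_of_ne {k : ℂ} (hc : ∀ j, k ≠ Complex.I * κ j) :
    regularized ε κ C A B k = corrected ε κ C A B k :=
  if_neg (by push Not; exact hc)

theorem eventually_ne {k : ℂ} (hc : ∀ j, k ≠ Complex.I * κ j) :
    ∀ᶠ z in 𝓝 k, ∀ j, z ≠ Complex.I * κ j :=
  eventually_all.2 fun j => isOpen_ne.mem_nhds (hc j)

theorem im_pos_of_mem_ball (h : PoleData ε κ C A B) {j : Fin N} {k : ℂ}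
    (hk : ‖k - Complex.I * κ j‖ < 2 * ε) : 0 < k.im := by
  have h1 := neg_le_of_abs_le (sub_im_le_norm k (κ j))
  have h2 := h.lower j
  have h3 := h.pos
  linarith

theorem ne_of_mem_ball (h : PoleData ε κ C A B) {j : Fin N} {k : ℂ}
    (hk : ‖k - Complex.I * κ j‖ < 2 * ε) (hne : k ≠ Complex.I * κ j) (i : Fin N) :
    k ≠ Complex.I * κ i := by
  rintro rfl
  by_cases hij : i = j
  · exact hne (by rw [hij])
  · rw [norm_I_mul_sub] at hk
    linarith [h.separated i j hij, h.pos]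

theorem notMem_sphere_of_mem_ball (h : PoleData ε κ C A B) {j : Fin N} {k : ℂ}
    (hk : ‖k - Complex.I * κ j‖ < ε) (i : Fin N) :
    k ∉ Metric.sphere (Complex.I * (κ i : ℂ)) ε := by
  intro hi
  rw [mem_sphere_iff_norm] at hi
  by_cases hij : i = j
  · subst hij; linarith
  · have h1 := h.separated i j hij
    rw [← norm_I_mul_sub] at h1
    have h2 := norm_sub_le_norm_sub_add_norm_sub (Complex.I * (κ i : ℂ)) k (Complex.I * κ j)
    rw [norm_sub_rev (Complex.I * (κ i : ℂ)) k] at h2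
    linarith [h.pos]

/-- By the residue condition `(k - z)` times the corrected function tends to `C B(z) - C B(z) = 0`;
the singularity is removable and `limUnder` is its holomorphic filling. -/
theorem center (h : PoleData ε κ C A B) (j : Fin N) :
    Tendsto (corrected ε κ C A B) (𝓝[≠] (Complex.I * κ j))
      (𝓝 (regularized ε κ C A B (Complex.I * κ j))) ∧
    DifferentiableAt ℂ (regularized ε κ C A B) (Complex.I * κ j) := by
  set z : ℂ := Complex.I * κ j with hz
  set f := corrected ε κ C A B with hf
  have hball : Metric.ball z ε ∈ 𝓝 z := Metric.ball_mem_nhds z h.pos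
  have hnorm : ∀ k ∈ Metric.ball z ε, ‖k - z‖ < ε := fun k hk => by
    rwa [mem_ball_iff_norm] at hk
  have hnorm2 : ∀ k ∈ Metric.ball z ε, ‖k - z‖ < 2 * ε := fun k hk => by
    linarith [hnorm k hk, h.pos]
  have hd : DifferentiableOn ℂ f (Metric.ball z ε \ {z}) := fun k hk =>
    (h.differentiableAt_corrected (h.im_pos_of_mem_ball (hnorm2 k hk.1))
      (h.ne_of_mem_ball (hnorm2 k hk.1) hk.2)
      (h.notMem_sphere_of_mem_ball (hnorm k hk.1))).differentiableWithinAt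
  have hlim : Tendsto (fun k => (k - z) * f k) (𝓝[≠] z) (𝓝 0) := by
    have hB : Tendsto B (𝓝[≠] z) (𝓝 (B z)) :=
      (h.differentiableAt_snd z (by
        have := h.lower j; have := h.pos; simp [hz]; linarith)).continuousAt.tendsto.mono_left
        nhdsWithin_le_nhds
    have h1 := (h.residue j).sub (hB.const_mul (C j))
    rw [sub_self] at h1
    refine h1.congr' ?_
    filter_upwards [self_mem_nhdsWithin, mem_nhdsWithin_of_mem_nhds hball] with k hk hkb
    have hne : k - z ≠ 0 := sub_ne_zero.2 hk
    rw [hf, corrected, h.poleSum_eq (hnorm2 k hkb), if_pos (hnorm k hkb), ← hz]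
    field_simp
  have ho : (fun k => f k - f z) =o[𝓝[≠] z] fun k => (k - z)⁻¹ := by
    refine Asymptotics.isLittleO_of_tendsto' ?_ ?_
    · filter_upwards [self_mem_nhdsWithin] with k hk h0
      exact absurd h0 (inv_ne_zero (sub_ne_zero.2 hk))
    · have h2 : Tendsto (fun k => (k - z) * f z) (𝓝[≠] z) (𝓝 0) := by
        have : Continuous fun k : ℂ => (k - z) * f z := by fun_prop
        simpa using (this.tendsto z).mono_left nhdsWithin_le_nhds
      have h3 := hlim.sub h2
      rw [sub_zero] at h3
      refine h3.congr fun k => ?_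
      rw [div_inv_eq_mul]; ring
  have hreg : regularized ε κ C A B z = limUnder (𝓝[≠] z) f := if_pos ⟨j, hz⟩
  have hdiff := Complex.differentiableOn_update_limUnder_of_isLittleO hball hd ho
  have ht := Complex.tendsto_limUnder_of_differentiable_on_punctured_nhds_of_isLittleO (f := f)
    (c := z) (by
      filter_upwards [self_mem_nhdsWithin, mem_nhdsWithin_of_mem_nhds hball] with k hk hkb
      exact (hd k ⟨hkb, hk⟩).differentiableAt
        ((Metric.isOpen_ball.sdiff isClosed_singleton).mem_nhds ⟨hkb, hk⟩)) ho
  refine ⟨by rw [hreg]; exact ht, ?_⟩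
  refine (hdiff.differentiableAt hball).congr_of_eventuallyEq ?_
  filter_upwards [hball] with k hk
  by_cases hkz : k = z
  · rw [hkz, Function.update_self, hreg]
  · rw [Function.update_of_ne hkz, regularized_of_ne (h.ne_of_mem_ball (hnorm2 k hk) hkz)]

theorem differentiableAt_regularized (h : PoleData ε κ C A B) {k : ℂ} (hk : 0 < k.im)
    (hs : ∀ j, k ∉ Metric.sphere (Complex.I * (κ j : ℂ)) ε) :
    DifferentiableAt ℂ (regularized ε κ C A B) k := by
  by_cases hc : ∃ j, k = Complex.I * κ j
  · obtain ⟨j, rfl⟩ := hc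
    exact (h.center j).2
  · push Not at hc
    refine (h.differentiableAt_corrected hk hc hs).congr_of_eventuallyEq ?_
    filter_upwards [eventually_ne hc] with z hz using regularized_of_ne hz

/-- `A` and `B` are continuous across the circle, so the two limits differ exactly by the principal
part, which is present only inside. -/
theorem tendsto_sphere (h : PoleData ε κ C A B) {j : Fin N} {k : ℂ}
    (hk : k ∈ Metric.sphere (Complex.I * (κ j : ℂ)) ε) :
    Tendsto (regularized ε κ C A B) (𝓝[Metric.ball (Complex.I * (κ j : ℂ)) ε] k)
      (𝓝 (A k - C j / (k - Complex.I * κ j) * B k)) ∧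
    Tendsto (regularized ε κ C A B) (𝓝[(Metric.closedBall (Complex.I * (κ j : ℂ)) ε)ᶜ] k)
      (𝓝 (A k)) := by
  rw [mem_sphere_iff_norm] at hk
  have hk2 : ‖k - Complex.I * κ j‖ < 2 * ε := by linarith [h.pos]
  have hne : k ≠ Complex.I * κ j := by
    rintro rfl
    rw [sub_self, norm_zero] at hk
    exact h.pos.ne hk
  have hc := h.ne_of_mem_ball hk2 hne
  have him := h.im_pos_of_mem_ball hk2
  have hA := (h.differentiableAt_fst k him hc).continuousAt.tendsto
  have hB := (h.differentiableAt_snd k him).continuousAt.tendsto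
  have ho : {z : ℂ | ‖z - Complex.I * κ j‖ < 2 * ε} ∈ 𝓝 k :=
    (isOpen_lt (by fun_prop) (by fun_prop)).mem_nhds hk2
  constructor
  · have hC : Tendsto (fun z => C j / (z - Complex.I * κ j)) (𝓝 k)
        (𝓝 (C j / (k - Complex.I * κ j))) :=
      (tendsto_const_nhds.div ((by fun_prop : Continuous fun z : ℂ => z - Complex.I * κ j).tendsto k)
        (sub_ne_zero.2 hne))
    refine ((hA.sub (hC.mul hB)).mono_left nhdsWithin_le_nhds).congr' ?_
    filter_upwards [mem_nhdsWithin_of_mem_nhds ho, self_mem_nhdsWithin,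
      mem_nhdsWithin_of_mem_nhds (eventually_ne hc)] with z hz hzb hzc
    rw [regularized_of_ne hzc, corrected, h.poleSum_eq hz, if_pos (by rwa [mem_ball_iff_norm] at hzb)]
  · refine (hA.mono_left nhdsWithin_le_nhds).congr' ?_
    filter_upwards [mem_nhdsWithin_of_mem_nhds ho, self_mem_nhdsWithin,
      mem_nhdsWithin_of_mem_nhds (eventually_ne hc)] with z hz hzb hzc
    rw [Set.mem_compl_iff, mem_closedBall_iff_norm, not_le] at hzb
    rw [regularized_of_ne hzc, corrected, h.poleSum_eq hz, if_neg (not_lt.2 hzb.le), zero_mul,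
      sub_zero]

theorem regularized_eq_of_im_lt (h : PoleData ε κ C A B) {k : ℂ} (hk : k.im < 3 * ε) :
    regularized ε κ C A B k = A k := by
  rw [regularized_of_ne, corrected, h.poleSum_eq_zero hk, zero_mul, sub_zero]
  rintro j rfl
  have h1 := h.lower j
  have h2 := h.pos
  simp at hk
  linarith

theorem tendsto_real (h : PoleData ε κ C A B) {s : ℝ} {a : ℂ}
    (ha : Tendsto A (𝓝[upperOpen] (s : ℂ)) (𝓝 a)) :
    Tendsto (regularized ε κ C A B) (𝓝[upperOpen] (s : ℂ)) (𝓝 a) := by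
  refine ha.congr' ?_
  have ho : {z : ℂ | z.im < 3 * ε} ∈ 𝓝 (s : ℂ) :=
    (isOpen_lt Complex.continuous_im continuous_const).mem_nhds (by simpa using h.pos)
  filter_upwards [mem_nhdsWithin_of_mem_nhds ho] with z hz
  exact (h.regularized_eq_of_im_lt hz).symm

theorem eventually_regularized_eq (h : PoleData ε κ C A B) :
    ∀ᶠ s : ℝ in atTop, regularized ε κ C A B (Complex.I * s) = A (Complex.I * s) := by
  have h1 : ∀ᶠ s : ℝ in atTop, ∀ j, κ j + ε < s := eventually_all.2 fun j => eventually_gt_atTop _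
  filter_upwards [h1] with s hs
  have h2 : ∀ j, ε < ‖Complex.I * (s : ℂ) - Complex.I * κ j‖ := fun j => by
    rw [norm_I_mul_sub, abs_of_pos (by linarith [hs j, h.pos])]
    linarith [hs j]
  rw [regularized_of_ne fun j hj => ?_, corrected, poleSum,
    Finset.sum_eq_zero fun j _ => if_neg (not_lt.2 (h2 j).le), zero_mul, sub_zero]
  have := h2 j
  rw [hj, sub_self, norm_zero] at this
  exact this.not_gt h.pos

end PoleData
end StepKdV
end

noncomputable section
namespace StepKdV

/-! ### The vector function -/

/-- The entry `T₁ φ e^{-i k₁ x}`. -/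
def transmitted (q : ℝ → ℝ) (c x : ℝ) (k₁ : ℂ) : ℂ :=
  leftTransmission q c k₁ * jostRight q c k₁ x * Complex.exp (-Complex.I * k₁ * x)

/-- The entry `φ₁ e^{i k₁ x}`. -/
def incoming (q : ℝ → ℝ) (c x : ℝ) (k₁ : ℂ) : ℂ :=
  jostLeft q c k₁ x * Complex.exp (Complex.I * k₁ * x)

/-- The residue constants `i γ_j² e^{t Φ₁(i κ_j)}`. -/
def residueConst {N : ℕ} (c x t : ℝ) (κ γ : Fin N → ℝ) (j : Fin N) : ℂ :=
  Complex.I * γ j ^ 2 * Complex.exp (t * phase c x t (Complex.I * κ j))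

/-- The factor `e^{-2 leftExponent t}` from the evolution of the data and the factor `e^{-2ik₁x}`
from the normalization of the entries assemble to `e^{tΦ₁}`; `t ≠ 0` is needed because `ξ` contains
`1/t`. -/
theorem mul_phase (c x : ℝ) {t : ℝ} (ht : t ≠ 0) (k : ℂ) :
    t * phase c x t k = -2 * leftExponent c k * t - 2 * Complex.I * k * x := by
  have ht' : (t : ℂ) ≠ 0 := by exact_mod_cast ht
  simp only [phase, leftExponent]
  push_cast
  field_simp
  ring

theorem phase_neg (c x t : ℝ) (k : ℂ) : phase c x t (-k) = -phase c x t k := by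
  simp only [phase]; ring

theorem tendsto_vec {α : Type*} {l : Filter α} {f g : α → ℂ} {a b : ℂ} (hf : Tendsto f l (𝓝 a))
    (hg : Tendsto g l (𝓝 b)) : Tendsto (fun z => ![f z, g z]) l (𝓝 ![a, b]) := by
  refine tendsto_pi_nhds.2 fun i => ?_
  fin_cases i
  · simpa using hf
  · simpa using hg

theorem vecMul_two (a b p q r s : ℂ) :
    Matrix.vecMul ![a, b] !![p, q; r, s] = ![a * p + b * r, a * q + b * s] := by
  ext i
  fin_cases i <;> simp [Matrix.vecMul, dotProduct, Fin.sum_univ_two]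

section Representation

variable {N : ℕ} {q : ℝ → ℝ → ℝ} {c x t ε : ℝ} {κ γ : Fin N → ℝ} {k : ℂ}

theorem leftVector_upper (q : ℝ → ℝ) (hk : 0 < k.im) :
    leftVector q c x k = ![transmitted q c x k, incoming q c x k] := if_pos hk

theorem leftVector_lower (q : ℝ → ℝ) (hk : k.im < 0) :
    leftVector q c x k = ![incoming q c x (-k), transmitted q c x (-k)] := by
  rw [leftVector, if_neg hk.not_gt, if_pos hk, incoming, transmitted]
  simp only [mul_neg, neg_mul, neg_neg]

theorem redefinedVector_upper (hk : 0 < k.im) :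
    redefinedVector q c x t ε κ γ k = ![corrected ε κ (residueConst c x t κ γ)
      (transmitted (fun y => q y t) c x) (incoming (fun y => q y t) c x) k,
      incoming (fun y => q y t) c x k] := by
  rw [redefinedVector, if_pos hk, leftVector_upper _ hk, vecMul_two]
  congr 1
  · simp only [corrected, poleSum, residueConst]; ring
  · simp

/-- In the lower half-plane the vector is the one at `-k` with its entries exchanged. Everything
there, and the symmetry condition, reduces to the upper half-plane. -/
theorem redefinedVector_lower (hk : k.im < 0) :
    redefinedVector q c x t ε κ γ k = ![incoming (fun y => q y t) c x (-k),
      corrected ε κ (residueConst c x t κ γ)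
        (transmitted (fun y => q y t) c x) (incoming (fun y => q y t) c x) (-k)] := by
  have hsum : (∑ j, if ‖k + Complex.I * κ j‖ < ε then
      Complex.I * γ j ^ 2 * Complex.exp (t * phase c x t (Complex.I * κ j))
        / (k + Complex.I * κ j) else 0) = -poleSum ε κ (residueConst c x t κ γ) (-k) := by
    rw [poleSum, ← Finset.sum_neg_distrib]
    refine Finset.sum_congr rfl fun j _ => ?_
    rw [show -k - Complex.I * κ j = -(k + Complex.I * κ j) by ring, norm_neg, div_neg]
    split_ifs <;> simp [residueConst]
  rw [redefinedVector, if_neg hk.not_gt, leftVector_lower _ hk, vecMul_two, hsum]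
  congr 1
  · simp
  · simp only [corrected]; congr 1; ring

theorem rhVector_upper
    (h : PoleData ε κ (residueConst c x t κ γ) (transmitted (fun y => q y t) c x)
      (incoming (fun y => q y t) c x)) (hk : 0 < k.im) :
    rhVector q c x t ε κ γ k = ![regularized ε κ (residueConst c x t κ γ)
      (transmitted (fun y => q y t) c x) (incoming (fun y => q y t) c x) k,
      incoming (fun y => q y t) c x k] := by
  by_cases hc : ∃ j, k = Complex.I * κ j
  · obtain ⟨j, rfl⟩ := hc
    rw [rhVector, if_pos ⟨j, Or.inl rfl⟩]
    have h1 := tendsto_vec (h.center j).1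
      ((h.differentiableAt_snd _ hk).continuousAt.tendsto.mono_left nhdsWithin_le_nhds)
    refine Tendsto.limUnder_eq (h1.congr' ?_)
    filter_upwards [mem_nhdsWithin_of_mem_nhds (isOpen_upperOpen.mem_nhds hk)] with z hz
    exact (redefinedVector_upper hz).symm
  · have hc' : ¬∃ j, k = Complex.I * κ j ∨ k = -(Complex.I * κ j) := by
      rintro ⟨j, hj | hj⟩
      · exact hc ⟨j, hj⟩
      · rw [hj] at hk
        have := h.lower j
        have := h.pos
        simp at hk
        linarith
    push Not at hc
    rw [rhVector, if_neg hc', redefinedVector_upper hk, PoleData.regularized_of_ne hc]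

theorem rhVector_lower
    (h : PoleData ε κ (residueConst c x t κ γ) (transmitted (fun y => q y t) c x)
      (incoming (fun y => q y t) c x)) (hk : k.im < 0) :
    rhVector q c x t ε κ γ k = ![incoming (fun y => q y t) c x (-k),
      regularized ε κ (residueConst c x t κ γ)
        (transmitted (fun y => q y t) c x) (incoming (fun y => q y t) c x) (-k)] := by
  by_cases hc : ∃ j, -k = Complex.I * κ j
  · obtain ⟨j, hj⟩ := hc
    rw [rhVector, if_pos ⟨j, Or.inr (by rw [← hj, neg_neg])⟩]
    have hneg : Tendsto (fun z : ℂ => -z) (𝓝[≠] k) (𝓝[≠] (Complex.I * κ j)) := by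
      rw [← hj]
      refine tendsto_nhdsWithin_iff.2 ⟨continuous_neg.continuousAt.tendsto.mono_left
        nhdsWithin_le_nhds, ?_⟩
      filter_upwards [self_mem_nhdsWithin] with z hz
      simpa using hz
    have hk' : 0 < (Complex.I * (κ j : ℂ)).im := by rw [← hj]; simpa using hk
    have h1 := tendsto_vec ((h.differentiableAt_snd _ hk').continuousAt.tendsto.mono_left
      nhdsWithin_le_nhds |>.comp hneg) ((h.center j).1.comp hneg)
    rw [hj]
    refine Tendsto.limUnder_eq (h1.congr' ?_)
    have ho : IsOpen {z : ℂ | z.im < 0} := isOpen_lt Complex.continuous_im continuous_const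
    filter_upwards [mem_nhdsWithin_of_mem_nhds (ho.mem_nhds hk)] with z hz
    exact (redefinedVector_lower hz).symm
  · have hc' : ¬∃ j, k = Complex.I * κ j ∨ k = -(Complex.I * κ j) := by
      rintro ⟨j, hj | hj⟩
      · rw [hj] at hk
        have := h.lower j
        have := h.pos
        simp at hk
        linarith
      · exact hc ⟨j, by rw [hj, neg_neg]⟩
    push Not at hc
    rw [rhVector, if_neg hc', redefinedVector_lower hk, PoleData.regularized_of_ne hc]

end Representation
end StepKdV
end

/-! ### Boundary values, residues and jumps of the vector function -/

noncomputable section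
namespace StepKdV

theorem SteplikeData.exists_bound {c C₀ : ℝ} {q : ℝ → ℝ} (h : SteplikeData c C₀ q) :
    ∃ B, ∀ x, |q x| ≤ B := by
  have hc : Continuous q := h.smooth.continuous
  obtain ⟨b, hb⟩ := eventually_atTop.1 (h.right_limit.abs.eventually_le_const
    (show |(0 : ℝ)| < 1 by simp))
  obtain ⟨a, ha⟩ := eventually_atBot.1 (h.left_limit.abs.eventually_le_const
    (lt_add_one |-c ^ 2|))
  obtain ⟨M, hM⟩ := (isCompact_Icc (a := a) (b := b)).exists_bound_of_continuousOn hc.continuousOn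
  refine ⟨max M (max 1 (|-c ^ 2| + 1)), fun x => ?_⟩
  by_cases h1 : x ≤ a
  · exact (ha x h1).trans ((le_max_right _ _).trans (le_max_right _ _))
  · by_cases h2 : b ≤ x
    · exact (hb x h2).trans ((le_max_left _ _).trans (le_max_right _ _))
    · exact (hM x ⟨(not_le.1 h1).le, (not_le.1 h2).le⟩).trans (le_max_left _ _)

namespace StepPotential

variable {c x : ℝ} {q : ℝ → ℝ} {k₁ : ℂ}

theorem transmitted_eq (hq : StepPotential c q) (hk : 0 ≤ k₁.im) : transmitted q c x k₁ =
    2 * Complex.I * k₁ / jostWronskian q c k₁ * jost q (kOf c k₁) x *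
      Complex.exp (-Complex.I * k₁ * x) := by
  rw [transmitted, hq.jostRight_eq hk, leftTransmission]

theorem incoming_eq (hq : StepPotential c q) (hk : 0 ≤ k₁.im) :
    incoming q c x k₁ = leftJost q c k₁ x * Complex.exp (Complex.I * k₁ * x) := by
  rw [incoming, hq.jostLeft_eq hk]

theorem differentiableAt_incoming (hq : StepPotential c q) (hk : 0 < k₁.im) :
    DifferentiableAt ℂ (incoming q c x) k₁ := by
  have h1 := (hq.differentiableOn_leftJost x).differentiableAt (isOpen_upperOpen.mem_nhds hk)
  have h2 : DifferentiableAt ℂ (fun k₁ => leftJost q c k₁ x * Complex.exp (Complex.I * k₁ * x)) k₁ :=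
    by fun_prop
  refine h2.congr_of_eventuallyEq ?_
  filter_upwards [isOpen_upperOpen.mem_nhds hk] with z hz
  exact hq.incoming_eq (upperOpen_subset hz)

theorem differentiableAt_transmitted (hq : StepPotential c q) (hk : 0 < k₁.im)
    (hW : jostWronskian q c k₁ ≠ 0) : DifferentiableAt ℂ (transmitted q c x) k₁ := by
  have h1 := (hq.differentiableOn_rightJost x).differentiableAt (isOpen_upperOpen.mem_nhds hk)
  have h2 := hq.differentiableOn_wronskian.differentiableAt (isOpen_upperOpen.mem_nhds hk)
  have h3 : DifferentiableAt ℂ (fun k₁ => 2 * Complex.I * k₁ / jostWronskian q c k₁ *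
      jost q (kOf c k₁) x * Complex.exp (-Complex.I * k₁ * x)) k₁ :=
    (((by fun_prop : DifferentiableAt ℂ (fun k₁ => 2 * Complex.I * k₁) k₁).div h2 hW).mul h1).mul
      (by fun_prop)
  refine h3.congr_of_eventuallyEq ?_
  filter_upwards [isOpen_upperOpen.mem_nhds hk] with z hz
  exact hq.transmitted_eq (upperOpen_subset hz)

theorem tendsto_incoming (hq : StepPotential c q) (s : ℝ) :
    Tendsto (incoming q c x) (𝓝[upperOpen] (s : ℂ)) (𝓝 (incoming q c x s)) := by
  have hs : (s : ℂ) ∈ upperClosed := by simp [upperClosed]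
  have h1 := (hq.continuousOn_leftJost x s hs).tendsto.mono_left
    (nhdsWithin_mono _ upperOpen_subset)
  have h2 : Tendsto (fun k : ℂ => Complex.exp (Complex.I * k * x)) (𝓝[upperOpen] (s : ℂ))
      (𝓝 (Complex.exp (Complex.I * s * x))) :=
    ((by fun_prop : Continuous fun k : ℂ => Complex.exp (Complex.I * k * x)).tendsto _).mono_left
      nhdsWithin_le_nhds
  rw [hq.incoming_eq hs]
  refine (h1.mul h2).congr' ?_
  filter_upwards [self_mem_nhdsWithin] with z hz
  exact (hq.incoming_eq (upperOpen_subset hz)).symm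

theorem tendsto_transmitted (hq : StepPotential c q) {s : ℝ} (hW : jostWronskian q c s ≠ 0) :
    Tendsto (transmitted q c x) (𝓝[upperOpen] (s : ℂ)) (𝓝 (transmitted q c x s)) := by
  have hs : (s : ℂ) ∈ upperClosed := by simp [upperClosed]
  have hle : 𝓝[upperOpen] (s : ℂ) ≤ 𝓝[upperClosed] (s : ℂ) := nhdsWithin_mono _ upperOpen_subset
  have h1 := (hq.continuousOn_rightJost x s hs).tendsto.mono_left hle
  have h0 := (hq.continuousOn_wronskian s hs).tendsto.mono_left hle
  have h2 : Tendsto (fun k : ℂ => Complex.exp (-Complex.I * k * x)) (𝓝[upperOpen] (s : ℂ))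
      (𝓝 (Complex.exp (-Complex.I * s * x))) :=
    ((by fun_prop : Continuous fun k : ℂ => Complex.exp (-Complex.I * k * x)).tendsto _).mono_left
      nhdsWithin_le_nhds
  have h3 : Tendsto (fun k : ℂ => 2 * Complex.I * k) (𝓝[upperOpen] (s : ℂ))
      (𝓝 (2 * Complex.I * s)) :=
    ((by fun_prop : Continuous fun k : ℂ => 2 * Complex.I * k).tendsto _).mono_left
      nhdsWithin_le_nhds
  rw [hq.transmitted_eq hs]
  refine (((h3.div h0 hW).mul h1).mul h2).congr' ?_
  filter_upwards [self_mem_nhdsWithin] with z hz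
  exact (hq.transmitted_eq (upperOpen_subset hz)).symm

theorem leftJost_neg (hq : StepPotential c q) (s y : ℝ) :
    leftJost q c (-s : ℝ) y = (starRingEnd ℂ) (leftJost q c s y) ∧
      leftJostDeriv q c (-s : ℝ) y = (starRingEnd ℂ) (leftJostDeriv q c s y) := by
  have := hq.left.jost_conj (k := (s : ℂ)) (by simp) (-y)
  rw [Complex.conj_ofReal, ← Complex.ofReal_neg] at this
  exact ⟨this.1, by rw [leftJostDeriv, this.2, leftJostDeriv, map_neg]⟩

theorem rightJost_neg (hq : StepPotential c q) (hc : 0 ≤ c) (s y : ℝ) :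
    jost q (kOf c (-s : ℝ)) y = (starRingEnd ℂ) (jost q (kOf c s) y) ∧
      jostDeriv q (kOf c (-s : ℝ)) y = (starRingEnd ℂ) (jostDeriv q (kOf c s) y) := by
  rw [kOf_neg hc]
  exact hq.right.jost_conj (kOf_im_nonneg c (by simp)) y

theorem wronskian_neg (hq : StepPotential c q) (hc : 0 ≤ c) (s : ℝ) :
    jostWronskian q c (-s : ℝ) = (starRingEnd ℂ) (jostWronskian q c s) := by
  rw [hq.wronskian_eq (by simp) 0, hq.wronskian_eq (by simp) 0, (hq.leftJost_neg s 0).1,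
    (hq.leftJost_neg s 0).2, (hq.rightJost_neg hc s 0).1, (hq.rightJost_neg hc s 0).2]
  simp

theorem incoming_neg (hq : StepPotential c q) (s : ℝ) :
    incoming q c x (-s : ℝ) = (starRingEnd ℂ) (incoming q c x s) := by
  rw [hq.incoming_eq (by simp), hq.incoming_eq (by simp), (hq.leftJost_neg s x).1, map_mul,
    ← Complex.exp_conj]
  simp

theorem transmitted_neg (hq : StepPotential c q) (hc : 0 ≤ c) (s : ℝ) :
    transmitted q c x (-s : ℝ) = (starRingEnd ℂ) (transmitted q c x s) := by
  rw [hq.transmitted_eq (by simp), hq.transmitted_eq (by simp), (hq.rightJost_neg hc s x).1,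
    hq.wronskian_neg hc]
  simp [← Complex.exp_conj, Complex.conj_ofNat]

/-- The scattering relation for the entries of the vector function. -/
theorem transmitted_real (hq : StepPotential c q) {s : ℝ} (hW : jostWronskian q c s ≠ 0) :
    transmitted q c x s = (starRingEnd ℂ) (incoming q c x s) +
      leftReflection q c s * Complex.exp (-2 * Complex.I * s * x) * incoming q c x s := by
  have h1 := (hq.scattering_relation hW x).1
  rw [leftTransmission] at h1
  rw [hq.transmitted_eq (by simp), h1, hq.incoming_eq (by simp), map_mul, ← Complex.exp_conj,
    show Complex.exp (-2 * Complex.I * s * x) =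
      Complex.exp (-Complex.I * s * x) * Complex.exp (-Complex.I * s * x) by
      rw [← Complex.exp_add]; congr 1; ring]
  have h2 : Complex.exp (-Complex.I * s * x) * Complex.exp (Complex.I * s * x) = 1 := by
    rw [← Complex.exp_add]; simp
  simp only [map_mul, Complex.conj_I, Complex.conj_ofReal]
  linear_combination (-leftReflection q c s * Complex.exp (-Complex.I * s * x) *
    leftJost q c s x) * h2

end StepPotential

/-! ### Verification of the Riemann–Hilbert problem -/

namespace IsKdVSolution

variable {c x t ε : ℝ} {q : ℝ → ℝ → ℝ} {N : ℕ} {κ : Fin N → ℝ} {k₁ : ℂ}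

/-- Zeros of `W` do not move in time, since `W` only acquires an exponential factor; at time zero
they lie on the imaginary axis and are eigenvalues. -/
theorem wronskian_ne_zero_of_notMem (hq : IsKdVSolution c q) {B : ℝ} (hB : ∀ x, |q x 0| ≤ B)
    (hκ : Set.range κ = leftDiscreteSpectrum (fun x => q x 0) c) (hk : 0 < k₁.im)
    (hne : ∀ j, k₁ ≠ Complex.I * κ j) : jostWronskian (fun x => q x t) c k₁ ≠ 0 := by
  rw [Ne, hq.wronskian_eq_zero_iff hk.le]
  intro hW
  have hre := (hq.stepPotential 0).re_eq_zero_of_wronskian_eq_zero hk hW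
  have hk' : k₁ = Complex.I * (k₁.im : ℂ) := by
    apply Complex.ext <;> simp [hre]
  rw [hk'] at hW
  have hmem := ((hq.stepPotential 0).mem_leftDiscreteSpectrum_iff hB hk).2 hW
  rw [← hκ] at hmem
  obtain ⟨j, hj⟩ := hmem
  exact hne j (by rw [hj]; exact hk')

theorem wronskian_real_ne_zero (hq : IsKdVSolution c q) (hc : 0 < c)
    (hres : jostWronskian (fun x => q x 0) c 0 ≠ 0) (s t : ℝ) :
    jostWronskian (fun x => q x t) c s ≠ 0 := by
  rw [Ne, hq.wronskian_eq_zero_iff (by simp)]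
  by_cases hs : s = 0
  · simpa [hs] using hres
  · exact (hq.stepPotential 0).wronskian_ne_zero_of_real hc hs

theorem sq_leftNorming (hq : StepPotential c fun x => q x 0) {a : ℝ} (ha : 0 ≤ a) :
    leftNorming (fun x => q x 0) c a ^ 2 =
      (∫ x, ‖leftJost (fun x => q x 0) c (Complex.I * a) x‖ ^ 2)⁻¹ := by
  rw [leftNorming, inv_pow, Real.sq_sqrt (integral_nonneg fun _ => by positivity),
    hq.jostLeft_eq (by simpa using ha)]

/-- `T₁` at time `t` is an exponential times `T₁` at time zero, so only the initial derivative `W' =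
2iκ μ ‖φ₁‖²` is needed. `proportional_time` rewrites `φ` through `φ₁` at time `t`. -/
theorem tendsto_residue (hq : IsKdVSolution c q) (ht : t ≠ 0) {a : ℝ} (ha : 0 < a)
    (hW : jostWronskian (fun x => q x 0) c (Complex.I * a) = 0) :
    Tendsto (fun k => (k - Complex.I * a) * transmitted (fun x => q x t) c x k)
      (𝓝[≠] (Complex.I * a)) (𝓝 (Complex.I * leftNorming (fun x => q x 0) c a ^ 2 *
        Complex.exp (t * phase c x t (Complex.I * a)) *
          incoming (fun x => q x t) c x (Complex.I * a))) := by
  set z : ℂ := Complex.I * a with hz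
  have him : 0 < z.im := by simpa [hz] using ha
  have hz0 : z ≠ 0 := fun h0 => by rw [h0] at him; simp at him
  have h0 := hq.stepPotential 0
  have ht' := hq.stepPotential t
  obtain ⟨μ, hμ0, hμ⟩ := h0.exists_proportional him.le hW
  have hI := h0.integral_leftJost_sq_pos him hW
  have hsq := sq_leftNorming h0 ha.le
  rw [← hz] at hsq
  set I₀ := ∫ x, ‖leftJost (fun x => q x 0) c z x‖ ^ 2 with hI₀
  have hI₀' : (I₀ : ℂ) ≠ 0 := by exact_mod_cast hI.ne'
  have hd := h0.hasDerivAt_wronskian ha hμ0 hμ hW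
  rw [← hz, ← hI₀] at hd
  have hd0 : 2 * z * μ * (I₀ : ℂ) ≠ 0 :=
    mul_ne_zero (mul_ne_zero (mul_ne_zero two_ne_zero hz0) hμ0) hI₀'
  have hslope := (hasDerivAt_iff_tendsto_slope.1 hd).inv₀ hd0
  have hnhds : upperOpen ∈ 𝓝 z := isOpen_upperOpen.mem_nhds him
  have hkof : Tendsto (kOf c) (𝓝[≠] z) (𝓝 (kOf c z)) :=
    ((differentiableOn_kOf c).differentiableAt hnhds).continuousAt.tendsto.mono_left
      nhdsWithin_le_nhds
  have hid : Tendsto (fun k : ℂ => k) (𝓝[≠] z) (𝓝 z) := tendsto_id.mono_left nhdsWithin_le_nhds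
  have hexp : Tendsto (fun k => Complex.exp (-((leftExponent c k + rightExponent c k) * t)))
      (𝓝[≠] z) (𝓝 (Complex.exp (-((leftExponent c z + rightExponent c z) * t)))) := by
    have hcont : Continuous fun p : ℂ × ℂ => Complex.exp (-((Complex.I * (4 * p.1 ^ 3 -
      6 * c ^ 2 * p.1) + -(Complex.I * (4 * p.2 ^ 3))) * t)) := by fun_prop
    have := (hcont.tendsto (z, kOf c z)).comp (hid.prodMk_nhds hkof)
    simpa only [Function.comp_def, leftExponent, rightExponent] using this
  have hφ := ((ht'.differentiableOn_rightJost x).differentiableAt hnhds).continuousAt.tendsto.mono_left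
    (nhdsWithin_le_nhds (s := {z}ᶜ))
  have he : Tendsto (fun k : ℂ => Complex.exp (-Complex.I * k * x)) (𝓝[≠] z)
      (𝓝 (Complex.exp (-Complex.I * z * x))) :=
    ((by fun_prop : Continuous fun k : ℂ => Complex.exp (-Complex.I * k * x)).tendsto _).mono_left
      nhdsWithin_le_nhds
  have hlim := ((hexp.mul ((hid.const_mul (2 * Complex.I)).mul hslope)).mul hφ).mul he
  have hval : Complex.exp (-((leftExponent c z + rightExponent c z) * t)) *
      (2 * Complex.I * z * (2 * z * μ * (I₀ : ℂ))⁻¹) * jost (fun x => q x t) (kOf c z) x *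
      Complex.exp (-Complex.I * z * x) =
      Complex.I * (leftNorming (fun x => q x 0) c a : ℂ) ^ 2 * Complex.exp (t * phase c x t z) *
        incoming (fun x => q x t) c x z := by
    rw [hq.proportional_time him.le hμ t x, mul_phase c x ht, ht'.incoming_eq him.le,
      ← Complex.ofReal_pow, hsq, Complex.ofReal_inv]
    have e1 : Complex.exp (-2 * leftExponent c z * t - 2 * Complex.I * z * x) *
        Complex.exp (Complex.I * z * x) =
        Complex.exp (-((leftExponent c z + rightExponent c z) * t)) *
        Complex.exp ((rightExponent c z - leftExponent c z) * t) *
        Complex.exp (-Complex.I * z * x) := by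
      rw [← Complex.exp_add, ← Complex.exp_add, ← Complex.exp_add]; congr 1; ring
    -- The unknown constant `μ` cancels, leaving `i γ²` with the initial norming constant.
    have e2 : 2 * Complex.I * z * (2 * z * μ * (I₀ : ℂ))⁻¹ * μ = Complex.I * (I₀ : ℂ)⁻¹ := by
      field_simp
    calc _ = (2 * Complex.I * z * (2 * z * μ * (I₀ : ℂ))⁻¹ * μ) * leftJost (fun x => q x t) c z x *
          (Complex.exp (-((leftExponent c z + rightExponent c z) * t)) *
          Complex.exp ((rightExponent c z - leftExponent c z) * t) *
          Complex.exp (-Complex.I * z * x)) := by ring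
      _ = _ := by rw [e2, ← e1]; ring
  rw [hval] at hlim
  refine hlim.congr' ?_
  filter_upwards [self_mem_nhdsWithin, mem_nhdsWithin_of_mem_nhds hnhds] with k hk hk'
  have hkz : k - z ≠ 0 := sub_ne_zero.2 hk
  have hs : (slope (jostWronskian (fun x => q x 0) c) z k)⁻¹ =
      (k - z) / jostWronskian (fun x => q x 0) c k := by
    rw [slope_def_field, hW, sub_zero, inv_div]
  rw [transmitted, ht'.jostRight_eq (upperOpen_subset hk'),
    hq.leftTransmission_time (upperOpen_subset hk'), leftTransmission, hs]
  ring

theorem poleData (hq : IsKdVSolution c q) {B : ℝ} (hB : ∀ x, |q x 0| ≤ B) (hmono : StrictMono κ)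
    (hκ : Set.range κ = leftDiscreteSpectrum (fun x => q x 0) c) (hε : 0 < ε)
    (hε₁ : ∀ j, ε < κ j / 4) (hε₂ : ∀ i j, i < j → ε < (κ j - κ i) / 4) (ht : t ≠ 0) :
    PoleData ε κ (residueConst c x t κ fun j => leftNorming (fun y => q y 0) c (κ j))
      (transmitted (fun y => q y t) c x) (incoming (fun y => q y t) c x) where
  pos := hε
  lower j := by linarith [hε₁ j]
  separated i j hij := by
    rcases lt_or_gt_of_ne hij with h | h
    · rw [abs_of_neg (sub_neg.2 (hmono h))]; linarith [hε₂ i j h]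
    · rw [abs_of_pos (sub_pos.2 (hmono h))]; linarith [hε₂ j i h]
  differentiableAt_fst k hk hne := (hq.stepPotential t).differentiableAt_transmitted hk
    (hq.wronskian_ne_zero_of_notMem hB hκ hk hne)
  differentiableAt_snd k hk := (hq.stepPotential t).differentiableAt_incoming hk
  residue j := by
    have hmem : κ j ∈ leftDiscreteSpectrum (fun x => q x 0) c := hκ ▸ Set.mem_range_self j
    exact hq.tendsto_residue ht hmem.1
      (((hq.stepPotential 0).mem_leftDiscreteSpectrum_iff hB hmem.1).1 hmem)

/-- With `a = T₁ φ e^{-isx}`, `b = φ₁ e^{isx}` and `u = e^{tΦ₁}`, the boundary values are `m₊ = (a,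
b)` and `m₋ = (conj b, conj a)`. The relation `a = conj b + R₁ u b` and its conjugate, with `conj u
= u⁻¹`, give both components. -/
theorem jump_real (hq : IsKdVSolution c q) (hc : 0 < c)
    (hres : jostWronskian (fun x => q x 0) c 0 ≠ 0) (ht : t ≠ 0) {γ : Fin N → ℝ}
    (h : PoleData ε κ (residueConst c x t κ γ) (transmitted (fun y => q y t) c x)
      (incoming (fun y => q y t) c x)) (s : ℝ) :
    HasJump (rhVector q c x t ε κ γ) {z | 0 < z.im} {z | z.im < 0} (s : ℂ)
      !![1 - (‖leftReflection (fun y => q y 0) c s‖ : ℂ) ^ 2,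
        -(starRingEnd ℂ) (leftReflection (fun y => q y 0) c s) *
          Complex.exp (-t * phase c x t s);
        leftReflection (fun y => q y 0) c s * Complex.exp (t * phase c x t s), 1] := by
  have hs := hq.stepPotential t
  have hW := hq.wronskian_real_ne_zero hc hres
  refine ⟨![transmitted (fun y => q y t) c x s, incoming (fun y => q y t) c x s],
    ![incoming (fun y => q y t) c x (-s : ℝ), transmitted (fun y => q y t) c x (-s : ℝ)], ?_, ?_, ?_⟩
  · refine (tendsto_vec (h.tendsto_real (hs.tendsto_transmitted (hW s t)))
      (hs.tendsto_incoming s)).congr' ?_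
    filter_upwards [self_mem_nhdsWithin] with z hz
    exact (rhVector_upper h hz).symm
  · have hneg : Tendsto (fun z : ℂ => -z) (𝓝[{z | z.im < 0}] (s : ℂ))
        (𝓝[upperOpen] ((-s : ℝ) : ℂ)) := by
      refine tendsto_nhdsWithin_iff.2 ⟨?_, ?_⟩
      · rw [Complex.ofReal_neg]
        exact continuous_neg.continuousAt.tendsto.mono_left nhdsWithin_le_nhds
      · filter_upwards [self_mem_nhdsWithin] with z hz
        simpa [upperOpen] using hz
    refine (tendsto_vec ((hs.tendsto_incoming (-s)).comp hneg)
      ((h.tendsto_real (hs.tendsto_transmitted (hW (-s) t))).comp hneg)).congr' ?_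
    filter_upwards [self_mem_nhdsWithin] with z hz
    exact (rhVector_lower h hz).symm
  · rw [hs.incoming_neg, hs.transmitted_neg hc.le, vecMul_two]
    have e1 := hs.transmitted_real (x := x) (hW s t)
    have e0 : Complex.exp (t * phase c x t s) = Complex.exp (-2 * leftExponent c s * t) *
        Complex.exp (-2 * Complex.I * s * x) := by
      rw [← Complex.exp_add, mul_phase c x ht]; congr 1; ring
    rw [hq.leftReflection_time (hW s 0), mul_right_comm (Complex.exp _), ← e0] at e1
    have e2 : (starRingEnd ℂ) (Complex.exp (t * phase c x t s)) =
        Complex.exp (-t * phase c x t s) := by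
      rw [← Complex.exp_conj]
      congr 1
      simp [phase, Complex.conj_ofNat]
      ring
    have e3 : Complex.exp (t * phase c x t s) * Complex.exp (-t * phase c x t s) = 1 := by
      rw [← Complex.exp_add]; simp
    have e4 := congrArg (starRingEnd ℂ) e1
    simp only [map_add, map_mul, Complex.conj_conj, e2] at e4
    have e5 := Complex.mul_conj' (leftReflection (fun y => q y 0) c s)
    generalize transmitted (fun y => q y t) c x s = a at *
    generalize incoming (fun y => q y t) c x s = b at *
    generalize leftReflection (fun y => q y 0) c s = r at *
    generalize Complex.exp (t * phase c x t s) = u at *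
    generalize Complex.exp (-t * phase c x t s) = v at *
    rw [← e5]
    congr 1
    · linear_combination e1 - r * u * e4 - ((starRingEnd ℂ) b * r * (starRingEnd ℂ) r) * e3
    · congr 1
      linear_combination -e4

theorem solvesRHP (hq : IsKdVSolution c q) (hc : 0 < c) {γ : Fin N → ℝ}
    (hres : jostWronskian (fun x => q x 0) c 0 ≠ 0) (ht : t ≠ 0)
    (h : PoleData ε κ (residueConst c x t κ γ) (transmitted (fun y => q y t) c x)
      (incoming (fun y => q y t) c x)) :
    SolvesRHP c x t ε (leftReflection (fun y => q y 0) c) κ γ (rhVector q c x t ε κ γ) where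
  holomorphic k hk := by
    rw [contour, Set.mem_compl_iff, Set.mem_union, not_or, Set.mem_iUnion, not_exists] at hk
    obtain ⟨hk0, hks⟩ := hk
    refine DifferentiableAt.differentiableWithinAt ?_
    rcases lt_or_gt_of_ne (show k.im ≠ 0 from hk0) with hlt | hgt
    · have hlt' : 0 < (-k).im := by simpa using hlt
      have ho : IsOpen {z : ℂ | z.im < 0} := isOpen_lt Complex.continuous_im continuous_const
      have hev : rhVector q c x t ε κ γ =ᶠ[𝓝 k] fun k => ![incoming (fun y => q y t) c x (-k),
          regularized ε κ (residueConst c x t κ γ) (transmitted (fun y => q y t) c x)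
            (incoming (fun y => q y t) c x) (-k)] := by
        filter_upwards [ho.mem_nhds hlt] with z hz using rhVector_lower h hz
      refine DifferentiableAt.congr_of_eventuallyEq ?_ hev
      have h1 := (h.differentiableAt_snd (-k) hlt').comp k differentiable_neg.differentiableAt
      have h2 := (h.differentiableAt_regularized hlt' fun j hj => hks j (Or.inr (by
        rw [mem_sphere_iff_norm] at hj ⊢
        rw [← hj, ← norm_neg]; congr 1; ring))).comp k differentiable_neg.differentiableAt
      refine differentiableAt_pi.2 fun i => ?_
      fin_cases i
      · simpa [Function.comp_def] using h1
      · simpa [Function.comp_def] using h2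
    · have hev : rhVector q c x t ε κ γ =ᶠ[𝓝 k] fun k => ![
          regularized ε κ (residueConst c x t κ γ) (transmitted (fun y => q y t) c x)
            (incoming (fun y => q y t) c x) k, incoming (fun y => q y t) c x k] := by
        filter_upwards [isOpen_upperOpen.mem_nhds hgt] with z hz using rhVector_upper h hz
      refine DifferentiableAt.congr_of_eventuallyEq ?_ hev
      have h1 := h.differentiableAt_snd k hgt
      have h2 := h.differentiableAt_regularized hgt fun j hj => hks j (Or.inl hj)
      refine differentiableAt_pi.2 fun i => ?_
      fin_cases i
      · simpa using h2
      · simpa using h1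
  jump_outer s _ := hq.jump_real hc hres ht h s
  -- On `[-c, c]` the general jump specializes because `|R₁| = 1` annihilates the diagonal entry.
  jump_inner s hs := by
    have h1 := hq.jump_real hc hres ht h s
    have h2 := (hq.stepPotential 0).norm_leftReflection hs (hq.wronskian_real_ne_zero hc hres s 0)
    rw [Complex.mul_conj'] at h2
    rwa [h2, sub_self] at h1
  jump_upper j k hk := by
    have hk' := mem_sphere_iff_norm.1 hk
    have him : 0 < k.im := h.im_pos_of_mem_ball (j := j) (by linarith [h.pos])
    obtain ⟨h1, h2⟩ := h.tendsto_sphere hk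
    have hB := (h.differentiableAt_snd k him).continuousAt.tendsto
    have hup := isOpen_upperOpen.mem_nhds him
    refine ⟨_, _, (tendsto_vec h1 (hB.mono_left nhdsWithin_le_nhds)).congr' ?_,
      (tendsto_vec h2 (hB.mono_left nhdsWithin_le_nhds)).congr' ?_, ?_⟩
    · filter_upwards [mem_nhdsWithin_of_mem_nhds hup] with z hz using (rhVector_upper h hz).symm
    · filter_upwards [mem_nhdsWithin_of_mem_nhds hup] with z hz using (rhVector_upper h hz).symm
    · rw [vecMul_two, residueConst]
      congr 1
      · ring
      · congr 1; ring
  -- The map `k ↦ -k` carries this circle to the upper one. The positive side is now the exterior,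
  -- so the uncorrected limit belongs to `m₊`.
  jump_lower j k hk := by
    have hk2 : -k ∈ Metric.sphere (Complex.I * (κ j : ℂ)) ε := by
      rw [mem_sphere_iff_norm] at hk ⊢
      rw [← hk, ← norm_neg]; congr 1; ring
    have hk' := mem_sphere_iff_norm.1 hk2
    have him : 0 < (-k).im := h.im_pos_of_mem_ball (j := j) (by linarith [h.pos])
    have hnorm : ∀ z : ℂ, ‖-z - Complex.I * κ j‖ = ‖z - -(Complex.I * κ j)‖ := fun z => by
      rw [← norm_neg]; congr 1; ring
    have hneg : ∀ {P P' : Set ℂ}, (∀ z ∈ P, -z ∈ P') →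
        Tendsto (fun z : ℂ => -z) (𝓝[P] k) (𝓝[P'] (-k)) := fun hP =>
      tendsto_nhdsWithin_iff.2 ⟨continuous_neg.continuousAt.tendsto.mono_left nhdsWithin_le_nhds,
        by filter_upwards [self_mem_nhdsWithin] with z hz using hP z hz⟩
    obtain ⟨h1, h2⟩ := h.tendsto_sphere hk2
    have hB := (h.differentiableAt_snd (-k) him).continuousAt.tendsto.comp
      (continuous_neg.tendsto k)
    have ho : IsOpen {z : ℂ | z.im < 0} := isOpen_lt Complex.continuous_im continuous_const
    have hlow := ho.mem_nhds (show k.im < 0 by simpa using him)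
    refine ⟨_, _, (tendsto_vec (hB.mono_left nhdsWithin_le_nhds) (h2.comp (hneg fun z hz => ?_))).congr' ?_,
      (tendsto_vec (hB.mono_left nhdsWithin_le_nhds) (h1.comp (hneg fun z hz => ?_))).congr' ?_, ?_⟩
    · rw [Set.mem_compl_iff, mem_closedBall_iff_norm] at hz ⊢
      rwa [hnorm]
    · filter_upwards [mem_nhdsWithin_of_mem_nhds hlow] with z hz using (rhVector_lower h hz).symm
    · rw [mem_ball_iff_norm] at hz ⊢
      rwa [hnorm]
    · filter_upwards [mem_nhdsWithin_of_mem_nhds hlow] with z hz using (rhVector_lower h hz).symm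
    · rw [vecMul_two, residueConst, phase_neg, neg_mul_neg,
        show -k - Complex.I * κ j = -(k + Complex.I * κ j) by ring, div_neg]
      congr 1
      · ring
      · congr 1; ring
  symmetry k hk := by
    have hk0 : k.im ≠ 0 := fun h0 => hk (Or.inl h0)
    rcases lt_or_gt_of_ne hk0 with hlt | hgt
    · rw [rhVector_upper h (k := -k) (by simpa using hlt), rhVector_lower h hlt, vecMul_two]
      simp
    · rw [rhVector_lower h (k := -k) (by simpa using hgt), rhVector_upper h hgt, vecMul_two]
      simp
  normalization := by
    refine ((hq.stepPotential t).tendsto_leftVector x).congr' ?_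
    filter_upwards [h.eventually_regularized_eq, eventually_gt_atTop 0] with s hs hs0
    have him : 0 < (Complex.I * (s : ℂ)).im := by simpa using hs0
    rw [rhVector_upper h him, hs, leftVector_upper _ him]

end IsKdVSolution
end StepKdV
end

theorem theorem6p1 (c C₀ : ℝ) (hc : 0 < c) (hC₀ : c < C₀) (q : ℝ → ℝ → ℝ)
    (hdata : StepKdV.SteplikeData c C₀ (fun x => q x 0))
    (hq : StepKdV.IsKdVSolution c q)
    (hnonres : StepKdV.jostWronskian (fun x => q x 0) c 0 ≠ 0) :
    (StepKdV.leftDiscreteSpectrum (fun x => q x 0) c).Finite ∧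
    ∀ (N : ℕ) (κ : Fin N → ℝ), StrictMono κ →
      Set.range κ = StepKdV.leftDiscreteSpectrum (fun x => q x 0) c →
      ∀ ε : ℝ, 0 < ε → (∀ j, ε < κ j / 4) → (∀ i j, i < j → ε < (κ j - κ i) / 4) →
      ∀ x t : ℝ, t ≠ 0 →
        StepKdV.SolvesRHP c x t ε (StepKdV.leftReflection (fun y => q y 0) c) κ
          (fun j => StepKdV.leftNorming (fun y => q y 0) c (κ j))
          (StepKdV.rhVector q c x t ε κ
            (fun j => StepKdV.leftNorming (fun y => q y 0) c (κ j))) := by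
  obtain ⟨B, hB⟩ := hdata.exists_bound
  refine ⟨(hq.stepPotential 0).finite_leftDiscreteSpectrum hB hnonres, ?_⟩
  intro N κ hmono hκ ε hε hε₁ hε₂ x t ht
  exact hq.solvesRHP hc hnonres ht (hq.poleData hB hmono hκ hε hε₁ hε₂ ht)
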